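/- Let $n\ge1$. Balls are closed; for a ball $B=B(x,r)\subset\mathbb R^{n+1}$ put $\lambda B=B(x,\lambda r)$, $\operatorname{rad}(B)=r$. For a (positive) Radon measure $\mu$ on $\mathbb R^{n+1}$ put $$\Theta_\mu(B)=\frac{\mu(B)}{r^n},\qquad \mathcal P_\mu(B)=\sum_{j\ge0}2^{-j}\Theta_\mu(2^jB),\qquad M_n\mu(x)=\sup_{r>0}\Theta_\mu(B(x,r)).$$ $B$ is $(\mathcal P_\mu,C)$-doubling if $\mathcal P_\mu(B)\le C\,\Theta_\mu(B)$, and $(\mu,C)$-good if $\mu(B)>0$ and $\int_BM_n(\chi_B\mu)\,d\mu\le C\,\Theta_\mu(B)\,\mu(B)$. Let $\mathcal R\mu(x)=\int\frac{x-y}{|x-y|^{n+1}}\,d\mu(y)$ be the $n$-dimensional Riesz transform, $\mathcal R_*\mu(x)=\sup_{\varepsilon>0}\big|\int_{|x-y|>\varepsilon}\frac{x-y}{|x-y|^{n+1}}\,d\mu(y)\big|$, and let $m_{\mu,S}(f)$ be the $\mu$-average of $f$ over $S$. (If $\mathcal R\mu$ is only defined modulo additive constants, because $\int(1+|y|)^{-n}d\mu(y)=\infty$,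 then $\mathcal R\mu(x)-m_{\mu,S}(\mathcal R\mu)$ is understood as the average over $z\in S$ of $\int\big(\frac{x-y}{|x-y|^{n+1}}-\frac{z-y}{|z-y|^{n+1}}\big)d\mu(y)$.) Let $\mathcal D_\mu=\bigcup_{k\ge0}\mathcal D_{\mu,k}$ be a David--Mattila lattice for $\mu$ with parameters $K_0>1$, $A_0>5000K_0$, $K>0$. That is, writing $E=\operatorname{supp}\mu$: each $\mathcal D_{\mu,k}$ is a partition of $E$ into Borel sets ("cubes of generation $k$"), nested in $k$; each $Q\in\mathcal D_{\mu,k}$ has a ball $B(Q)=B(x_Q,r(Q))$ with $x_Q\in E$, $A_0^{-k}\le r(Q)\le K_0A_0^{-k}$, $E\cap B(Q)\subset Q\subset 28B(Q)$, the balls $5B(Q)$, $Q\in\mathcal D_{\mu,k}$, being disjoint; for all $l\ge0$, the set of points of $E\setminus Q$ at distance less than $A_0^{-k-l}$ from $Q$ together with the points of $Q$ at distance less than $A_0^{-k-l}$ from $E\setminus Q$ has $\mu$-measure at most $(K^{-1}K_0^{-3(n+1)-1}A_0)^{-l}\mu(90B(Q))$; and if $\mu(100B(Q))>K_0\,\mu(B(Q))$,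 then $r(Q)=A_0^{-k}$ and $\mu(100B(Q))\le K_0^{-l}\mu(100^{l+1}B(Q))$ for all $l\ge1$ with $100^l\le K_0$. For $Q\in\mathcal D_{\mu,k}$ let $\ell(Q)=56K_0A_0^{-k}$, and let $2Q$ be the union of the $P\in\mathcal D_{\mu,k}$ with $\operatorname{dist}(x_Q,P)\le2\ell(Q)$. Given a ball $B_0$, let $R_0$ be the union of the maximal cubes $Q\in\mathcal D_\mu$ such that $2Q\subset\frac32B_0$ and $Q\cap B_0\ne\varnothing$. **Statement.** Let $\alpha,C_2>0$. For each $\delta_0>0$ there is a constant $c_1=c_1(n,\alpha,\delta_0,C_2)>0$, and for all $C_0,\tau,\eta,\rho>0$ there is $\delta=\delta(n,\alpha,C_2,C_0,\tau,\eta,\rho)\in(0,\frac12)$, such that the following holds whenever $\delta_0>0$ and $0<\delta_1\le\delta$. Let $\mu$ be a Radon measure on $\mathbb R^{n+1}$, $B_0$ a $(\mathcal P_\mu,C_0)$-doubling ball, $\mathcal D_\mu$ a David--Mattila lattice for $\mu$, and $R_0$ as above. Suppose that 1. $\mu=h\,\mathcal L^{n+1}$ in $2B_0$ for some $h\in L^\infty(\mu)$,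 and $M_n(\chi_{3B_0}\mu)$, $\mathcal R_*(\chi_{3B_0}\mu)\in L^2(\mu|_{2B_0})$; 2. there is a ball $B_1=B(x_1,r_1)$ centered in $B_0$ with $\Theta_\mu(B_1)\ge\alpha\,\Theta_\mu(B_0)$ and $\delta_0\operatorname{rad}(B_0)\le\operatorname{rad}(B_1)\le\delta_1\operatorname{rad}(B_0)$; 3. $\operatorname{supp}\mu\cap B(x_1,\rho\operatorname{rad}(B_0))\subset R_0$; 4. with $N=\lfloor\log_2(\operatorname{rad}(B_0)/\operatorname{rad}(B_1))\rfloor$, at least $\eta N$ of the balls $2^jB_1$, $0\le j\le N$, are $(\mu,C_2)$-good; 5. $\displaystyle\int_{2B_0\setminus R_0}\int_{R_0}\frac1{|x-y|^n}\,d\mu(x)\,d\mu(y)\le\tau\,\Theta_\mu(B_0)\,\mu(2B_0)$. Then $$\int_{R_0}|\mathcal R\mu-m_{\mu,R_0}(\mathcal R\mu)|^2\,d\mu\ \ge\ c_1\,\Theta_\mu(B_0)^2\,\mu(B_0).$$ In particular $c_1$ does not depend on $\|h\|_{L^\infty(\mu)}$. -/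

import Mathlib

open MeasureTheory Metric Set
open scoped ENNReal NNReal

noncomputable section

/-- The Euclidean space `ℝ^{n+1}`. -/
abbrev Euc (n : ℕ) : Type := EuclideanSpace ℝ (Fin (n + 1))

variable {n : ℕ}

/-- The `n`-dimensional density `μ(B(x,r)) / r^n` of the closed ball `B(x,r)`, `r > 0`. -/
def ballDensity (μ : Measure (Euc n)) (x : Euc n) (r : ℝ) : ℝ≥0∞ :=
  μ (closedBall x r) / ENNReal.ofReal r ^ n

/-- The Poisson-type sum `∑_{j ≥ 0} 2^{-j} Θ_μ(2^j B)` of the ball `B = B(x,r)`. -/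
def poissonDensity (μ : Measure (Euc n)) (x : Euc n) (r : ℝ) : ℝ≥0∞ :=
  ∑' j : ℕ, (2 ^ j : ℝ≥0∞)⁻¹ * ballDensity μ x (2 ^ j * r)

/-- The ball `B(x,r)` is `(P_μ, C)`-doubling. -/
def IsPDoubling (μ : Measure (Euc n)) (C : ℝ) (x : Euc n) (r : ℝ) : Prop :=
  poissonDensity μ x r ≤ ENNReal.ofReal C * ballDensity μ x r

/-- The radial maximal function `M_n μ(x) = sup_{r>0} μ(B(x,r)) / r^n`. -/
def maximalDensity (μ : Measure (Euc n)) (x : Euc n) : ℝ≥0∞ :=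
  ⨆ (r : ℝ) (_ : 0 < r), ballDensity μ x r

/-- The ball `B = B(x,r)` is `(μ, C)`-good: `μ(B) > 0` and
`∫_B M_n(χ_B μ) dμ ≤ C Θ_μ(B) μ(B)`. -/
def IsGoodBall (μ : Measure (Euc n)) (C : ℝ) (x : Euc n) (r : ℝ) : Prop :=
  0 < μ (closedBall x r) ∧
    ∫⁻ y in closedBall x r, maximalDensity (μ.restrict (closedBall x r)) y ∂μ ≤
      ENNReal.ofReal C * ballDensity μ x r * μ (closedBall x r)

/-- The Riesz kernel `K(z) = z / |z|^{n+1}` in `ℝ^{n+1}`. -/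
def rieszKernel (z : Euc n) : Euc n := (‖z‖ ^ (n + 1))⁻¹ • z

/-- The Riesz transform `R μ(x) = ∫ K(x - y) dμ(y)`. -/
def rieszTransform (μ : Measure (Euc n)) (x : Euc n) : Euc n :=
  ∫ y, rieszKernel (x - y) ∂μ

/-- The truncated Riesz transform `R_ε μ(x) = ∫_{|x-y|>ε} K(x - y) dμ(y)`. -/
def rieszTruncated (μ : Measure (Euc n)) (ε : ℝ) (x : Euc n) : Euc n :=
  ∫ y in {y | ε < dist x y}, rieszKernel (x - y) ∂μ

/-- The maximal Riesz transform `R_* μ(x) = sup_{ε>0} |R_ε μ(x)|`. -/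
def rieszMaximal (μ : Measure (Euc n)) (x : Euc n) : ℝ≥0∞ :=
  ⨆ (ε : ℝ) (_ : 0 < ε), ‖rieszTruncated μ ε x‖ₑ

/-- The function `R μ - m_{μ,S}(R μ)`, where `m_{μ,S}` is the `μ`-average over `S`, written as
the average over `z ∈ S` of `R μ(x) - R μ(z) = ∫ (K(x - y) - K(z - y)) dμ(y)`.
The integrand decays one order faster in `y` than `K(x - y)`. So this makes sense also when `R μ`
is only defined modulo constants (`∫ dμ(y) / (1 + |y|)^{n+1} < ∞`), and it is the literal
difference when `R μ` is given by convergent integrals, see `rieszOscillation_eq`. -/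
def rieszOscillation (μ : Measure (Euc n)) (S : Set (Euc n)) (x : Euc n) : Euc n :=
  ⨍ z in S, (∫ y, (rieszKernel (x - y) - rieszKernel (z - y)) ∂μ) ∂μ

theorem rieszOscillation_eq (μ : Measure (Euc n)) (S : Set (Euc n)) (x : Euc n)
    (h0 : μ S ≠ 0) (hfin : μ S ≠ ∞)
    (hx : Integrable (fun y => rieszKernel (x - y)) μ)
    (hz : ∀ᵐ z ∂μ.restrict S, Integrable (fun y => rieszKernel (z - y)) μ)
    (hR : IntegrableOn (rieszTransform μ) S μ) :
    rieszOscillation μ S x = rieszTransform μ x - ⨍ z in S, rieszTransform μ z ∂μ := by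
  have e : (fun z => ∫ y, (rieszKernel (x - y) - rieszKernel (z - y)) ∂μ)
      =ᵐ[μ.restrict S] fun z => rieszTransform μ x - rieszTransform μ z := by
    filter_upwards [hz] with z hz'
    exact integral_sub hx hz'
  have hr : μ.real S ≠ 0 := by
    rw [Measure.real, ENNReal.toReal_ne_zero]
    exact ⟨h0, hfin⟩
  haveI : IsFiniteMeasure (μ.restrict S) := ⟨by simpa using hfin.lt_top⟩
  rw [rieszOscillation, average_congr e, setAverage_eq, setAverage_eq,
    integral_sub (integrable_const _) hR, setIntegral_const, smul_sub, smul_smul,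
    inv_mul_cancel₀ hr, one_smul]

/-- A David–Mattila lattice of cubes associated with the measure `μ` on `ℝ^{n+1}`, i.e. a choice
of the partitions `D_{μ,k}`, `k ≥ 0`, of `supp μ`, with small boundaries. Here `C₀`, `A₀` are the
parameters of the lattice and `K` is the constant in the small boundary condition. A cube is a
pair (generation `k`, set `Q ∈ cubes k`), `B(Q) = B(center k Q, radius k Q)`. -/
structure DavidMattilaLattice (μ : Measure (Euc n)) where
  C₀ : ℝ
  A₀ : ℝ
  K : ℝ
  one_lt_C₀ : 1 < C₀
  lt_A₀ : 5000 * C₀ < A₀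
  K_pos : 0 < K
  cubes : ℕ → Set (Set (Euc n))
  center : ℕ → Set (Euc n) → Euc n
  radius : ℕ → Set (Euc n) → ℝ
  measurableSet : ∀ k, ∀ Q ∈ cubes k, MeasurableSet Q
  sUnion_cubes : ∀ k, ⋃₀ cubes k = μ.support
  pairwiseDisjoint : ∀ k, (cubes k).PairwiseDisjoint id
  nested : ∀ k l, k < l → ∀ Q ∈ cubes l, ∀ R ∈ cubes k, Disjoint Q R ∨ Q ⊆ R
  center_mem : ∀ k, ∀ Q ∈ cubes k, center k Q ∈ μ.support
  le_radius : ∀ k, ∀ Q ∈ cubes k, (A₀ ^ k)⁻¹ ≤ radius k Q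
  radius_le : ∀ k, ∀ Q ∈ cubes k, radius k Q ≤ C₀ * (A₀ ^ k)⁻¹
  ball_subset : ∀ k, ∀ Q ∈ cubes k, μ.support ∩ closedBall (center k Q) (radius k Q) ⊆ Q
  subset_ball : ∀ k, ∀ Q ∈ cubes k,
    Q ⊆ μ.support ∩ closedBall (center k Q) (28 * radius k Q)
  disjoint_balls : ∀ k,
    (cubes k).PairwiseDisjoint fun Q => closedBall (center k Q) (5 * radius k Q)
  small_boundary : ∀ k, ∀ Q ∈ cubes k, ∀ l : ℕ,
    μ ({x | x ∈ μ.support \ Q ∧ ∃ y ∈ Q, dist x y < (A₀ ^ (k + l))⁻¹} ∪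
        {x | x ∈ Q ∧ ∃ y ∈ μ.support \ Q, dist x y < (A₀ ^ (k + l))⁻¹}) ≤
      ENNReal.ofReal (((K⁻¹ * (C₀ ^ (3 * (n + 1) + 1))⁻¹ * A₀) ^ l)⁻¹) *
        μ (closedBall (center k Q) (90 * radius k Q))
  nondoubling : ∀ k, ∀ Q ∈ cubes k,
    ENNReal.ofReal C₀ * μ (closedBall (center k Q) (radius k Q)) <
        μ (closedBall (center k Q) (100 * radius k Q)) →
      radius k Q = (A₀ ^ k)⁻¹ ∧
      ∀ l : ℕ, 1 ≤ l → (100 : ℝ) ^ l ≤ C₀ →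
        μ (closedBall (center k Q) (100 * radius k Q)) ≤
          ENNReal.ofReal ((C₀ ^ l)⁻¹) *
            μ (closedBall (center k Q) (100 ^ (l + 1) * radius k Q))

namespace DavidMattilaLattice

variable {μ : Measure (Euc n)} (D : DavidMattilaLattice μ)

/-- The side length `ℓ(Q) = 56 C₀ A₀^{-k}` of the cubes of generation `k`. -/
def sideLength (k : ℕ) : ℝ := 56 * D.C₀ * (D.A₀ ^ k)⁻¹

/-- The set `λ Q`, for a cube `Q` of generation `k`: the union of the cubes `P` of the same
generation with `dist(x_Q, P) ≤ λ ℓ(Q)`. -/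
def dilate (lam : ℝ) (k : ℕ) (Q : Set (Euc n)) : Set (Euc n) :=
  ⋃₀ {P | P ∈ D.cubes k ∧ infDist (D.center k Q) P ≤ lam * D.sideLength k}

/-- `Q` is a cube of the lattice with `2Q ⊆ (3/2) B₀` and `Q ∩ B₀ ≠ ∅`, where `B₀ = B(x₀,r₀)`. -/
def IsAdmissible (x₀ : Euc n) (r₀ : ℝ) (Q : Set (Euc n)) : Prop :=
  ∃ k, Q ∈ D.cubes k ∧ D.dilate 2 k Q ⊆ closedBall x₀ (3 / 2 * r₀) ∧
    (Q ∩ closedBall x₀ r₀).Nonempty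

/-- The region `R₀`: the union of the maximal cubes `Q` such that `2Q ⊆ (3/2) B₀` and
`Q ∩ B₀ ≠ ∅`, where `B₀ = B(x₀,r₀)`. -/
def region (x₀ : Euc n) (r₀ : ℝ) : Set (Euc n) :=
  ⋃₀ {Q | Maximal (D.IsAdmissible x₀ r₀) Q}

end DavidMattilaLattice

end

/-!
The oscillation of the Riesz transform on the region `R₀` is the field `H + R σ` of the measure
`σ = μ|_{R₀}` in an external field `H`, which is generated by the mass outside `R₀`
(`exists_isExternalField`). The doubling condition for `B₀` and the bound for the interaction
across the boundary of `R₀` make `|H| ≲ Θ(B₀)` near `x₁`, where `H` is harmonic and divergence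
free. The claim is therefore a lower bound for the energy `∫ |H + R σ|² dσ` (`lt_energy`), and it
is proved by contradiction: let the energy be tiny.

*Variation.* Removing a set of mass `m` should not decrease the energy by more than `lam * m`. A
maximal removal of bad sets leaves a set `A` of nearly full measure that is stable in this sense
(`exists_stable_subset`). With `G = H + R(χ_A σ)` and the adjoint transform `T` of `G χ_A σ`, the
first variation `V = |G|² + 2 T` is then at most `lam` almost everywhere on `A`
(`firstVar_le_of_stable`).

*Subharmonicity.* Off the support of `χ_A σ` both `G` and `T` are harmonic, so `|G|² + 2 T` is
subharmonic there, and it is at most `lam` on the support. Hence the excess `(V - 2 lam)₊`, raised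
to the third power to be of class `C²`, is subharmonic in the whole ball where `H` has no sources
(`wmass_mul_excess_le`). In a smaller concentric ball it is bounded by a multiple of `Θ(B₀)²`,
since its square root is bounded in mean by a multiple of `Θ(B₀)`
(`excess_le_of_integral_field_le`).

*Decay.* The excess vanishes on most of `σ`. In a good ball `B` this set carries a measure whose
potential with kernel `|x - y|^{-(n - 1/2)}` is bounded on the set by a multiple of the density.
This kernel is subharmonic off the origin, so comparing the excess with the potential by the
maximum principle gives a fixed factor less than `1` from `16 B` to `2 B` (`le_of_isGoodBall`).
There are many good balls between the scales of `B₁` and of `B₀`, so the excess is as small as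
desired on `2 B₁` (`le_pow_card_of_isGoodBall`).

*Flux.* By Gauss's law the mass of `A ∩ B₁`, which is at least half the mass of `B₁`, produces a
flux of `G` out of `2 B₁` comparable to the density of `B₁` (`wflux_field`). On the other hand
`|G|² = V - 2 T` is at most a small multiple of `Θ(B₀)²` plus `2 |T|`, and `T` is small in mean
because the energy is. This is the contradiction (`flux_contradiction`).

The constants are consistent because `δ₀ rad(B₀) ≤ rad(B₁) ≤ δ₁ rad(B₀)` forces `δ₀ ≤ δ`: with `δ`
at most `1 / C₀` and `ρ`, the quantities `C₀` and `1 / ρ` are at most `1 / δ₀`, and the lower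
bound may depend on them. The number of good scales that the decay needs depends on `τ` and `η` as
well, but not on `δ₀`.

Mean values, harmonicity and fluxes are expressed throughout by integrals against the radial
weight `(1 - |ω|²)₊³`, which replaces surface integrals over spheres by integrals over balls.
-/

noncomputable section

open Filter Topology InnerProductSpace
open scoped Laplacian RealInnerProductSpace ContDiff

namespace RieszLowerBound

variable {n : ℕ}

/-! ### Weighted mean values of functions of class `C²` -/

/-- The radial weight `(1 - |ω|²)_+^k` on the unit ball. -/
def bump (k : ℕ) (w : Euc n) : ℝ := max (1 - ‖w‖ ^ 2) 0 ^ k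

/-- The mean `∫ (1 - |ω|²)_+³ u(x + r ω) dω` (not normalised) of `u` over `B(x,r)`. -/
def wmean {F : Type*} [NormedAddCommGroup F] [NormedSpace ℝ F] (u : Euc n → F) (x : Euc n)
    (r : ℝ) : F := ∫ w, bump 3 w • u (x + r • w)

/-- The total mass of the weight in `wmean`. -/
def wmass (n : ℕ) : ℝ := ∫ w : Euc n, bump 3 w

lemma hasDerivAt_posPart_pow (k : ℕ) (hk : 1 ≤ k) (t : ℝ) :
    HasDerivAt (fun t : ℝ => max t 0 ^ (k + 1)) ((k + 1) * max t 0 ^ k) t := by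
  rcases lt_trichotomy t 0 with h | h | h
  · have : (fun t : ℝ => max t 0 ^ (k + 1)) =ᶠ[𝓝 t] fun _ => 0 := by
      filter_upwards [Iio_mem_nhds h] with s hs
      rw [max_eq_right (le_of_lt hs)]; simp
    rw [max_eq_right h.le, zero_pow (by omega), mul_zero]
    exact (hasDerivAt_const t (0 : ℝ)).congr_of_eventuallyEq this
  · subst h
    rw [max_self, zero_pow (by omega), mul_zero]
    rw [hasDerivAt_iff_isLittleO]
    simp only [max_self, sub_zero, smul_zero]
    have h1 : (fun x' : ℝ => max x' 0 ^ (k + 1) - 0 ^ (k + 1)) =O[𝓝 0] fun x' => x' ^ (k + 1) := by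
      refine Asymptotics.IsBigO.of_bound 1 (Eventually.of_forall fun x' => ?_)
      simp only [ne_eq, Nat.add_eq_zero_iff, one_ne_zero, and_false, not_false_eq_true, zero_pow,
        sub_zero, norm_pow, Real.norm_eq_abs, one_mul]
      refine pow_le_pow_left₀ (abs_nonneg _) ?_ _
      rw [abs_of_nonneg (le_max_right x' (0 : ℝ))]
      exact max_le (le_abs_self _) (abs_nonneg _)
    exact h1.trans_isLittleO (Asymptotics.isLittleO_pow_id (by omega))
  · have : (fun t : ℝ => max t 0 ^ (k + 1)) =ᶠ[𝓝 t] fun t => t ^ (k + 1) := by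
      filter_upwards [Ioi_mem_nhds h] with s hs
      rw [max_eq_left (le_of_lt hs)]
    rw [max_eq_left h.le]
    have := (hasDerivAt_pow (k + 1) t).congr_of_eventuallyEq this
    simpa using this

lemma contDiff_posPart_pow (k m : ℕ) (hk : m ≤ k) :
    ContDiff ℝ m (fun t : ℝ => max t 0 ^ (k + 1)) := by
  induction m generalizing k with
  | zero =>
    rw [Nat.cast_zero, contDiff_zero]
    exact (continuous_id.max continuous_const).pow _
  | succ m ih =>
    have hk1 : 1 ≤ k := by omega
    have : ((m + 1 : ℕ) : ℕ∞ω) = (m : ℕ∞ω) + 1 := by push_cast; rfl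
    rw [this, contDiff_succ_iff_deriv]
    refine ⟨fun t => (hasDerivAt_posPart_pow k hk1 t).differentiableAt, by simp, ?_⟩
    have e : deriv (fun t : ℝ => max t 0 ^ (k + 1)) = fun t => ((k : ℝ) + 1) * max t 0 ^ k :=
      funext fun t => (hasDerivAt_posPart_pow k hk1 t).deriv
    rw [e]
    obtain ⟨k', rfl⟩ : ∃ k', k = k' + 1 := ⟨k - 1, by omega⟩
    exact contDiff_const.mul (ih k' (by omega))

lemma bump_nonneg (k : ℕ) (w : Euc n) : 0 ≤ bump k w := pow_nonneg (le_max_right _ _) _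

lemma bump_le_one (k : ℕ) (w : Euc n) : bump k w ≤ 1 :=
  pow_le_one₀ (le_max_right _ _) (max_le (by nlinarith [sq_nonneg ‖w‖]) zero_le_one)

lemma bump_eq_zero {k : ℕ} (hk : k ≠ 0) {w : Euc n} (hw : 1 ≤ ‖w‖) : bump k w = 0 := by
  rw [bump, max_eq_right (by nlinarith), zero_pow hk]

lemma norm_lt_one_of_bump_ne_zero {k : ℕ} (hk : k ≠ 0) {w : Euc n} (hw : bump k w ≠ 0) :
    ‖w‖ < 1 := by
  by_contra h
  exact hw (bump_eq_zero hk (not_lt.1 h))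

lemma bump_pos (k : ℕ) {w : Euc n} (hw : ‖w‖ < 1) : 0 < bump k w :=
  pow_pos (lt_max_of_lt_left (by nlinarith [norm_nonneg w])) _

@[simp] lemma bump_neg (k : ℕ) (w : Euc n) : bump k (-w) = bump k w := by simp [bump]

lemma contDiff_bump_three : ContDiff ℝ 2 (bump 3 : Euc n → ℝ) :=
  (contDiff_posPart_pow 2 2 le_rfl).comp (contDiff_const.sub (contDiff_norm_sq ℝ))

lemma continuous_bump (k : ℕ) : Continuous (bump k : Euc n → ℝ) := by
  unfold bump; fun_prop

lemma hasCompactSupport_bump {k : ℕ} (hk : k ≠ 0) : HasCompactSupport (bump k : Euc n → ℝ) := by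
  refine HasCompactSupport.intro (isCompact_closedBall (0 : Euc n) 1) fun x hx => ?_
  refine bump_eq_zero hk ?_
  simp only [mem_closedBall, dist_zero_right, not_le] at hx
  exact hx.le

lemma integrable_bump {k : ℕ} (hk : k ≠ 0) : Integrable (bump k : Euc n → ℝ) :=
  (continuous_bump k).integrable_of_hasCompactSupport (hasCompactSupport_bump hk)

lemma wmass_pos (n : ℕ) : 0 < wmass n := by
  unfold wmass
  rw [integral_pos_iff_support_of_nonneg (bump_nonneg 3) (integrable_bump (by norm_num))]
  refine lt_of_lt_of_le (measure_ball_pos volume (0 : Euc n) one_pos) (measure_mono ?_)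
  intro w hw
  exact (bump_pos 3 (by simpa using hw)).ne'

lemma hasFDerivAt_bump_four (w : Euc n) :
    HasFDerivAt (bump 4 : Euc n → ℝ) (-(8 * bump 3 w) • innerSL ℝ w) w := by
  have h1 : HasFDerivAt (fun w : Euc n => 1 - ‖w‖ ^ 2) (-(2 • innerSL ℝ w)) w :=
    (hasStrictFDerivAt_norm_sq w).hasFDerivAt.const_sub 1
  have h2 := (hasDerivAt_posPart_pow 3 (by norm_num) (1 - ‖w‖ ^ 2)).comp_hasFDerivAt w h1
  refine h2.congr_fderiv ?_
  ext v
  simp [bump]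
  ring

lemma integrable_bump_smul {F : Type*} [NormedAddCommGroup F] {k : ℕ} (hk : k ≠ 0)
    [NormedSpace ℝ F] {g : Euc n → F} (hg : ContinuousOn g (closedBall 0 1)) :
    Integrable (fun w => bump k w • g w) := by
  have h1 : IntegrableOn (fun w => bump k w • g w) (closedBall (0 : Euc n) 1) :=
    ((continuous_bump k).continuousOn.smul hg).integrableOn_compact (isCompact_closedBall _ _)
  rwa [integrableOn_iff_integrable_of_support_subset] at h1
  intro w hw
  have : bump k w ≠ 0 := fun h => hw (by simp [h])
  simpa using (norm_lt_one_of_bump_ne_zero hk this).le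

lemma add_smul_mem_closedBall {x w : Euc n} {r : ℝ} (hr : 0 ≤ r) (hw : ‖w‖ ≤ 1) :
    x + r • w ∈ closedBall x r := by
  rw [mem_closedBall, dist_eq_norm, add_sub_cancel_left, norm_smul, Real.norm_of_nonneg hr]
  exact mul_le_of_le_one_right hr hw

lemma continuousOn_comp_add_smul {F : Type*} [NormedAddCommGroup F] {u : Euc n → F}
    {x : Euc n} {r : ℝ} (hr : 0 ≤ r) (hu : ContinuousOn u (closedBall x r)) :
    ContinuousOn (fun w => u (x + r • w)) (closedBall 0 1) :=
  hu.comp (by fun_prop) fun w hw => add_smul_mem_closedBall hr (by simpa using hw)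

lemma integrable_wmean {F : Type*} [NormedAddCommGroup F] [NormedSpace ℝ F] {u : Euc n → F}
    {x : Euc n} {r : ℝ} (hr : 0 ≤ r) (hu : ContinuousOn u (closedBall x r)) :
    Integrable (fun w => bump 3 w • u (x + r • w)) :=
  integrable_bump_smul (by norm_num) (continuousOn_comp_add_smul hr hu)

lemma wmean_zero_radius (u : Euc n → ℝ) (x : Euc n) : wmean u x 0 = wmass n * u x := by
  simp [wmean, wmass, integral_mul_const]

lemma laplacian_eq_sum {u : Euc n → ℝ} (x : Euc n) :
    Δ u x = ∑ i, fderiv ℝ (fderiv ℝ u) x (EuclideanSpace.basisFun (Fin (n + 1)) ℝ i)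
      (EuclideanSpace.basisFun (Fin (n + 1)) ℝ i) := by
  rw [laplacian_eq_iteratedFDeriv_orthonormalBasis u (EuclideanSpace.basisFun (Fin (n + 1)) ℝ)]
  simp [iteratedFDeriv_two_apply]

lemma hasDerivAt_wmean {u : Euc n → ℝ} (hu : ContDiff ℝ 2 u) (hc : HasCompactSupport u)
    (x : Euc n) (r : ℝ) :
    HasDerivAt (wmean u x) (∫ w, bump 3 w * fderiv ℝ u (x + r • w) w) r := by
  have hd : Continuous (fderiv ℝ u) := hu.continuous_fderiv (by norm_num)
  obtain ⟨C, hC⟩ := hd.bounded_above_of_compact_support (hc.fderiv (𝕜 := ℝ))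
  unfold wmean
  have key := hasDerivAt_integral_of_dominated_loc_of_deriv_le (μ := (volume : Measure (Euc n)))
    (F := fun r w => bump 3 w • u (x + r • w)) (x₀ := r) (s := univ)
    (F' := fun r w => bump 3 w * fderiv ℝ u (x + r • w) w)
    (bound := fun w => bump 3 w * C) univ_mem ?_ ?_ ?_ ?_ ?_ ?_
  · exact key.2
  · refine Eventually.of_forall fun s => ?_
    have := hu.continuous
    exact (((continuous_bump 3).smul (this.comp (by fun_prop)))).aestronglyMeasurable
  · exact integrable_bump_smul (by norm_num) (hu.continuous.comp (by fun_prop)).continuousOn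
  · refine Continuous.aestronglyMeasurable ?_
    exact (continuous_bump 3).mul ((hd.comp (by fun_prop)).clm_apply continuous_id)
  · refine Eventually.of_forall fun w s _ => ?_
    rw [norm_mul, Real.norm_of_nonneg (bump_nonneg 3 w)]
    by_cases hw : bump 3 w = 0
    · simp [hw]
    · gcongr
      · exact bump_nonneg 3 w
      refine ((fderiv ℝ u (x + s • w)).le_opNorm w).trans ?_
      have := norm_lt_one_of_bump_ne_zero (by norm_num) hw
      calc _ ≤ C * 1 := by
            gcongr
            · exact (norm_nonneg _).trans (hC x)
            · exact hC _
        _ = C := mul_one C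
  · exact (integrable_bump (by norm_num)).mul_const C
  · refine Eventually.of_forall fun w s _ => ?_
    have h1 : HasDerivAt (fun s : ℝ => x + s • w) w s := by
      simpa using ((hasDerivAt_id s).smul_const w).const_add x
    have h2 := ((hu.differentiable (by norm_num)) (x + s • w)).hasFDerivAt.comp_hasDerivAt s h1
    simpa using h2.const_mul (bump 3 w)

/-- Integration by parts, using that `-8 (1 - |ω|²)_+³ ω` is the gradient of `(1 - |ω|²)_+⁴`. -/
lemma integral_bump_fderiv {u : Euc n → ℝ} (hu : ContDiff ℝ 2 u)
    (x : Euc n) (r : ℝ) :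
    ∫ w, bump 3 w * fderiv ℝ u (x + r • w) w = r / 8 * ∫ w, bump 4 w * Δ u (x + r • w) := by
  set b := EuclideanSpace.basisFun (Fin (n + 1)) ℝ with hb
  have hd : ContDiff ℝ 1 (fderiv ℝ u) := hu.fderiv_right (by norm_num)
  have hdd : Continuous (fderiv ℝ (fderiv ℝ u)) := hd.continuous_fderiv (by norm_num)
  set g : Fin (n + 1) → Euc n → ℝ := fun i w => fderiv ℝ u (x + r • w) (b i) with hg
  have hgd : ∀ i w, HasFDerivAt (g i)
      (r • (fderiv ℝ (fderiv ℝ u) (x + r • w)).flip (b i)) w := by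
    intro i w
    have h1 : HasFDerivAt (fun w : Euc n => x + r • w)
        (r • ContinuousLinearMap.id ℝ (Euc n)) w :=
      ((hasFDerivAt_id w).const_smul r).const_add x
    have h2 := (hd.differentiable (by norm_num) (x + r • w)).hasFDerivAt.comp w h1
    have h3 := h2.clm_apply (hasFDerivAt_const (b i) w)
    refine h3.congr_fderiv ?_
    ext v
    simp
  have hgc : ∀ i, Continuous (g i) := fun i =>
    (hd.continuous.comp (by fun_prop)).clm_apply continuous_const
  have hgdc : ∀ i, Continuous (fun w => fderiv ℝ (fderiv ℝ u) (x + r • w) (b i) (b i)) := fun i =>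
    ((hdd.comp (by fun_prop)).clm_apply continuous_const).clm_apply continuous_const
  have e1 : ∀ w, fderiv ℝ u (x + r • w) w = ∑ i, w i * g i w := by
    intro w
    rw [← congrArg (fderiv ℝ u (x + r • w)) (b.sum_repr w)]
    simp only [map_sum, map_smul, smul_eq_mul, hg]
    simp [hb]
  have ibp : ∀ i, ∫ w, bump 3 w * (w i * g i w)
      = r / 8 * ∫ w, bump 4 w * fderiv ℝ (fderiv ℝ u) (x + r • w) (b i) (b i) := by
    intro i
    have hfd : ∀ w : Euc n, fderiv ℝ (bump 4 : Euc n → ℝ) w (b i) = -(8 * bump 3 w) * w i := by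
      intro w
      rw [(hasFDerivAt_bump_four w).fderiv]
      simp [hb, EuclideanSpace.inner_single_right]
    have hgf : ∀ w : Euc n, fderiv ℝ (g i) w (b i)
        = r * fderiv ℝ (fderiv ℝ u) (x + r • w) (b i) (b i) := by
      intro w
      rw [(hgd i w).fderiv]
      simp
    have key := integral_mul_fderiv_eq_neg_fderiv_mul_of_integrable
      (μ := (volume : Measure (Euc n))) (f := (bump 4 : Euc n → ℝ)) (g := g i) (v := b i)
      ?_ ?_ ?_ (fun w _ => (hasFDerivAt_bump_four w).differentiableAt)
      (fun w _ => (hgd i w).differentiableAt)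
    · simp only [hfd, hgf] at key
      have l1 : ∫ w, bump 4 w * (r * fderiv ℝ (fderiv ℝ u) (x + r • w) (b i) (b i))
          = r * ∫ w, bump 4 w * fderiv ℝ (fderiv ℝ u) (x + r • w) (b i) (b i) := by
        rw [← integral_const_mul]; congr 1; ext w; ring
      have l2 : ∫ w : Euc n, -(8 * bump 3 w) * w i * g i w
          = -(8 * ∫ w, bump 3 w * (w i * g i w)) := by
        rw [← integral_const_mul, ← integral_neg]; congr 1; ext w; ring
      rw [l1, l2] at key
      linarith
    · simp only [hfd]
      have := integrable_bump_smul (n := n) (k := 3) (by norm_num)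
        (g := fun w => -8 * (w i * g i w)) (by have := hgc i; fun_prop)
      refine this.congr (Eventually.of_forall fun w => ?_)
      simp only [smul_eq_mul]; ring
    · simp only [hgf]
      have := hgdc i
      exact integrable_bump_smul (by norm_num) (by fun_prop)
    · exact integrable_bump_smul (by norm_num) (hgc i).continuousOn
  simp only [e1, Finset.mul_sum, laplacian_eq_sum]
  rw [integral_finsetSum, integral_finsetSum, Finset.mul_sum]
  · exact Finset.sum_congr rfl fun i _ => ibp i
  · intro i _
    exact integrable_bump_smul (by norm_num) (hgdc i).continuousOn
  · intro i _
    exact integrable_bump_smul (by norm_num) (by have := hgc i; fun_prop)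

/-- A cutoff: near a closed ball in `O` the function agrees with a compactly supported one of class
`C²` on the whole space. -/
lemma exists_contDiff_eqOn_nhds {u : Euc n → ℝ} {O : Set (Euc n)} (hO : IsOpen O)
    (hu : ContDiffOn ℝ 2 u O) {x : Euc n} {R : ℝ} (hR : 0 ≤ R) (hxO : closedBall x R ⊆ O) :
    ∃ v : Euc n → ℝ, ContDiff ℝ 2 v ∧ HasCompactSupport v ∧
      ∀ y ∈ closedBall x R, v =ᶠ[𝓝 y] u := by
  obtain ⟨δ, hδ, hsub⟩ := (isCompact_closedBall x R).exists_cthickening_subset_open hO hxO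
  rw [cthickening_closedBall hδ.le hR] at hsub
  let χ : ContDiffBump x := ⟨R + δ / 2, R + δ, by linarith, by linarith⟩
  refine ⟨fun y => χ y * u y, ?_, χ.hasCompactSupport.mul_right, ?_⟩
  · rw [contDiff_iff_contDiffAt]
    intro y
    by_cases hy : y ∈ O
    · exact χ.contDiffAt.mul ((hu y hy).contDiffAt (hO.mem_nhds hy))
    · have : (fun y => χ y * u y) =ᶠ[𝓝 y] fun _ => 0 := by
        have hy' : y ∈ (closedBall x (δ + R))ᶜ := fun h => hy (hsub h)
        filter_upwards [isClosed_closedBall.isOpen_compl.mem_nhds hy'] with z hz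
        rw [χ.zero_of_le_dist, zero_mul]
        simp only [mem_compl_iff, mem_closedBall, not_le] at hz
        change R + δ ≤ _
        linarith
      exact contDiffAt_const.congr_of_eventuallyEq this
  · intro y hy
    have : ball x (R + δ / 2) ∈ 𝓝 y := isOpen_ball.mem_nhds (by
      rw [mem_closedBall] at hy; rw [mem_ball]; linarith)
    filter_upwards [this] with z hz
    rw [χ.one_of_mem_closedBall (ball_subset_closedBall hz), one_mul]

lemma wmean_congr {F : Type*} [NormedAddCommGroup F] [NormedSpace ℝ F] {u v : Euc n → F}
    {x : Euc n} {r : ℝ} (hr : 0 ≤ r)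
    (h : EqOn u v (closedBall x r)) : wmean u x r = wmean v x r := by
  refine integral_congr_ae (Eventually.of_forall fun w => ?_)
  by_cases hw : bump 3 w = 0
  · simp [hw]
  · simp only
    rw [h (add_smul_mem_closedBall hr (norm_lt_one_of_bump_ne_zero (by norm_num) hw).le)]

/-- A subharmonic function of class `C²` has the sub-mean value property. -/
lemma le_wmean_of_laplacian_nonneg {u : Euc n → ℝ} {O : Set (Euc n)} (hO : IsOpen O)
    (hu : ContDiffOn ℝ 2 u O) {x : Euc n} {R : ℝ} (hR : 0 ≤ R) (hxO : closedBall x R ⊆ O)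
    (hΔ : ∀ y ∈ closedBall x R, 0 ≤ Δ u y) : wmass n * u x ≤ wmean u x R := by
  obtain ⟨v, hv, hvc, hvu⟩ := exists_contDiff_eqOn_nhds hO hu hR hxO
  have e : EqOn v u (closedBall x R) := fun y hy => (hvu y hy).eq_of_nhds
  rw [← wmean_congr hR e, ← e (mem_closedBall_self hR), ← wmean_zero_radius]
  have hd : ∀ r, HasDerivAt (wmean v x) _ r := hasDerivAt_wmean hv hvc x
  refine monotoneOn_of_deriv_nonneg (convex_Icc 0 R)
    (fun r _ => (hd r).continuousAt.continuousWithinAt)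
    (fun r _ => (hd r).differentiableAt.differentiableWithinAt) (fun r hr => ?_)
    (left_mem_Icc.2 hR) (right_mem_Icc.2 hR) hR
  rw [interior_Icc] at hr
  rw [(hd r).deriv, integral_bump_fderiv hv]
  refine mul_nonneg (by have := hr.1; positivity) (integral_nonneg fun w => ?_)
  by_cases hw : bump 4 w = 0
  · simp [hw]
  · refine mul_nonneg (bump_nonneg 4 w) ?_
    have hm : x + r • w ∈ closedBall x R :=
      closedBall_subset_closedBall hr.2.le
        (add_smul_mem_closedBall hr.1.le (norm_lt_one_of_bump_ne_zero (by norm_num) hw).le)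
    rw [(laplacian_congr_nhds (hvu _ hm)).eq_of_nhds]
    exact hΔ _ hm

/-- A function of class `C²` whose means over small balls dominate its value at the centre
has nonnegative Laplacian. -/
lemma laplacian_nonneg_of_le_wmean {u : Euc n → ℝ} {O : Set (Euc n)} (hO : IsOpen O)
    (hu : ContDiffOn ℝ 2 u O) {x : Euc n} (hx : x ∈ O)
    (h : ∃ᶠ r in 𝓝[>] (0 : ℝ), wmass n * u x ≤ wmean u x r) : 0 ≤ Δ u x := by
  by_contra! hneg
  have hcont : ContinuousAt (fun y => Δ u y) x := by
    obtain ⟨v, hv, -, hvu⟩ := exists_contDiff_eqOn_nhds hO hu le_rfl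
      (x := x) (by simpa using hx)
    have hvu := hvu x (by simp)
    have h1 : Δ v =ᶠ[𝓝 x] Δ u :=
      hvu.eventuallyEq_nhds.mono fun y hy => (laplacian_congr_nhds hy).eq_of_nhds
    refine ContinuousAt.congr ?_ h1
    have hd : ContDiff ℝ 1 (fderiv ℝ v) := hv.fderiv_right (by norm_num)
    have hdd : Continuous (fderiv ℝ (fderiv ℝ v)) := hd.continuous_fderiv (by norm_num)
    have : Δ v = _ := funext fun y => laplacian_eq_sum (u := v) y
    rw [this]
    exact (continuous_finsetSum _ fun i _ =>
      (hdd.clm_apply continuous_const).clm_apply continuous_const).continuousAt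
  have hev : ∀ᶠ y in 𝓝 x, y ∈ O ∧ Δ u y < 0 :=
    (hO.eventually_mem hx).and (hcont.eventually_lt_const hneg)
  obtain ⟨R, hR, hball⟩ := Metric.nhds_basis_closedBall.eventually_iff.1 hev
  obtain ⟨v, hv, hvc, hvu⟩ := exists_contDiff_eqOn_nhds hO hu hR.le
    (fun y hy => (hball hy).1)
  have e : EqOn v u (closedBall x R) := fun y hy => (hvu y hy).eq_of_nhds
  have hd : ∀ r, HasDerivAt (wmean v x) _ r := hasDerivAt_wmean hv hvc x
  have hdd : Continuous (Δ v) := by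
    have hd : ContDiff ℝ 1 (fderiv ℝ v) := hv.fderiv_right (by norm_num)
    have hdd : Continuous (fderiv ℝ (fderiv ℝ v)) := hd.continuous_fderiv (by norm_num)
    have : Δ v = _ := funext fun y => laplacian_eq_sum (u := v) y
    rw [this]
    exact (continuous_finsetSum _ fun i _ =>
      (hdd.clm_apply continuous_const).clm_apply continuous_const)
  -- if the Laplacian were negative at `x`, the means would strictly decrease for small radii
  have hanti : StrictAntiOn (wmean v x) (Icc 0 R) := by
    refine strictAntiOn_of_deriv_neg (convex_Icc 0 R)
      (fun r _ => (hd r).continuousAt.continuousWithinAt) fun r hr => ?_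
    rw [interior_Icc] at hr
    rw [(hd r).deriv, integral_bump_fderiv hv]
    refine mul_neg_of_pos_of_neg (by have := hr.1; positivity) ?_
    have hlt : ∀ w : Euc n, ‖w‖ < 1 → Δ v (x + r • w) < 0 := by
      intro w hw
      have hm : x + r • w ∈ closedBall x R :=
        closedBall_subset_closedBall hr.2.le (add_smul_mem_closedBall hr.1.le hw.le)
      rw [(laplacian_congr_nhds (hvu _ hm)).eq_of_nhds]
      exact (hball hm).2
    have hnn : 0 ≤ fun w => bump 4 w * -Δ v (x + r • w) := by
      intro w
      by_cases hw : bump 4 w = 0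
      · simp [hw]
      · exact mul_nonneg (bump_nonneg 4 w)
          (neg_nonneg.2 (hlt w (norm_lt_one_of_bump_ne_zero (by norm_num) hw)).le)
    have hint : Integrable (fun w => bump 4 w * -Δ v (x + r • w)) :=
      integrable_bump_smul (by norm_num) (hdd.comp (by fun_prop)).neg.continuousOn
    have hpos : 0 < ∫ w, bump 4 w * -Δ v (x + r • w) := by
      rw [integral_pos_iff_support_of_nonneg hnn hint]
      refine lt_of_lt_of_le (measure_ball_pos volume (0 : Euc n) one_pos) (measure_mono ?_)
      intro w hw
      have hw : ‖w‖ < 1 := by simpa using hw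
      exact (mul_pos (bump_pos 4 hw) (neg_pos.2 (hlt w hw))).ne'
    simp only [mul_neg, integral_neg] at hpos
    linarith
  have hev2 : ∀ᶠ r in 𝓝[>] (0 : ℝ), ¬ (wmass n * u x ≤ wmean u x r) := by
    filter_upwards [Ioc_mem_nhdsGT hR] with r hr
    have h1 := hanti (left_mem_Icc.2 hR.le) ⟨hr.1.le, hr.2⟩ hr.1
    rw [wmean_zero_radius, e (mem_closedBall_self hR.le),
      wmean_congr hr.1.le (e.mono (closedBall_subset_closedBall hr.2))] at h1
    exact not_le.2 h1
  exact h hev2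

/-- Local sub-mean value property for functions of class `C²` implies the sub-mean value
property on all balls. -/
lemma le_wmean_of_local {u : Euc n → ℝ} {O : Set (Euc n)} (hO : IsOpen O)
    (hu : ContDiffOn ℝ 2 u O)
    (h : ∀ y ∈ O, ∃ᶠ r in 𝓝[>] (0 : ℝ), wmass n * u y ≤ wmean u y r)
    {x : Euc n} {R : ℝ} (hR : 0 ≤ R) (hxO : closedBall x R ⊆ O) :
    wmass n * u x ≤ wmean u x R :=
  le_wmean_of_laplacian_nonneg hO hu hR hxO fun y hy =>
    laplacian_nonneg_of_le_wmean hO hu (hxO hy) (h y (hxO hy))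

/-! ### The Riesz kernel and the power kernels -/

lemma hasFDerivAt_affine_mul_rpow (c a : ℝ) (v : Euc n) {x : Euc n} (hx : x ≠ 0) :
    HasFDerivAt (fun y : Euc n => (c + ⟪v, y⟫) * (‖y‖ ^ 2) ^ (-a))
      ((‖x‖ ^ 2) ^ (-a) • innerSL ℝ v
        - (2 * a * (c + ⟪v, x⟫) * (‖x‖ ^ 2) ^ (-a - 1)) • innerSL ℝ x) x := by
  have hq : ‖x‖ ^ 2 ≠ 0 := by positivity
  have h1 : HasFDerivAt (fun y : Euc n => ‖y‖ ^ 2) (2 • innerSL ℝ x) x :=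
    (hasStrictFDerivAt_norm_sq x).hasFDerivAt
  have h2 := (Real.hasDerivAt_rpow_const (p := -a) (Or.inl hq)).comp_hasFDerivAt x h1
  have h3 : HasFDerivAt (fun y : Euc n => c + ⟪v, y⟫) (innerSL ℝ v) x :=
    (innerSL ℝ v).hasFDerivAt.const_add c
  refine (h3.mul h2).congr_fderiv ?_
  ext w
  simp
  ring

lemma contDiffAt_affine_mul_rpow (c a : ℝ) (v : Euc n) {x : Euc n} (hx : x ≠ 0) :
    ContDiffAt ℝ 2 (fun y : Euc n => (c + ⟪v, y⟫) * (‖y‖ ^ 2) ^ (-a)) x := by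
  have hq : ‖x‖ ^ 2 ≠ 0 := by positivity
  refine ContDiffAt.mul ?_ ?_
  · exact (contDiff_const.add (innerSL ℝ v).contDiff).contDiffAt
  · exact ((contDiff_norm_sq ℝ).contDiffAt).rpow_const_of_ne hq

/-- The functions `(c + ⟨v, y⟩) |y|^{-2a}` comprise the components of the Riesz kernel
(`c = 0`, `2a = n + 1`) and the power kernels (`v = 0`). -/
lemma laplacian_affine_mul_rpow (c a : ℝ) (v : Euc n) {x : Euc n} (hx : x ≠ 0) :
    Δ (fun y : Euc n => (c + ⟪v, y⟫) * (‖y‖ ^ 2) ^ (-a)) x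
      = (‖x‖ ^ 2) ^ (-a - 1) * (-4 * a * ⟪v, x⟫ + 2 * a * (2 * a + 2 - (n + 1)) *
        (c + ⟪v, x⟫)) := by
  have hq : 0 < ‖x‖ ^ 2 := by positivity
  set u := fun y : Euc n => (c + ⟪v, y⟫) * (‖y‖ ^ 2) ^ (-a) with hu
  set e := EuclideanSpace.basisFun (Fin (n + 1)) ℝ
  rw [laplacian_eq_sum]
  have hfd : fderiv ℝ u =ᶠ[𝓝 x] fun y => (‖y‖ ^ 2) ^ (-a) • innerSL ℝ v
        - (2 * a * (c + ⟪v, y⟫) * (‖y‖ ^ 2) ^ (-a - 1)) • innerSL ℝ y := by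
    filter_upwards [isOpen_compl_singleton.mem_nhds hx] with y hy
    exact (hasFDerivAt_affine_mul_rpow c a v hy).fderiv
  have h1 : HasFDerivAt (fun y : Euc n => ‖y‖ ^ 2) (2 • innerSL ℝ x) x :=
    (hasStrictFDerivAt_norm_sq x).hasFDerivAt
  have h2 : HasFDerivAt (fun y : Euc n => (‖y‖ ^ 2) ^ (-a))
      ((-a * (‖x‖ ^ 2) ^ (-a - 1)) • (2 • innerSL ℝ x)) x := HasDerivAt.comp_hasFDerivAt
    (h₂ := fun t : ℝ => t ^ (-a)) x (Real.hasDerivAt_rpow_const (p := -a) (Or.inl hq.ne')) h1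
  have h3 : HasFDerivAt (fun y : Euc n => (‖y‖ ^ 2) ^ (-a - 1))
      (((-a - 1) * (‖x‖ ^ 2) ^ (-a - 1 - 1)) • (2 • innerSL ℝ x)) x := HasDerivAt.comp_hasFDerivAt
    (h₂ := fun t : ℝ => t ^ (-a - 1)) x
    (Real.hasDerivAt_rpow_const (p := -a - 1) (Or.inl hq.ne')) h1
  have h4 : HasFDerivAt (fun y : Euc n => 2 * a * (c + ⟪v, y⟫)) ((2 * a) • innerSL ℝ v) x :=
    ((innerSL ℝ v).hasFDerivAt.const_add c).const_mul (2 * a)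
  have h5 : HasFDerivAt (fun y : Euc n => innerSL ℝ y) (innerSL ℝ) x :=
    (innerSL ℝ).hasFDerivAt
  have h6 := (h2.smul_const (innerSL ℝ v)).sub ((h4.mul h3).smul h5)
  have h7 := (h6.congr_of_eventuallyEq hfd).fderiv
  have key : ∀ i, fderiv ℝ (fderiv ℝ u) x (e i) (e i) =
      (‖x‖ ^ 2) ^ (-a - 1) * (-4 * a) * (x i * v i)
      + 4 * a * (a + 1) * (c + ⟪v, x⟫) * (‖x‖ ^ 2) ^ (-a - 1 - 1) * (x i * x i)
      - 2 * a * (c + ⟪v, x⟫) * (‖x‖ ^ 2) ^ (-a - 1) := by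
    intro i
    have he : innerSL ℝ (EuclideanSpace.single i (1 : ℝ) : Euc n) (EuclideanSpace.single i 1)
        = 1 := by
      rw [innerSL_apply_apply, real_inner_self_eq_norm_sq]; simp
    rw [h7]
    simp [e, he, EuclideanSpace.inner_single_right]
    ring
  rw [Finset.sum_congr rfl fun i _ => key i, Finset.sum_sub_distrib, Finset.sum_add_distrib,
    ← Finset.mul_sum, ← Finset.mul_sum]
  have s1 : ∑ i, x i * v i = ⟪v, x⟫ := by
    simp [PiLp.inner_apply]
  have s2 : ∑ i, x i * x i = ‖x‖ ^ 2 := by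
    rw [EuclideanSpace.real_norm_sq_eq]; simp [sq]
  have s3 : (‖x‖ ^ 2) ^ (-a - 1 - 1) * ‖x‖ ^ 2 = (‖x‖ ^ 2) ^ (-a - 1) := by
    rw [Real.rpow_sub_one hq.ne' (-a - 1)]
    field_simp
  rw [s1, s2]
  simp only [Finset.sum_const, Finset.card_univ, Fintype.card_fin, nsmul_eq_mul]
  push_cast
  linear_combination 4 * a * (a + 1) * (c + ⟪v, x⟫) * s3

lemma norm_rieszKernel_rpow (z : Euc n) (hn : 1 ≤ n) : ‖rieszKernel z‖ = ‖z‖ ^ (-(n : ℝ)) := by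
  rw [rieszKernel, norm_smul, norm_inv, norm_pow, norm_norm, Real.rpow_neg (norm_nonneg _),
    Real.rpow_natCast]
  rcases eq_or_ne z 0 with rfl | hz
  · simp [zero_pow (by omega : n ≠ 0)]
  · have : ‖z‖ ≠ 0 := norm_ne_zero_iff.2 hz
    field_simp
    ring

@[simp] lemma rieszKernel_neg (z : Euc n) : rieszKernel (-z) = -rieszKernel z := by
  simp [rieszKernel]

@[simp] lemma rieszKernel_zero : rieszKernel (0 : Euc n) = 0 := by simp [rieszKernel]

lemma measurable_rieszKernel : Measurable (rieszKernel : Euc n → Euc n) := by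
  unfold rieszKernel; fun_prop

lemma continuousAt_rieszKernel {z : Euc n} (hz : z ≠ 0) : ContinuousAt rieszKernel z := by
  unfold rieszKernel
  exact ((continuous_norm.pow _).continuousAt.inv₀ (by simpa using hz)).smul continuousAt_id

lemma inner_rieszKernel (v z : Euc n) :
    ⟪v, rieszKernel z⟫ = (0 + ⟪v, z⟫) * (‖z‖ ^ 2) ^ (-(((n : ℝ) + 1) / 2)) := by
  rw [rieszKernel, inner_smul_right, zero_add, mul_comm]
  congr 1
  rw [Real.rpow_neg (by positivity), ← Real.rpow_natCast, ← Real.rpow_natCast ‖z‖ 2,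
    ← Real.rpow_mul (norm_nonneg _)]
  congr 2
  push_cast
  ring

lemma wmean_inner {u : Euc n → Euc n} {x : Euc n} {r : ℝ}
    (h : Integrable (fun w => bump 3 w • u (x + r • w))) (v : Euc n) :
    wmean (fun y => ⟪v, u y⟫) x r = ⟪v, wmean u x r⟫ := by
  unfold wmean
  rw [← integral_inner h]
  congr 1; ext w; rw [inner_smul_right]; rfl

lemma continuousOn_rieszKernel_sub (y : Euc n) {s : Set (Euc n)} (hs : y ∉ s) :
    ContinuousOn (fun x => rieszKernel (x - y)) s := fun x hx =>
  ((continuousAt_rieszKernel (sub_ne_zero.2 (ne_of_mem_of_not_mem hx hs))).comp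
    (f := fun x => x - y) (by fun_prop)).continuousWithinAt

lemma wmean_const_shift {F : Type*} [NormedAddCommGroup F] [NormedSpace ℝ F] (u : Euc n → F)
    (x y : Euc n) (r : ℝ) : wmean (fun z => u (z - y)) x r = wmean u (x - y) r := by
  unfold wmean
  congr 1; ext w; congr 2; abel_nf

/-- The hypothesis `h` says that the Laplacian is nonnegative. -/
lemma wmass_mul_le_wmean_affine_mul_rpow {c a : ℝ} {v z : Euc n} {r : ℝ} (hr : 0 ≤ r)
    (hz : r < ‖z‖)
    (h : ∀ x : Euc n, x ≠ 0 → 0 ≤ -4 * a * ⟪v, x⟫ + 2 * a * (2 * a + 2 - (n + 1)) *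
        (c + ⟪v, x⟫)) :
    wmass n * ((c + ⟪v, z⟫) * (‖z‖ ^ 2) ^ (-a)) ≤
      wmean (fun y : Euc n => (c + ⟪v, y⟫) * (‖y‖ ^ 2) ^ (-a)) z r := by
  have h0 : closedBall z r ⊆ {0}ᶜ := by
    intro y hy h0
    simp only [mem_singleton_iff] at h0
    subst h0
    rw [mem_closedBall, dist_zero_left] at hy
    linarith
  refine le_wmean_of_laplacian_nonneg (u := fun y : Euc n => (c + ⟪v, y⟫) * (‖y‖ ^ 2) ^ (-a))
    isOpen_compl_singleton
    (fun y hy => (contDiffAt_affine_mul_rpow c a v hy).contDiffWithinAt) hr h0 fun y hy => ?_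
  rw [laplacian_affine_mul_rpow c a v (h0 hy)]
  exact mul_nonneg (by positivity) (h y (h0 hy))

/-- The components of the Riesz kernel are harmonic away from the origin. -/
lemma wmean_rieszKernel {x y : Euc n} {r : ℝ} (hr : 0 ≤ r) (hxy : r < dist x y) :
    wmean (fun z => rieszKernel (z - y)) x r = wmass n • rieszKernel (x - y) := by
  rw [wmean_const_shift]
  set z := x - y with hzdef
  have hz : r < ‖z‖ := by rwa [hzdef, ← dist_eq_norm]
  have h0 : (0 : Euc n) ∉ closedBall z r := by
    rw [mem_closedBall, dist_zero_left]; exact not_le.2 hz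
  have hi : Integrable (fun w => bump 3 w • rieszKernel (z + r • w)) :=
    integrable_wmean hr (by simpa using continuousOn_rieszKernel_sub 0 h0)
  have key : ∀ v : Euc n, wmass n * ⟪v, rieszKernel z⟫ ≤ ⟪v, wmean rieszKernel z r⟫ := by
    intro v
    rw [← wmean_inner hi]
    simp only [inner_rieszKernel]
    refine wmass_mul_le_wmean_affine_mul_rpow hr hz fun x _ => le_of_eq ?_
    ring
  refine ext_inner_left ℝ fun v => ?_
  rw [inner_smul_right]
  refine le_antisymm ?_ (key v)
  have := key (-v)
  simp only [inner_neg_left, mul_neg] at this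
  linarith

/-- The power kernel `|z|^{-(n - 1/2)}`. It is subharmonic away from the origin, since the exponent
is at least `n - 1`, and its potentials are controlled by the `n`-dimensional density, since the
exponent is less than `n`. -/
def powKernel (z : Euc n) : ℝ := ‖z‖ ^ (-((n : ℝ) - 1 / 2))

lemma powKernel_eq (z : Euc n) :
    powKernel z = (1 + ⟪(0 : Euc n), z⟫) * (‖z‖ ^ 2) ^ (-(((n : ℝ) - 1 / 2) / 2)) := by
  rw [inner_zero_left, add_zero, one_mul, powKernel, ← Real.rpow_natCast ‖z‖ 2,
    ← Real.rpow_mul (norm_nonneg _)]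
  congr 1
  push_cast
  ring

lemma powKernel_nonneg (z : Euc n) : 0 ≤ powKernel z := by unfold powKernel; positivity

lemma measurable_powKernel : Measurable (powKernel : Euc n → ℝ) := by
  unfold powKernel; fun_prop

lemma continuousAt_powKernel {z : Euc n} (hz : z ≠ 0) : ContinuousAt powKernel z := by
  unfold powKernel
  exact continuous_norm.continuousAt.rpow_const (Or.inl (by simpa using hz))

lemma wmass_mul_powKernel_le {x y : Euc n} {r : ℝ} (hn : 1 ≤ n) (hr : 0 ≤ r)
    (hxy : r < dist x y) :
    wmass n * powKernel (x - y) ≤ wmean (fun z => powKernel (z - y)) x r := by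
  rw [wmean_const_shift powKernel]
  set z := x - y with hzdef
  have hz : r < ‖z‖ := by rwa [hzdef, ← dist_eq_norm]
  rw [powKernel_eq, show (powKernel : Euc n → ℝ) = _ from funext powKernel_eq]
  refine wmass_mul_le_wmean_affine_mul_rpow hr hz fun x _ => ?_
  have : (1 : ℝ) ≤ n := by exact_mod_cast hn
  simp only [inner_zero_left, mul_zero, zero_add, add_zero, mul_one]
  refine mul_nonneg (by linarith) (by linarith)

/-- Lipschitz estimate for the Riesz kernel at distance at least `m` from the origin. -/
lemma norm_rieszKernel_sub_le {a b : Euc n} {m : ℝ} (hm : 0 < m) (ha : m ≤ ‖a‖) (hb : m ≤ ‖b‖) :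
    ‖rieszKernel a - rieszKernel b‖ ≤ (n + 2) * ‖a - b‖ * (m ^ (n + 1))⁻¹ := by
  wlog h : ‖a‖ ≤ ‖b‖ generalizing a b
  · rw [norm_sub_rev, norm_sub_rev a b]; exact this hb ha (le_of_not_ge h)
  have hapos : 0 < ‖a‖ := hm.trans_le ha
  have hbpos : 0 < ‖b‖ := hm.trans_le hb
  have e : rieszKernel a - rieszKernel b =
      (‖a‖ ^ (n + 1))⁻¹ • (a - b) + ((‖a‖ ^ (n + 1))⁻¹ - (‖b‖ ^ (n + 1))⁻¹) • b := by
    simp only [rieszKernel, smul_sub, sub_smul]; abel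
  have h1 : (‖a‖ ^ (n + 1))⁻¹ ≤ (m ^ (n + 1))⁻¹ := by gcongr
  have h2 : ‖b‖ ^ (n + 1) - ‖a‖ ^ (n + 1) ≤ (n + 1) * ‖b‖ ^ n * ‖a - b‖ := by
    have := abs_pow_sub_pow_le ‖b‖ ‖a‖ (n + 1)
    rw [abs_of_nonneg (norm_nonneg b), abs_of_nonneg (norm_nonneg a), max_eq_left h] at this
    have h3 := abs_norm_sub_norm_le b a
    rw [norm_sub_rev] at h3
    calc _ ≤ _ := le_abs_self _
      _ ≤ _ := this
      _ ≤ ‖a - b‖ * ((n + 1 : ℕ) : ℝ) * ‖b‖ ^ (n + 1 - 1) := by gcongr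
      _ = _ := by rw [Nat.add_sub_cancel]; push_cast; ring
  have h4 : |(‖a‖ ^ (n + 1))⁻¹ - (‖b‖ ^ (n + 1))⁻¹| * ‖b‖ ≤
      (n + 1) * ‖a - b‖ * (m ^ (n + 1))⁻¹ := by
    have hnn : 0 ≤ (‖a‖ ^ (n + 1))⁻¹ - (‖b‖ ^ (n + 1))⁻¹ := sub_nonneg.2 (by gcongr)
    rw [abs_of_nonneg hnn, inv_sub_inv (by positivity) (by positivity), div_mul_eq_mul_div,
      div_le_iff₀ (by positivity)]
    calc _ ≤ ((n + 1) * ‖b‖ ^ n * ‖a - b‖) * ‖b‖ := by gcongr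
      _ = (n + 1) * ‖a - b‖ * ((‖a‖ ^ (n + 1))⁻¹ * (‖a‖ ^ (n + 1) * ‖b‖ ^ (n + 1))) := by
        rw [inv_mul_cancel_left₀ (by positivity)]; ring
      _ ≤ (n + 1) * ‖a - b‖ * ((m ^ (n + 1))⁻¹ * (‖a‖ ^ (n + 1) * ‖b‖ ^ (n + 1))) := by gcongr
      _ = _ := by ring
  rw [e]
  calc _ ≤ (‖a‖ ^ (n + 1))⁻¹ * ‖a - b‖ + |(‖a‖ ^ (n + 1))⁻¹ - (‖b‖ ^ (n + 1))⁻¹| * ‖b‖ := by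
        refine (norm_add_le _ _).trans ?_
        rw [norm_smul, norm_smul, Real.norm_of_nonneg (by positivity), Real.norm_eq_abs]
    _ ≤ (m ^ (n + 1))⁻¹ * ‖a - b‖ + (n + 1) * ‖a - b‖ * (m ^ (n + 1))⁻¹ := by gcongr
    _ = _ := by ring

/-! ### Integral estimates for weakly singular kernels -/

/-- A constant bounding the integrals of `|z|^{-s}` over balls of radius `1`. -/
def powConst (n : ℕ) (s : ℝ) : ℝ :=
  (∫ z in closedBall (0 : Euc n) 1, ‖z‖ ^ (-s)) + (volume : Measure (Euc n)).real (closedBall 0 1)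

lemma powConst_pos (n : ℕ) (s : ℝ) : 0 < powConst n s := by
  refine add_pos_of_nonneg_of_pos (integral_nonneg fun z => by positivity) ?_
  exact ENNReal.toReal_pos (measure_closedBall_pos _ _ one_pos).ne'
    measure_closedBall_lt_top.ne

lemma integrableOn_rpow {s : ℝ} (hs : s < n + 1) (R : ℝ) :
    IntegrableOn (fun z : Euc n => ‖z‖ ^ (-s)) (closedBall 0 R) := by
  refine (integrableOn_ball_of_norm_le_rpow (C := 1) (α := s) (r := R + 1) (by simp)
    ?_ ?_ ?_).mono_set (closedBall_subset_ball (by linarith))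
  · simpa using hs
  · refine Eventually.of_forall fun x => ?_
    rw [one_mul, Real.norm_of_nonneg (by positivity)]
  · exact (by fun_prop : Measurable fun z : Euc n => ‖z‖ ^ (-s)).aestronglyMeasurable

lemma setIntegral_rpow (s : ℝ) {R : ℝ} (hR : 0 < R) :
    ∫ z in closedBall (0 : Euc n) R, ‖z‖ ^ (-s) =
      R ^ ((n : ℝ) + 1 - s) * ∫ z in closedBall (0 : Euc n) 1, ‖z‖ ^ (-s) := by
  have h := Measure.setIntegral_comp_smul_of_pos (volume : Measure (Euc n))
    (fun z : Euc n => ‖z‖ ^ (-s)) (closedBall 0 1) hR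
  rw [smul_unitClosedBall_of_nonneg hR.le] at h
  have e : ∀ z : Euc n, ‖R • z‖ ^ (-s) = R ^ (-s) * ‖z‖ ^ (-s) := fun z => by
    rw [norm_smul, Real.norm_of_nonneg hR.le, Real.mul_rpow hR.le (norm_nonneg _)]
  simp only [e, integral_const_mul, finrank_euclideanSpace, Fintype.card_fin, smul_eq_mul] at h
  rw [eq_inv_mul_iff_mul_eq₀ (by positivity)] at h
  rw [← h, ← mul_assoc, sub_eq_add_neg, Real.rpow_add hR, ← Nat.cast_add_one, Real.rpow_natCast]

/-- The integral of the kernel `|x - y|^{-s}` over a ball of radius `r` need not be centred at `x`: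
the points of the ball at distance more than `r` from `x` contribute at most `r^{-s}` times its
volume. -/
lemma setLIntegral_rpow_le {s : ℝ} (hs0 : 0 ≤ s) (hs : s < n + 1) (x z : Euc n) {r : ℝ}
    (hr : 0 < r) :
    ∫⁻ y in closedBall z r, ENNReal.ofReal (‖x - y‖ ^ (-s)) ≤
      ENNReal.ofReal (powConst n s * r ^ ((n : ℝ) + 1 - s)) := by
  have h1 : ∫⁻ y in closedBall x r, ENNReal.ofReal (‖x - y‖ ^ (-s)) =
      ENNReal.ofReal (r ^ ((n : ℝ) + 1 - s) * ∫ z in closedBall (0 : Euc n) 1, ‖z‖ ^ (-s)) := by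
    rw [← setIntegral_rpow s hr, ofReal_integral_eq_lintegral_ofReal (integrableOn_rpow hs r)
      (Eventually.of_forall fun _ => by positivity), ← lintegral_indicator measurableSet_closedBall,
      ← lintegral_indicator measurableSet_closedBall,
      ← lintegral_sub_left_eq_self (fun z => (closedBall (0 : Euc n) r).indicator _ z) x]
    congr 1; ext y
    simp only [indicator, mem_closedBall, dist_zero_right]
    rw [dist_comm, dist_eq_norm]
  have h2 : ∫⁻ y in closedBall z r \ closedBall x r, ENNReal.ofReal (‖x - y‖ ^ (-s)) ≤
      ENNReal.ofReal (r ^ ((n : ℝ) + 1 - s) *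
        (volume : Measure (Euc n)).real (closedBall 0 1)) := by
    calc _ ≤ ∫⁻ y in closedBall z r \ closedBall x r, ENNReal.ofReal (r ^ (-s)) := by
          refine setLIntegral_mono measurable_const fun y hy => ?_
          refine ENNReal.ofReal_le_ofReal (Real.rpow_le_rpow_of_nonpos hr ?_ (by linarith))
          have := hy.2
          rw [mem_closedBall, dist_comm, dist_eq_norm, not_le] at this
          exact this.le
      _ = ENNReal.ofReal (r ^ (-s)) * volume (closedBall z r \ closedBall x r) := by simp
      _ ≤ ENNReal.ofReal (r ^ (-s)) * volume (closedBall z r) := by gcongr; exact sdiff_subset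
      _ = _ := by
        rw [Measure.addHaar_closedBall' _ _ hr.le, Measure.real, ENNReal.ofReal_mul (by positivity),
          ENNReal.ofReal_toReal measure_closedBall_lt_top.ne, ← mul_assoc,
          ← ENNReal.ofReal_mul (by positivity)]
        congr 2
        rw [sub_eq_neg_add, Real.rpow_add hr, ← Nat.cast_add_one, Real.rpow_natCast]
        simp
  calc _ ≤ ∫⁻ y in closedBall x r ∪ (closedBall z r \ closedBall x r),
        ENNReal.ofReal (‖x - y‖ ^ (-s)) := by
        refine lintegral_mono_set ?_
        rw [union_sdiff_self]; exact subset_union_right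
    _ ≤ _ := (lintegral_union_le _ _ _).trans (add_le_add h1.le h2)
    _ = _ := by
      rw [← ENNReal.ofReal_add, powConst]
      · congr 1; ring
      · have := integral_nonneg (μ := volume.restrict (closedBall (0 : Euc n) 1))
          (f := fun z => ‖z‖ ^ (-s)) fun z => by positivity
        positivity
      · positivity

/-- The average of the kernel `|· - y|^{-s}` over a ball of radius `r`. -/
lemma lintegral_rpow_comp_le {s : ℝ} (hs0 : 0 ≤ s) (hs : s < n + 1) (x y : Euc n) {r : ℝ}
    (hr : 0 < r) :
    ∫⁻ w in closedBall 0 1, ENNReal.ofReal (‖x + r • w - y‖ ^ (-s)) ≤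
      ENNReal.ofReal (powConst n s * r ^ (-s)) := by
  have e : ∀ w : Euc n, ENNReal.ofReal (‖x + r • w - y‖ ^ (-s)) =
      ENNReal.ofReal (r ^ (-s)) * ENNReal.ofReal (‖r⁻¹ • (y - x) - w‖ ^ (-s)) := by
    intro w
    have : x + r • w - y = -(r • (r⁻¹ • (y - x) - w)) := by
      rw [smul_sub, smul_inv_smul₀ hr.ne']; abel
    rw [this, norm_neg, norm_smul, Real.norm_of_nonneg hr.le,
      Real.mul_rpow hr.le (norm_nonneg _), ENNReal.ofReal_mul (by positivity)]
  simp only [e]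
  rw [lintegral_const_mul' _ _ ENNReal.ofReal_ne_top, mul_comm (powConst n s),
    ENNReal.ofReal_mul (by positivity)]
  gcongr
  simpa using setLIntegral_rpow_le hs0 hs (r⁻¹ • (y - x)) 0 one_pos

section Density

variable {σ : Measure (Euc n)} {M : ℝ≥0}

lemma setLIntegral_rpow_le_of_le (hσ : σ ≤ M • volume) {s : ℝ} (hs0 : 0 ≤ s) (hs : s < n + 1)
    (x z : Euc n) {r : ℝ} (hr : 0 < r) :
    ∫⁻ y in closedBall z r, ENNReal.ofReal (‖x - y‖ ^ (-s)) ∂σ ≤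
      ENNReal.ofReal (M * powConst n s * r ^ ((n : ℝ) + 1 - s)) := by
  calc _ ≤ ∫⁻ y in closedBall z r, ENNReal.ofReal (‖x - y‖ ^ (-s)) ∂(M • volume) :=
        lintegral_mono' (Measure.restrict_mono le_rfl hσ) le_rfl
    _ = M * ∫⁻ y in closedBall z r, ENNReal.ofReal (‖x - y‖ ^ (-s)) := by
        rw [Measure.restrict_smul, lintegral_smul_measure]; rfl
    _ ≤ M * ENNReal.ofReal (powConst n s * r ^ ((n : ℝ) + 1 - s)) := by
        gcongr; exact setLIntegral_rpow_le hs0 hs x z hr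
    _ = _ := by
      rw [mul_assoc, ENNReal.ofReal_mul (p := (M : ℝ)) (by positivity), ENNReal.ofReal_coe_nnreal]

/-- Uniform bound for the potentials of a finite measure with bounded density. -/
lemma lintegral_rpow_le_of_le [IsFiniteMeasure σ] (hσ : σ ≤ M • volume) {s : ℝ} (hs0 : 0 ≤ s)
    (hs : s < n + 1) (x : Euc n) :
    ∫⁻ y, ENNReal.ofReal (‖x - y‖ ^ (-s)) ∂σ ≤
      ENNReal.ofReal (M * powConst n s + σ.real univ) := by
  have h1 := setLIntegral_rpow_le_of_le hσ hs0 hs x x one_pos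
  have h2 : ∫⁻ y in (closedBall x 1)ᶜ, ENNReal.ofReal (‖x - y‖ ^ (-s)) ∂σ ≤ σ univ := by
    calc _ ≤ ∫⁻ y in (closedBall x 1)ᶜ, 1 ∂σ := by
          refine setLIntegral_mono measurable_const fun y hy => ?_
          rw [ENNReal.ofReal_le_one]
          have : 1 < ‖x - y‖ := by
            rw [mem_compl_iff, mem_closedBall, dist_comm, dist_eq_norm, not_le] at hy
            exact hy
          exact Real.rpow_le_one_of_one_le_of_nonpos this.le (by linarith)
      _ ≤ _ := by rw [setLIntegral_one]; exact measure_mono (subset_univ _)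
  rw [← lintegral_add_compl _ (measurableSet_closedBall (x := x) (ε := 1)),
    ENNReal.ofReal_add (by have := powConst_pos n s; positivity) (by positivity)]
  refine add_le_add (h1.trans (by simp)) (h2.trans ?_)
  rw [Measure.real, ENNReal.ofReal_toReal (measure_ne_top _ _)]

lemma integrable_of_norm_le_rpow [IsFiniteMeasure σ] {F : Type*} [NormedAddCommGroup F]
    (hσ : σ ≤ M • volume) {s C : ℝ} (hs0 : 0 ≤ s)
    (hs : s < n + 1) {x : Euc n} {f : Euc n → F} (hf : AEStronglyMeasurable f σ)
    (hC : ∀ y, ‖f y‖ ≤ C * ‖x - y‖ ^ (-s)) : Integrable f σ := by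
  have h : Integrable (fun y => ‖x - y‖ ^ (-s)) σ := by
    refine ⟨(by fun_prop : Measurable fun y => ‖x - y‖ ^ (-s)).aestronglyMeasurable, ?_⟩
    rw [hasFiniteIntegral_iff_ofReal (Eventually.of_forall fun _ => by positivity)]
    exact (lintegral_rpow_le_of_le hσ hs0 hs x).trans_lt ENNReal.ofReal_lt_top
  exact (h.const_mul C).mono' hf (Eventually.of_forall hC)

lemma integral_rpow_le_of_le [IsFiniteMeasure σ] (hσ : σ ≤ M • volume) {s : ℝ} (hs0 : 0 ≤ s)
    (hs : s < n + 1) (x : Euc n) :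
    ∫ y, ‖x - y‖ ^ (-s) ∂σ ≤ M * powConst n s + σ.real univ := by
  rw [integral_eq_lintegral_of_nonneg_ae (Eventually.of_forall fun _ => by positivity)
    (by fun_prop : Measurable fun y => ‖x - y‖ ^ (-s)).aestronglyMeasurable]
  refine ENNReal.toReal_le_of_le_ofReal ?_ (lintegral_rpow_le_of_le hσ hs0 hs x)
  have := powConst_pos n s
  positivity

lemma integrable_rpow_of_le [IsFiniteMeasure σ] (hσ : σ ≤ M • volume) {s : ℝ} (hs0 : 0 ≤ s)
    (hs : s < n + 1) (x : Euc n) : Integrable (fun y => ‖x - y‖ ^ (-s)) σ :=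
  integrable_of_norm_le_rpow (C := 1) hσ hs0 hs
    (by fun_prop : Measurable fun y => ‖x - y‖ ^ (-s)).aestronglyMeasurable
    (fun y => by rw [one_mul, Real.norm_of_nonneg (by positivity)])

lemma setIntegral_rpow_le_of_le [IsFiniteMeasure σ] (hσ : σ ≤ M • volume) {s : ℝ} (hs0 : 0 ≤ s)
    (hs : s < n + 1) (x z : Euc n) {r : ℝ} (hr : 0 < r) :
    ∫ y in closedBall z r, ‖x - y‖ ^ (-s) ∂σ ≤ M * powConst n s * r ^ ((n : ℝ) + 1 - s) := by
  rw [integral_eq_lintegral_of_nonneg_ae (Eventually.of_forall fun _ => by positivity)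
    (by fun_prop : Measurable fun y => ‖x - y‖ ^ (-s)).aestronglyMeasurable]
  refine ENNReal.toReal_le_of_le_ofReal ?_ (setLIntegral_rpow_le_of_le hσ hs0 hs x z hr)
  have := powConst_pos n s
  positivity

/-- Potentials of measures with bounded density with respect to a weakly singular kernel
are continuous. -/
lemma continuous_integral_of_weaklySingular {F : Type*} [NormedAddCommGroup F] [NormedSpace ℝ F]
    [IsFiniteMeasure σ] (hσ : σ ≤ M • volume) {s C : ℝ}
    (hs0 : 0 ≤ s) (hs : s < n + 1) (hC0 : 0 ≤ C) {Q : Euc n → Euc n → F}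
    (hm : ∀ x, AEStronglyMeasurable (Q x) σ) (hc : ∀ x y, x ≠ y → ContinuousAt (Q · y) x)
    (hC : ∀ x y, ‖Q x y‖ ≤ C * ‖x - y‖ ^ (-s)) : Continuous fun x => ∫ y, Q x y ∂σ := by
  -- cutting off the singularity at distance `ε` gives continuous potentials that converge uniformly
  set χ : ℝ → Euc n → Euc n → ℝ := fun ε x y => min (max (‖x - y‖ / ε - 1) 0) 1 with hχ
  have χ0 : ∀ ε x y, 0 ≤ χ ε x y := fun ε x y => le_min (le_max_right _ _) zero_le_one
  have χ1 : ∀ ε x y, χ ε x y ≤ 1 := fun ε x y => min_le_right _ _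
  have χs : ∀ ε > 0, ∀ x y, ‖x - y‖ ≤ ε → χ ε x y = 0 := fun ε hε x y h => by
    have : ‖x - y‖ / ε - 1 ≤ 0 := by rw [sub_nonpos, div_le_one hε]; exact h
    simp [hχ, max_eq_right this]
  have χb : ∀ ε > 0, ∀ x y, 2 * ε ≤ ‖x - y‖ → χ ε x y = 1 := fun ε hε x y h => by
    have : 1 ≤ ‖x - y‖ / ε - 1 := by
      have : 2 ≤ ‖x - y‖ / ε := by rw [le_div_iff₀ hε]; exact h
      linarith
    simp only [hχ]
    rw [max_eq_left (by linarith), min_eq_right this]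
  have χm : ∀ ε x, Continuous (χ ε x) := fun ε x => by simp only [hχ]; fun_prop
  have χc : ∀ ε y, Continuous (χ ε · y) := fun ε y => by simp only [hχ]; fun_prop
  have hint : ∀ x, Integrable (Q x) σ := fun x =>
    integrable_of_norm_le_rpow hσ hs0 hs (hm x) (hC x)
  have bd : ∀ ε > 0, ∀ x y, ‖χ ε x y • Q x y‖ ≤ C * ε ^ (-s) := by
    intro ε hε x y
    rw [norm_smul, Real.norm_of_nonneg (χ0 ε x y)]
    rcases le_total ‖x - y‖ ε with h | h
    · rw [χs ε hε x y h, zero_mul]; positivity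
    · calc _ ≤ 1 * (C * ‖x - y‖ ^ (-s)) := by
            gcongr
            · exact χ1 ε x y
            · exact hC x y
        _ ≤ C * ε ^ (-s) := by
            rw [one_mul]
            gcongr ?_ * ?_
            exact Real.rpow_le_rpow_of_nonpos hε h (by linarith)
  have hcont : ∀ ε > 0, Continuous fun x => ∫ y, χ ε x y • Q x y ∂σ := by
    intro ε hε
    refine continuous_of_dominated (bound := fun _ => C * ε ^ (-s)) (fun x => ?_) (fun x => ?_)
      (integrable_const _) ?_
    · exact (χm ε x).aestronglyMeasurable.smul (hm x)
    · exact Eventually.of_forall fun y => bd ε hε x y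
    · refine Eventually.of_forall fun y => ?_
      rw [continuous_iff_continuousAt]
      intro x
      by_cases h : x = y
      · have : (fun x => χ ε x y • Q x y) =ᶠ[𝓝 x] fun _ => 0 := by
          filter_upwards [Metric.ball_mem_nhds x hε] with z hz
          rw [χs ε hε z y, zero_smul]
          rw [← dist_eq_norm, ← h]; exact hz.le
        exact continuousAt_const.congr this.symm
      · exact (χc ε y).continuousAt.smul (hc x y h)
  set D := C * (M * powConst n s) * 2 ^ ((n : ℝ) + 1 - s) with hD
  have hp := powConst_pos n s
  have hD0 : 0 ≤ D := by positivity
  have approx : ∀ ε > 0, ∀ x, dist (∫ y, Q x y ∂σ) (∫ y, χ ε x y • Q x y ∂σ) ≤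
      D * ε ^ ((n : ℝ) + 1 - s) := by
    intro ε hε x
    have hi2 : Integrable (fun y => χ ε x y • Q x y) σ :=
      (integrable_const (C * ε ^ (-s))).mono' ((χm ε x).aestronglyMeasurable.smul (hm x))
        (Eventually.of_forall fun y => bd ε hε x y)
    rw [dist_eq_norm, ← integral_sub (hint x) hi2]
    have hi3 : Integrable ((closedBall x (2 * ε)).indicator fun y => C * ‖x - y‖ ^ (-s)) σ :=
      ((integrable_rpow_of_le hσ hs0 hs x).const_mul C).indicator measurableSet_closedBall
    calc _ ≤ ∫ y, (closedBall x (2 * ε)).indicator (fun y => C * ‖x - y‖ ^ (-s)) y ∂σ := by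
          refine norm_integral_le_of_norm_le hi3 (Eventually.of_forall fun y => ?_)
          by_cases hy : y ∈ closedBall x (2 * ε)
          · rw [indicator_of_mem hy]
            have : Q x y - χ ε x y • Q x y = (1 - χ ε x y) • Q x y := by rw [sub_smul, one_smul]
            rw [this, norm_smul, Real.norm_of_nonneg (by linarith [χ1 ε x y])]
            calc _ ≤ 1 * ‖Q x y‖ := by gcongr; linarith [χ0 ε x y]
              _ ≤ _ := by rw [one_mul]; exact hC x y
          · rw [indicator_of_notMem hy, χb ε hε x y, one_smul, sub_self, norm_zero]
            rw [mem_closedBall, dist_comm, dist_eq_norm, not_le] at hy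
            exact hy.le
      _ = C * ∫ y in closedBall x (2 * ε), ‖x - y‖ ^ (-s) ∂σ := by
          rw [integral_indicator measurableSet_closedBall, integral_const_mul]
      _ ≤ C * (M * powConst n s * (2 * ε) ^ ((n : ℝ) + 1 - s)) := by
          gcongr; exact setIntegral_rpow_le_of_le hσ hs0 hs x x (by positivity)
      _ = _ := by rw [hD, Real.mul_rpow (by norm_num) hε.le]; ring
  refine continuous_of_uniform_approx_of_continuous fun u hu => ?_
  obtain ⟨δ, hδ, hsub⟩ := Metric.mem_uniformity_dist.1 hu
  have ht : Tendsto (fun ε : ℝ => D * ε ^ ((n : ℝ) + 1 - s)) (𝓝[>] 0) (𝓝 0) := by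
    have : ContinuousAt (fun ε : ℝ => D * ε ^ ((n : ℝ) + 1 - s)) 0 :=
      continuousAt_const.mul (Real.continuousAt_rpow_const _ _ (Or.inr (by linarith)))
    have h2 := this.tendsto
    simp only [Real.zero_rpow (by linarith : (n : ℝ) + 1 - s ≠ 0), mul_zero] at h2
    exact h2.mono_left nhdsWithin_le_nhds
  obtain ⟨ε, hε1, hε⟩ := ((ht.eventually_lt_const hδ).and self_mem_nhdsWithin).exists
  exact ⟨_, hcont ε hε, fun x => hsub ((approx ε hε x).trans_lt hε1)⟩

end Density

/-! ### Mean values and fluxes of potentials -/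

/-- The weighted outward flux `∫ (1 - |ω|²)_+³ ω · u(x + r ω) dω` of a vector field. -/
def wflux (u : Euc n → Euc n) (x : Euc n) (r : ℝ) : ℝ := ∫ w, bump 3 w * ⟪w, u (x + r • w)⟫

section Fubini

variable {F : Type*} [NormedAddCommGroup F] [NormedSpace ℝ F] {ν : Measure (Euc n)}
  {Q : Euc n → Euc n → F} {x : Euc n} {r : ℝ}

lemma aestronglyMeasurable_bump_smul_comp [SFinite ν]
    (hm : StronglyMeasurable (Function.uncurry Q)) :
    AEStronglyMeasurable (fun p : Euc n × Euc n => bump 3 p.1 • Q (x + r • p.1) p.2)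
      ((volume : Measure (Euc n)).prod ν) := by
  refine StronglyMeasurable.aestronglyMeasurable ?_
  refine ((continuous_bump 3).stronglyMeasurable.comp_measurable measurable_fst).smul ?_
  exact hm.comp_measurable (g := fun p : Euc n × Euc n => (x + r • p.1, p.2)) (by fun_prop)

/-- The hypothesis of Fubini's theorem for the means of a potential in a ball that is far from the
mass. -/
lemma integrable_prod_of_dominated [SFinite ν]
    (hm : StronglyMeasurable (Function.uncurry Q)) (hr : 0 ≤ r)
    {b : Euc n → ℝ} (hb : Integrable b ν)
    (hQ : ∀ᵐ y ∂ν, ∀ z ∈ closedBall x r, ‖Q z y‖ ≤ b y) :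
    Integrable (fun p : Euc n × Euc n => bump 3 p.1 • Q (x + r • p.1) p.2)
      ((volume : Measure (Euc n)).prod ν) := by
  refine ((integrable_bump (n := n) (k := 3) (by norm_num)).mul_prod hb).mono'
    (aestronglyMeasurable_bump_smul_comp hm) ?_
  have := Measure.quasiMeasurePreserving_snd (μ := (volume : Measure (Euc n))) (ν := ν) |>.ae hQ
  filter_upwards [this] with p hp
  rw [norm_smul, Real.norm_of_nonneg (bump_nonneg _ _)]
  by_cases hw : bump 3 p.1 = 0
  · simp [hw]
  · exact mul_le_mul_of_nonneg_left (hp _ (add_smul_mem_closedBall hr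
      (norm_lt_one_of_bump_ne_zero (by norm_num) hw).le)) (bump_nonneg _ _)

/-- The hypothesis of Fubini's theorem for the means of a potential with a weakly singular kernel,
in an arbitrary ball. -/
lemma integrable_prod_of_weaklySingular [IsFiniteMeasure ν]
    (hm : StronglyMeasurable (Function.uncurry Q)) (hr : 0 < r) {s C : ℝ} (hC0 : 0 ≤ C)
    (hs0 : 0 ≤ s) (hs : s < n + 1) (hC : ∀ x y, ‖Q x y‖ ≤ C * ‖x - y‖ ^ (-s)) :
    Integrable (fun p : Euc n × Euc n => bump 3 p.1 • Q (x + r • p.1) p.2)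
      ((volume : Measure (Euc n)).prod ν) := by
  refine ⟨aestronglyMeasurable_bump_smul_comp hm, ?_⟩
  rw [HasFiniteIntegral, lintegral_prod_symm _
    (aestronglyMeasurable_bump_smul_comp hm).enorm]
  have hb : ∀ y, ∫⁻ w, ‖bump 3 w • Q (x + r • w) y‖ₑ ≤
      ENNReal.ofReal C * ENNReal.ofReal (powConst n s * r ^ (-s)) := by
    intro y
    calc _ ≤ ∫⁻ w, (closedBall (0 : Euc n) 1).indicator
          (fun w => ENNReal.ofReal C * ENNReal.ofReal (‖x + r • w - y‖ ^ (-s))) w := by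
          refine lintegral_mono fun w => ?_
          by_cases hw : bump 3 w = 0
          · simp [hw]
          · rw [indicator_of_mem (by simpa using (norm_lt_one_of_bump_ne_zero (by norm_num) hw).le),
              ← ENNReal.ofReal_mul hC0, ← ofReal_norm, norm_smul,
              Real.norm_of_nonneg (bump_nonneg _ _)]
            refine ENNReal.ofReal_le_ofReal ?_
            calc _ ≤ 1 * ‖Q (x + r • w) y‖ := by gcongr; exact bump_le_one _ _
              _ ≤ _ := by rw [one_mul]; exact hC _ _
      _ = ENNReal.ofReal C *
          ∫⁻ w in closedBall 0 1, ENNReal.ofReal (‖x + r • w - y‖ ^ (-s)) := by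
          rw [lintegral_indicator measurableSet_closedBall,
            lintegral_const_mul' _ _ ENNReal.ofReal_ne_top]
      _ ≤ _ := by gcongr; exact lintegral_rpow_comp_le hs0 hs x y hr
  calc _ ≤ ∫⁻ _, ENNReal.ofReal C * ENNReal.ofReal (powConst n s * r ^ (-s)) ∂ν :=
        lintegral_mono hb
    _ < ⊤ := by
      rw [lintegral_const]
      exact ENNReal.mul_lt_top (ENNReal.mul_lt_top ENNReal.ofReal_lt_top ENNReal.ofReal_lt_top)
        (measure_lt_top _ _)

lemma wmean_integral [SFinite ν]
    (hint : Integrable (fun p : Euc n × Euc n => bump 3 p.1 • Q (x + r • p.1) p.2)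
      ((volume : Measure (Euc n)).prod ν)) :
    wmean (fun z => ∫ y, Q z y ∂ν) x r = ∫ y, wmean (Q · y) x r ∂ν := by
  unfold wmean
  simp_rw [← integral_smul]
  exact integral_integral_swap hint

lemma wflux_integral [SFinite ν] {Q : Euc n → Euc n → Euc n}
    (hQ : ∀ᵐ w, Integrable (Q (x + r • w)) ν)
    (hint : Integrable (fun p : Euc n × Euc n => bump 3 p.1 • Q (x + r • p.1) p.2)
      ((volume : Measure (Euc n)).prod ν)) :
    wflux (fun z => ∫ y, Q z y ∂ν) x r = ∫ y, wflux (Q · y) x r ∂ν := by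
  unfold wflux
  have e : (fun w => bump 3 w * ⟪w, ∫ y, Q (x + r • w) y ∂ν⟫) =ᵐ[volume]
      fun w => ∫ y, bump 3 w * ⟪w, Q (x + r • w) y⟫ ∂ν := by
    filter_upwards [hQ] with w hw
    rw [← integral_inner hw, integral_const_mul]
  rw [integral_congr_ae e]
  refine integral_integral_swap ?_
  refine hint.mono ?_ (Eventually.of_forall fun p => ?_)
  · have h1 : AEStronglyMeasurable
        (fun p : Euc n × Euc n => ⟪p.1, bump 3 p.1 • Q (x + r • p.1) p.2⟫)
        ((volume : Measure (Euc n)).prod ν) :=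
      AEStronglyMeasurable.inner (𝕜 := ℝ) measurable_fst.aestronglyMeasurable
        hint.aestronglyMeasurable
    refine h1.congr (Eventually.of_forall fun p => ?_)
    simp only [inner_smul_right, Function.uncurry]
  · simp only [Function.uncurry]
    rw [norm_mul, norm_smul]
    by_cases hw : bump 3 p.1 = 0
    · simp [hw]
    · gcongr
      have := norm_lt_one_of_bump_ne_zero (by norm_num) hw
      calc _ ≤ ‖p.1‖ * ‖Q (x + r • p.1) p.2‖ := norm_inner_le_norm _ _
        _ ≤ 1 * ‖Q (x + r • p.1) p.2‖ := by gcongr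
        _ = _ := one_mul _

end Fubini

lemma norm_wflux_le {u : Euc n → Euc n} {x : Euc n} {r : ℝ}
    (h : Integrable (fun w => bump 3 w * ‖u (x + r • w)‖)) :
    |wflux u x r| ≤ ∫ w, bump 3 w * ‖u (x + r • w)‖ := by
  rw [← Real.norm_eq_abs]
  refine norm_integral_le_of_norm_le h (Eventually.of_forall fun w => ?_)
  rw [norm_mul, Real.norm_of_nonneg (bump_nonneg _ _)]
  by_cases hw : bump 3 w = 0
  · simp [hw]
  · refine mul_le_mul_of_nonneg_left ?_ (bump_nonneg _ _)
    have := norm_lt_one_of_bump_ne_zero (by norm_num) hw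
    calc _ ≤ ‖w‖ * ‖u (x + r • w)‖ := norm_inner_le_norm _ _
      _ ≤ 1 * ‖u (x + r • w)‖ := by gcongr
      _ = _ := one_mul _

/-- The surface measure of the unit sphere of `ℝ^{n+1}`. -/
def sphereConst (n : ℕ) : ℝ := (volume : Measure (Euc n)).toSphere.real univ

lemma sphereConst_pos (n : ℕ) : 0 < sphereConst n := by
  unfold sphereConst
  rw [Measure.toSphere_real_apply_univ]
  have : 0 < (volume : Measure (Euc n)).real (ball 0 1) :=
    ENNReal.toReal_pos (measure_ball_pos _ _ one_pos).ne' measure_ball_lt_top.ne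
  simp only [finrank_euclideanSpace, Fintype.card_fin]
  positivity

/-- The integral of the kernel against the gradient of a test function, in polar coordinates. -/
lemma integral_fderiv_rieszKernel (hn : 1 ≤ n) {φ : Euc n → ℝ} (hφ : ContDiff ℝ 1 φ)
    (hc : HasCompactSupport φ) (y : Euc n) :
    ∫ z, fderiv ℝ φ (y + z) (rieszKernel z) = -sphereConst n * φ y := by
  have hd : Continuous (fderiv ℝ φ) := hφ.continuous_fderiv (by norm_num)
  have hint : Integrable (fun z => fderiv ℝ φ (y + z) (rieszKernel z)) := by
    obtain ⟨C, hC⟩ := hd.bounded_above_of_compact_support (hc.fderiv (𝕜 := ℝ))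
    obtain ⟨R, hR⟩ := (hc.fderiv (𝕜 := ℝ)).isCompact.isBounded.subset_closedBall (0 : Euc n)
    have hC0 : 0 ≤ C := (norm_nonneg _).trans (hC 0)
    have hb : IntegrableOn (fun z : Euc n => C * ‖z‖ ^ (-(n : ℝ))) (closedBall 0 (R + ‖y‖)) :=
      (integrableOn_rpow (by linarith) (R + ‖y‖)).const_mul C
    have hmeas : AEStronglyMeasurable (fun z => fderiv ℝ φ (y + z) (rieszKernel z))
        (volume : Measure (Euc n)) := by
      have h1 : StronglyMeasurable fun z => fderiv ℝ φ (y + z) :=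
        (hd.comp (by fun_prop)).stronglyMeasurable
      have h2 := (measurable_rieszKernel (n := n)).stronglyMeasurable
      exact ((continuous_fst.clm_apply continuous_snd).comp_stronglyMeasurable
        (h1.prodMk h2)).aestronglyMeasurable
    have := hb.integrable_indicator measurableSet_closedBall
    refine this.mono' hmeas (Eventually.of_forall fun z => ?_)
    by_cases hz : z ∈ closedBall (0 : Euc n) (R + ‖y‖)
    · rw [indicator_of_mem hz]
      refine (ContinuousLinearMap.le_opNorm _ _).trans ?_
      rw [norm_rieszKernel_rpow z hn]
      gcongr
      exact hC _
    · rw [indicator_of_notMem hz]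
      have : fderiv ℝ φ (y + z) = 0 := by
        by_contra h
        have h1 := hR (subset_tsupport _ (Function.mem_support.2 h))
        rw [mem_closedBall, dist_zero_right] at h1 hz
        have : ‖z‖ ≤ ‖y + z‖ + ‖y‖ := by
          simpa using norm_sub_le (y + z) y
        linarith
      simp [this]
  set f := fun z => fderiv ℝ φ (y + z) (rieszKernel z) with hf
  -- along a ray the Jacobian `t ^ n` cancels the kernel, leaving the derivative of `φ (y + t v)`
  have hline : ∀ v : Euc n, ‖v‖ = 1 →
      ∫ t in Ioi (0 : ℝ), t ^ n • f (t • v) = -φ y := by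
    intro v hv
    have e : ∀ t ∈ Ioi (0 : ℝ), t ^ n • f (t • v) = fderiv ℝ φ (y + t • v) v := by
      intro t ht
      have ht0 : (0 : ℝ) < t := ht
      have : rieszKernel (t • v) = (t ^ n)⁻¹ • v := by
        rw [rieszKernel, norm_smul, hv, mul_one, Real.norm_of_nonneg ht0.le, smul_smul]
        congr 1
        field_simp
        ring
      simp only [hf, this, map_smul, smul_smul]
      rw [mul_inv_cancel₀ (by positivity), one_smul]
    rw [setIntegral_congr_fun measurableSet_Ioi e]
    have hder : ∀ t : ℝ, HasDerivAt (fun t : ℝ => φ (y + t • v)) (fderiv ℝ φ (y + t • v) v) t := by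
      intro t
      have h1 : HasDerivAt (fun s : ℝ => y + s • v) v t := by
        simpa using ((hasDerivAt_id t).smul_const v).const_add y
      exact ((hφ.differentiable (by norm_num)) (y + t • v)).hasFDerivAt.comp_hasDerivAt t h1
    have hemb : IsClosedEmbedding (fun t : ℝ => y + t • v) := by
      have : Isometry (fun t : ℝ => y + t • v) := by
        refine Isometry.of_dist_eq fun a b => ?_
        rw [dist_add_left, dist_eq_norm, ← sub_smul, norm_smul, hv, mul_one, dist_eq_norm]
      exact this.isClosedEmbedding
    have hc1 : HasCompactSupport (fun t : ℝ => φ (y + t • v)) := hc.comp_isClosedEmbedding hemb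
    have hc2 : HasCompactSupport (fun t : ℝ => fderiv ℝ φ (y + t • v) v) :=
      ((hc.fderiv (𝕜 := ℝ)).comp_isClosedEmbedding hemb).mono (fun t ht h => ht (by
        simp only [Function.comp] at h; simp [h]))
    have hcont : Continuous (fun t : ℝ => fderiv ℝ φ (y + t • v) v) :=
      (hd.comp (by fun_prop)).clm_apply continuous_const
    have hi := hcont.integrable_of_hasCompactSupport (μ := volume) hc2
    rw [integral_Ioi_of_hasDerivAt_of_tendsto (m := 0)
      (hder 0).continuousAt.continuousWithinAt (fun t _ => hder t) hi.integrableOn]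
    · simp
    · exact hc1.is_zero_at_infty.mono_left atTop_le_cocompact
  -- polar coordinates
  have hmp := (volume : Measure (Euc n)).measurePreserving_homeomorphUnitSphereProd
  have hdim : Module.finrank ℝ (Euc n) - 1 = n := by simp
  rw [hdim] at hmp
  set g : sphere (0 : Euc n) 1 × Ioi (0 : ℝ) → ℝ := fun p => f ((p.2 : ℝ) • (p.1 : Euc n)) with hg
  have hgf : ∀ z : ({0}ᶜ : Set (Euc n)), g (homeomorphUnitSphereProd (Euc n) z) = f z := by
    intro z
    have := (homeomorphUnitSphereProd (Euc n)).symm_apply_apply z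
    have h2 := congrArg Subtype.val this
    rw [homeomorphUnitSphereProd_symm_apply_coe] at h2
    simp only [hg, h2]
  have e1 : ∫ z, f z = ∫ p, g p ∂((volume : Measure (Euc n)).toSphere.prod
      (Measure.volumeIoiPow n)) := by
    rw [← hmp.integral_comp (Homeomorph.measurableEmbedding _)]
    simp only [hgf]
    rw [integral_subtype_comap (measurableSet_singleton _).compl, restrict_compl_singleton]
  have hgi : Integrable g ((volume : Measure (Euc n)).toSphere.prod
      (Measure.volumeIoiPow n)) := by
    rw [← hmp.integrable_comp_emb (Homeomorph.measurableEmbedding _)]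
    have : g ∘ (homeomorphUnitSphereProd (Euc n)) = f ∘ Subtype.val := funext hgf
    rw [this, ← integrableOn_iff_comap_subtypeVal (measurableSet_singleton _).compl,
      IntegrableOn, restrict_compl_singleton]
    exact hint
  rw [e1, integral_prod _ hgi]
  have e2 : ∀ v : sphere (0 : Euc n) 1, ∫ t, g (v, t) ∂(Measure.volumeIoiPow n) = -φ y := by
    intro v
    rw [← hline v (by simp)]
    simp only [Measure.volumeIoiPow, ENNReal.ofReal, hg]
    rw [integral_withDensity_eq_integral_smul,
      integral_subtype_comap measurableSet_Ioi fun a =>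
        Real.toNNReal (a ^ n) • f (a • (v : Euc n)),
      setIntegral_congr_fun measurableSet_Ioi fun t ht => ?_]
    · rw [NNReal.smul_def, Real.coe_toNNReal _ (pow_nonneg (le_of_lt ht) _)]
    · exact (measurable_subtype_coe.pow_const _).real_toNNReal
  simp only [e2, integral_const, smul_eq_mul]
  rw [sphereConst]
  ring

/-- The flux of the Riesz kernel, a form of Gauss's law. -/
lemma wflux_rieszKernel (hn : 1 ≤ n) (x y : Euc n) {r : ℝ} (hr : 0 < r) :
    wflux (fun z => rieszKernel (z - y)) x r =
      sphereConst n / (8 * r ^ n) * bump 4 (r⁻¹ • (y - x)) := by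
  set y' := r⁻¹ • (y - x) with hy'
  have h := integral_fderiv_rieszKernel hn (φ := bump 4)
    ((contDiff_posPart_pow 3 1 (by norm_num)).comp (contDiff_const.sub (contDiff_norm_sq ℝ)))
    (hasCompactSupport_bump (n := n) (k := 4) (by norm_num)) y'
  have e : ∀ w : Euc n, bump 3 w * ⟪w, rieszKernel (x + r • w - y)⟫ =
      -(1 / (8 * r ^ n)) * fderiv ℝ (bump 4) (y' + (w - y')) (rieszKernel (w - y')) := by
    intro w
    have e1 : x + r • w - y = r • (w - y') := by
      rw [smul_sub, hy', smul_inv_smul₀ hr.ne']; abel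
    have e2 : rieszKernel (r • (w - y')) = (r ^ n)⁻¹ • rieszKernel (w - y') := by
      rw [rieszKernel, rieszKernel, norm_smul, Real.norm_of_nonneg hr.le, smul_smul, smul_smul]
      congr 1
      rw [mul_pow, mul_inv, pow_succ r]
      field_simp
    rw [add_sub_cancel, e1, e2, (hasFDerivAt_bump_four w).fderiv, inner_smul_right]
    simp
    field_simp
  unfold wflux
  simp only [e]
  rw [integral_const_mul, integral_sub_right_eq_self
    (fun w => fderiv ℝ (bump 4) (y' + w) (rieszKernel w)), h]
  field_simp

/-! ### Regularity from the mean value property -/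

/-- A continuous function with the mean value property is of class `C²`, being locally equal to
its own mollification. -/
lemma contDiffOn_of_wmean_eq {F : Type*} [NormedAddCommGroup F] [NormedSpace ℝ F]
    [CompleteSpace F] {u : Euc n → F} {O : Set (Euc n)} (hO : IsOpen O) (hu : ContinuousOn u O)
    (h : ∀ x r, 0 < r → closedBall x r ⊆ O → wmean u x r = wmass n • u x) :
    ContDiffOn ℝ 2 u O := by
  intro x hx
  obtain ⟨ε', hε', hsub'⟩ := Metric.nhds_basis_closedBall.mem_iff.1 (hO.mem_nhds hx)
  obtain ⟨ε, rfl⟩ : ∃ ε, ε' = 2 * ε := ⟨ε' / 2, by ring⟩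
  have hε : 0 < ε := by linarith
  set g := (closedBall x (2 * ε)).indicator u with hg
  have hgi : Integrable g := ((hu.mono hsub').integrableOn_compact
    (isCompact_closedBall _ _)).integrable_indicator measurableSet_closedBall
  -- `u` is a multiple of the convolution of its restriction to a ball with this rescaled weight
  set k : Euc n → ℝ := fun v => bump 3 (ε⁻¹ • v) with hk
  have hkd : ContDiff ℝ 2 k := contDiff_bump_three.comp (contDiff_id.const_smul ε⁻¹)
  have hkc : HasCompactSupport k := (hasCompactSupport_bump (by norm_num)).comp_homeomorph
    (Homeomorph.smulOfNeZero ε⁻¹ (inv_ne_zero hε.ne'))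
  have hconv := hkc.contDiff_convolution_right (n := 2) (ContinuousLinearMap.lsmul ℝ ℝ).flip
    hgi.locallyIntegrable hkd
  set C := convolution g k (ContinuousLinearMap.lsmul ℝ ℝ).flip (volume : Measure (Euc n))
  have key : ∀ y ∈ ball x ε, u y = ((wmass n)⁻¹ * (ε ^ (n + 1))⁻¹) • C y := by
    intro y hy
    have hyb : closedBall y ε ⊆ closedBall x (2 * ε) :=
      closedBall_subset_closedBall' (by rw [mem_ball] at hy; linarith)
    have hm := h y ε hε (hyb.trans hsub')
    have e1 : wmean u y ε = wmean g y ε := by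
      unfold wmean
      refine integral_congr_ae (Eventually.of_forall fun w => ?_)
      by_cases hw : bump 3 w = 0
      · simp [hw]
      · simp only [hg]
        rw [indicator_of_mem (hyb (add_smul_mem_closedBall hε.le
          (norm_lt_one_of_bump_ne_zero (by norm_num) hw).le))]
    have e2 : wmean g y ε = (ε ^ (n + 1))⁻¹ • C y := by
      have h2 := Measure.integral_comp_smul_of_nonneg (volume : Measure (Euc n))
        (fun v => bump 3 (ε⁻¹ • v) • g (y + v)) ε (hR := hε.le)
      simp only [inv_smul_smul₀ hε.ne', finrank_euclideanSpace, Fintype.card_fin] at h2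
      unfold wmean
      rw [h2]
      congr 1
      rw [← integral_add_left_eq_self _ (-y)]
      simp only [C, convolution]
      refine integral_congr_ae (Eventually.of_forall fun v => ?_)
      simp only [hk, add_neg_cancel_left, ContinuousLinearMap.flip_apply,
        ContinuousLinearMap.lsmul_apply]
      congr 1
      rw [← bump_neg, ← smul_neg]
      congr 2; abel
    rw [mul_smul, ← e2, ← e1, hm, smul_smul, inv_mul_cancel₀ (wmass_pos n).ne', one_smul]
  have : ContDiffAt ℝ 2 u x := by
    refine ContDiffAt.congr_of_eventuallyEq ?_ (eventually_of_mem (ball_mem_nhds x hε) key)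
    exact (hconv.const_smul _).contDiffAt
  exact this.contDiffWithinAt

/-! ### The variational argument -/

/-- A one-sided variational principle on measurable sets: a functional which is continuous along
decreasing sequences of sets admits a set from which no part `S` can be removed at a gain larger
than `lam * σ S`. -/
lemma exists_stable_subset {X : Type*} [MeasurableSpace X] (σ : Measure X) [IsFiniteMeasure σ]
    (J : Set X → ℝ) (lam : ℝ)
    (hJ : ∀ A : ℕ → Set X, (∀ k, MeasurableSet (A k)) → Antitone A →
      Tendsto (fun k => J (A k)) atTop (𝓝 (J (⋂ k, A k)))) :
    ∃ A, MeasurableSet A ∧ J A + lam * σ.real Aᶜ ≤ J univ ∧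
      ∀ S ⊆ A, MeasurableSet S → 0 < σ.real S → J A ≤ J (A \ S) + lam * σ.real S := by
  set Φ : Set X → ℝ := fun A => J A - lam * σ.real A with hΦ
  -- among the subsets on which `Φ` does not increase, choose one of almost minimal measure
  have step : ∀ (k : ℕ) (A : {A : Set X // MeasurableSet A}), ∃ B : {A : Set X // MeasurableSet A},
      B.1 ⊆ A.1 ∧ Φ B.1 ≤ Φ A.1 ∧
      ∀ C, MeasurableSet C → C ⊆ A.1 → Φ C ≤ Φ A.1 → σ.real B.1 ≤ σ.real C + 1 / ((k : ℝ) + 1) := by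
    rintro k ⟨A, hA⟩
    set T : Set ℝ := {t | ∃ C, MeasurableSet C ∧ C ⊆ A ∧ Φ C ≤ Φ A ∧ σ.real C = t} with hT
    have hTne : T.Nonempty := ⟨_, A, hA, subset_rfl, le_rfl, rfl⟩
    have hTb : BddBelow T := ⟨0, by rintro t ⟨C, -, -, -, rfl⟩; exact measureReal_nonneg⟩
    obtain ⟨t, ⟨B, hB1, hB2, hB3, rfl⟩, ht⟩ := exists_lt_of_csInf_lt hTne
      (lt_add_of_pos_right (sInf T) (by positivity : (0 : ℝ) < 1 / ((k : ℝ) + 1)))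
    refine ⟨⟨B, hB1⟩, hB2, hB3, fun C hC1 hC2 hC3 => ?_⟩
    have := csInf_le hTb ⟨C, hC1, hC2, hC3, rfl⟩
    simp only
    linarith
  choose next hn1 hn2 hn3 using step
  set A : ℕ → {A : Set X // MeasurableSet A} :=
    fun k => Nat.rec ⟨univ, MeasurableSet.univ⟩ next k with hA
  have hAs : ∀ k, A (k + 1) = next k (A k) := fun k => rfl
  have hanti : Antitone fun k => (A k).1 := antitone_nat_of_succ_le fun k => hn1 k (A k)
  have hΦanti : Antitone fun k => Φ (A k).1 := antitone_nat_of_succ_le fun k => hn2 k (A k)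
  set A' := ⋂ k, (A k).1 with hA'
  have hA'm : MeasurableSet A' := MeasurableSet.iInter fun k => (A k).2
  have hσ : Tendsto (fun k => σ.real (A k).1) atTop (𝓝 (σ.real A')) := by
    have := tendsto_measure_iInter_atTop (μ := σ) (fun k => (A k).2.nullMeasurableSet) hanti
      ⟨0, measure_ne_top _ _⟩
    exact (ENNReal.tendsto_toReal (measure_ne_top _ _)).comp this
  have hΦt : Tendsto (fun k => Φ (A k).1) atTop (𝓝 (Φ A')) :=
    (hJ _ (fun k => (A k).2) hanti).sub (hσ.const_mul lam)
  have hle : ∀ k, Φ A' ≤ Φ (A k).1 := fun k => hΦanti.le_of_tendsto hΦt k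
  refine ⟨A', hA'm, ?_, fun S hS hSm hSpos => ?_⟩
  · have := hle 0
    simp only [hΦ] at this
    change _ ≤ J univ - lam * σ.real univ at this
    rw [measureReal_compl hA'm]
    linarith
  · by_contra! hlt
    -- removing `S` would not increase `Φ`, and so contradict the near minimality at late stages
    have hd : σ.real (A' \ S) = σ.real A' - σ.real S := measureReal_sdiff hS hSm
    have h1 : Φ (A' \ S) ≤ Φ A' := by simp only [hΦ, hd]; linarith
    have h2 : ∀ k : ℕ, σ.real (A (k + 1)).1 ≤ σ.real (A' \ S) + 1 / ((k : ℝ) + 1) := fun k =>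
      hn3 k (A k) _ (hA'm.diff hSm) (sdiff_subset.trans (iInter_subset _ k)) (h1.trans (hle k))
    have h3 := le_of_tendsto_of_tendsto' ((tendsto_add_atTop_iff_nat 1).2 hσ)
      (tendsto_const_nhds.add tendsto_one_div_add_atTop_nhds_zero_nat) h2
    linarith

/-- The field generated by the part of `σ` on `A`, in the presence of the external field `H`. -/
def field (σ : Measure (Euc n)) (H : Euc n → Euc n) (A : Set (Euc n)) (x : Euc n) : Euc n :=
  H x + ∫ y in A, rieszKernel (x - y) ∂σ

/-- The functional minimised in the variational argument. -/
def energy (σ : Measure (Euc n)) (H : Euc n → Euc n) (A : Set (Euc n)) : ℝ :=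
  ∫ x in A, ‖field σ H A x‖ ^ 2 ∂σ

/-- The adjoint Riesz transform of the vector measure `field σ H A • σ|_A`. -/
def adjField (σ : Measure (Euc n)) (H : Euc n → Euc n) (A : Set (Euc n)) (y : Euc n) : ℝ :=
  ∫ x in A, ⟪rieszKernel (x - y), field σ H A x⟫ ∂σ

/-- The first variation of `energy`: removing a small mass `m` at `x` lowers the energy by
`m * firstVar σ H A x`, up to terms of higher order. -/
def firstVar (σ : Measure (Euc n)) (H : Euc n → Euc n) (A : Set (Euc n)) (x : Euc n) : ℝ :=
  ‖field σ H A x‖ ^ 2 + 2 * adjField σ H A x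

section Variation

variable {σ : Measure (Euc n)} {M : ℝ≥0}

lemma restrict_le_smul (hσ : σ ≤ M • volume) (A : Set (Euc n)) : σ.restrict A ≤ M • volume :=
  Measure.restrict_le_self.trans hσ

variable [IsFiniteMeasure σ]

lemma integrable_prod_rpow {σ₁ σ₂ : Measure (Euc n)} [IsFiniteMeasure σ₁] [IsFiniteMeasure σ₂]
    (h₁ : σ₁ ≤ M • volume) {s : ℝ} (hs0 : 0 ≤ s) (hs : s < n + 1) :
    Integrable (fun p : Euc n × Euc n => ‖p.1 - p.2‖ ^ (-s)) (σ₁.prod σ₂) := by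
  have hm : Measurable fun p : Euc n × Euc n => ‖p.1 - p.2‖ ^ (-s) := by fun_prop
  refine ⟨hm.aestronglyMeasurable, ?_⟩
  rw [HasFiniteIntegral, lintegral_prod_symm _ hm.aestronglyMeasurable.enorm]
  calc _ ≤ ∫⁻ _, ENNReal.ofReal (M * powConst n s + σ₁.real univ) ∂σ₂ := by
        refine lintegral_mono fun y => ?_
        refine le_trans (le_of_eq ?_) (lintegral_rpow_le_of_le h₁ hs0 hs y)
        refine lintegral_congr fun x => ?_
        rw [Real.enorm_of_nonneg (by positivity), norm_sub_rev]
    _ < ⊤ := by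
        rw [lintegral_const]
        exact ENNReal.mul_lt_top ENNReal.ofReal_lt_top (measure_lt_top _ _)

lemma norm_rieszKernel_sub_le_rpow (hn : 1 ≤ n) (x y : Euc n) :
    ‖rieszKernel (x - y)‖ ≤ 1 * ‖x - y‖ ^ (-(n : ℝ)) := by
  rw [one_mul, norm_rieszKernel_rpow _ hn]

lemma continuousAt_rieszKernel_sub {x y : Euc n} (h : x ≠ y) :
    ContinuousAt (fun x => rieszKernel (x - y)) x :=
  ContinuousAt.comp (f := fun x => x - y) (continuousAt_rieszKernel (sub_ne_zero.2 h))
    (by fun_prop)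

lemma continuous_integral_rieszKernel (hn : 1 ≤ n) (hσ : σ ≤ M • volume) :
    Continuous fun x => ∫ y, rieszKernel (x - y) ∂σ :=
  continuous_integral_of_weaklySingular (Q := fun x y => rieszKernel (x - y)) (s := n) (C := 1) hσ
    (by positivity) (by linarith) zero_le_one
    (fun x => (measurable_rieszKernel.comp (by fun_prop)).aestronglyMeasurable)
    (fun x y h => continuousAt_rieszKernel_sub h)
    (fun x y => norm_rieszKernel_sub_le_rpow hn x y)

lemma integrable_rieszKernel (hn : 1 ≤ n) (hσ : σ ≤ M • volume) (x : Euc n) :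
    Integrable (fun y => rieszKernel (x - y)) σ :=
  integrable_of_norm_le_rpow (s := n) (C := 1) hσ (by positivity) (by linarith)
    (measurable_rieszKernel.comp (by fun_prop)).aestronglyMeasurable
    (fun y => norm_rieszKernel_sub_le_rpow hn x y)

lemma norm_integral_rieszKernel_le (hn : 1 ≤ n) (hσ : σ ≤ M • volume) (x : Euc n) :
    ‖∫ y, rieszKernel (x - y) ∂σ‖ ≤ M * powConst n n + σ.real univ := by
  refine (norm_integral_le_of_norm_le (integrable_rpow_of_le (s := n) hσ (by positivity)
    (by linarith) x) (Eventually.of_forall fun y => ?_)).trans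
    (integral_rpow_le_of_le hσ (by positivity) (by linarith) x)
  rw [norm_rieszKernel_rpow _ hn]

variable {H : Euc n → Euc n} {CH : ℝ}

lemma measurable_field (hn : 1 ≤ n) (hσ : σ ≤ M • volume) (hH : Measurable H) (A : Set (Euc n)) :
    Measurable (field σ H A) :=
  hH.add (continuous_integral_rieszKernel hn (restrict_le_smul hσ A)).measurable

lemma norm_field_le (hn : 1 ≤ n) (hσ : σ ≤ M • volume) (hHb : ∀ x, ‖H x‖ ≤ CH)
    (A : Set (Euc n)) (x : Euc n) :
    ‖field σ H A x‖ ≤ CH + (M * powConst n n + σ.real univ) := by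
  refine (norm_add_le _ _).trans (add_le_add (hHb x)
    ((norm_integral_rieszKernel_le hn (restrict_le_smul hσ A) x).trans ?_))
  gcongr
  rw [measureReal_restrict_apply_univ]
  exact measureReal_mono (subset_univ _)

/-- The energy is continuous along decreasing sequences of sets, as `exists_stable_subset`
requires. -/
lemma tendsto_energy_iInter (hn : 1 ≤ n) (hσ : σ ≤ M • volume) (hH : Measurable H)
    (hHb : ∀ x, ‖H x‖ ≤ CH) (A : ℕ → Set (Euc n)) (hA : ∀ k, MeasurableSet (A k))
    (hanti : Antitone A) :
    Tendsto (fun k => energy σ H (A k)) atTop (𝓝 (energy σ H (⋂ k, A k))) := by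
  have hf : ∀ x, Tendsto (fun k => field σ H (A k) x) atTop (𝓝 (field σ H (⋂ k, A k) x)) :=
    fun x => tendsto_const_nhds.add (tendsto_setIntegral_of_antitone hA hanti
      ⟨0, (integrable_rieszKernel hn hσ x).integrableOn⟩)
  unfold energy
  simp only [← integral_indicator (hA _), ← integral_indicator (MeasurableSet.iInter hA)]
  set C := CH + (M * powConst n n + σ.real univ) with hC
  refine tendsto_integral_of_dominated_convergence (fun _ => C ^ 2) (fun k => ?_)
    (integrable_const _) (fun k => Eventually.of_forall fun x => ?_)
    (Eventually.of_forall fun x => ?_)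
  · exact (((measurable_field hn hσ hH _).norm.pow_const 2).indicator
      (hA k)).aestronglyMeasurable
  · by_cases hx : x ∈ A k
    · rw [indicator_of_mem hx, norm_pow, norm_norm]
      gcongr
      exact norm_field_le hn hσ hHb _ _
    · rw [indicator_of_notMem hx, norm_zero]; positivity
  · by_cases hx : x ∈ ⋂ k, A k
    · rw [indicator_of_mem hx]
      have : ∀ k, x ∈ A k := fun k => mem_iInter.1 hx k
      simp only [indicator_of_mem (this _)]
      exact (hf x).norm.pow 2
    · rw [indicator_of_notMem hx]
      obtain ⟨k, hk⟩ : ∃ k, x ∉ A k := by simpa using hx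
      refine tendsto_const_nhds.congr' ?_
      filter_upwards [eventually_ge_atTop k] with m hm
      rw [indicator_of_notMem fun h => hk (hanti hm h)]

/-- The adjoint of the Riesz transform, by Fubini's theorem. -/
lemma setIntegral_inner_rieszKernel_comm (hn : 1 ≤ n) (hσ : σ ≤ M • volume)
    {f : Euc n → Euc n} {C : ℝ} (hf : Measurable f) (hfb : ∀ x, ‖f x‖ ≤ C) (A S : Set (Euc n)) :
    ∫ x in A, ⟪f x, ∫ y in S, rieszKernel (x - y) ∂σ⟫ ∂σ =
      ∫ y in S, ∫ x in A, ⟪rieszKernel (x - y), f x⟫ ∂σ ∂σ := by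
  have e : ∀ x, ⟪f x, ∫ y in S, rieszKernel (x - y) ∂σ⟫ =
      ∫ y in S, ⟪rieszKernel (x - y), f x⟫ ∂σ := fun x => by
    rw [← integral_inner (integrable_rieszKernel hn (restrict_le_smul hσ S) x)]
    simp only [real_inner_comm]
  simp only [e]
  refine integral_integral_swap ?_
  have hC0 : 0 ≤ C := (norm_nonneg _).trans (hfb 0)
  refine ((integrable_prod_rpow (s := n) (restrict_le_smul hσ A) (by positivity)
    (by linarith)).const_mul C).mono' ?_ (Eventually.of_forall fun p => ?_)
  · refine Measurable.aestronglyMeasurable ?_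
    exact Measurable.inner (𝕜 := ℝ) (measurable_rieszKernel.comp (by fun_prop))
      (hf.comp measurable_fst)
  · simp only [Function.uncurry]
    refine (norm_inner_le_norm _ _).trans ?_
    rw [norm_rieszKernel_rpow _ hn, mul_comm]
    gcongr
    exact hfb _

lemma field_sdiff (hn : 1 ≤ n) (hσ : σ ≤ M • volume) {A S : Set (Euc n)} (hS : MeasurableSet S)
    (hSA : S ⊆ A) (x : Euc n) :
    field σ H (A \ S) x = field σ H A x - ∫ y in S, rieszKernel (x - y) ∂σ := by
  unfold field
  rw [setIntegral_sdiff hS (integrable_rieszKernel hn hσ x).integrableOn hSA]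
  abel

lemma continuous_adjField (hn : 1 ≤ n) (hσ : σ ≤ M • volume) (hH : Measurable H)
    (hHb : ∀ x, ‖H x‖ ≤ CH) (A : Set (Euc n)) : Continuous (adjField σ H A) := by
  have hfm := measurable_field hn hσ hH A
  have hfb := norm_field_le hn hσ hHb A
  refine continuous_integral_of_weaklySingular (σ := σ.restrict A)
    (Q := fun y x => ⟪rieszKernel (x - y), field σ H A x⟫) (s := n)
    (C := CH + (M * powConst n n + σ.real univ)) (restrict_le_smul hσ A)
    (by positivity) (by linarith) ((norm_nonneg _).trans (hfb 0)) (fun y => ?_) (fun y x h => ?_)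
    (fun y x => ?_)
  · exact (Measurable.inner (𝕜 := ℝ) (measurable_rieszKernel.comp (by fun_prop))
      hfm).aestronglyMeasurable
  · refine ContinuousAt.inner (𝕜 := ℝ) ?_ continuousAt_const
    exact ContinuousAt.comp (f := fun y => x - y) (continuousAt_rieszKernel
      (sub_ne_zero.2 h.symm)) (by fun_prop)
  · refine (norm_inner_le_norm _ _).trans ?_
    rw [norm_rieszKernel_rpow _ hn, mul_comm, norm_sub_rev]
    gcongr
    exact hfb _

/-- If no part of `A` can be removed at a gain larger than `lam` times its measure, then the first
variation is at most `lam` almost everywhere on `A`. -/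
lemma firstVar_le_of_stable (hn : 1 ≤ n) (hσ : σ ≤ M • volume) (hH : Measurable H)
    (hHb : ∀ x, ‖H x‖ ≤ CH) {A : Set (Euc n)} (hA : MeasurableSet A) {lam : ℝ}
    (hstable : ∀ S ⊆ A, MeasurableSet S → 0 < σ.real S →
      energy σ H A ≤ energy σ H (A \ S) + lam * σ.real S) :
    ∀ᵐ x ∂σ.restrict A, firstVar σ H A x ≤ lam := by
  set f := field σ H A with hf
  have hfm : Measurable f := measurable_field hn hσ hH A
  set Cf := CH + (M * powConst n n + σ.real univ) with hCf
  have hfb : ∀ x, ‖f x‖ ≤ Cf := norm_field_le hn hσ hHb A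
  have hCf0 : 0 ≤ Cf := (norm_nonneg _).trans (hfb 0)
  set D := M * powConst n n + σ.real univ with hD
  have hpow := powConst_pos n n
  have hD0 : 0 ≤ D := by positivity
  have hadj : Continuous (adjField σ H A) := continuous_adjField hn hσ hH hHb A
  have hVm : Measurable (firstVar σ H A) := (hfm.norm.pow_const 2).add (hadj.measurable.const_mul 2)
  have key : ∀ ε > 0, σ.restrict A {x | lam + ε < firstVar σ H A x} = 0 := by
    intro ε hε
    by_contra hne
    -- remove a part `S` of the exceptional set `W` that lies in a small ball, so that the field of
    -- `S` is at most `δ`: the energy then drops by `∫_S V`, up to an error of order `δ σ(S)`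
    set W := A ∩ {x | lam + ε < firstVar σ H A x} with hW
    have hWm : MeasurableSet W := hA.inter (measurableSet_lt measurable_const hVm)
    have hWpos : σ W ≠ 0 := by
      rwa [Measure.restrict_apply (measurableSet_lt measurable_const hVm), inter_comm] at hne
    obtain ⟨x₀, hx₀⟩ := Measure.nonempty_support (μ := σ.restrict W) (by
      rwa [Ne, Measure.restrict_eq_zero])
    obtain ⟨r, hr0, hr⟩ : ∃ r : ℝ, 0 < r ∧ M * powConst n n * r * (D + 2 * Cf) < ε := by
      have : Tendsto (fun r : ℝ => M * powConst n n * r * (D + 2 * Cf)) (𝓝[>] 0) (𝓝 0) := by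
        have h : Continuous fun r : ℝ => M * powConst n n * r * (D + 2 * Cf) := by fun_prop
        have := h.tendsto 0
        simp only [mul_zero, zero_mul] at this
        exact this.mono_left nhdsWithin_le_nhds
      obtain ⟨r, h1, h2⟩ := ((this.eventually_lt_const hε).and self_mem_nhdsWithin).exists
      exact ⟨r, h2, h1⟩
    set S := W ∩ closedBall x₀ r with hS
    have hSm : MeasurableSet S := hWm.inter measurableSet_closedBall
    have hSA : S ⊆ A := inter_subset_left.trans inter_subset_left
    have hSpos : 0 < σ.real S := by
      have := (Measure.mem_support_iff_forall x₀).1 hx₀ _ (closedBall_mem_nhds x₀ hr0)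
      rw [Measure.restrict_apply measurableSet_closedBall, inter_comm] at this
      exact ENNReal.toReal_pos this.ne' (measure_ne_top _ _)
    set g : Euc n → Euc n := fun x => ∫ y in S, rieszKernel (x - y) ∂σ with hg
    set δ := M * powConst n n * r with hδ
    have hδ0 : 0 ≤ δ := by positivity
    have hgc : Continuous g := continuous_integral_rieszKernel hn (restrict_le_smul hσ S)
    have hg1 : ∀ x, ‖g x‖ ≤ ∫ y in S, ‖x - y‖ ^ (-(n : ℝ)) ∂σ := fun x =>
      norm_integral_le_of_norm_le (integrable_rpow_of_le (restrict_le_smul hσ S) (by positivity)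
        (by linarith) x) (Eventually.of_forall fun y => by rw [norm_rieszKernel_rpow _ hn])
    have hgb : ∀ x, ‖g x‖ ≤ δ := by
      intro x
      refine (hg1 x).trans ?_
      calc _ ≤ ∫ y in closedBall x₀ r, ‖x - y‖ ^ (-(n : ℝ)) ∂σ := by
            refine setIntegral_mono_set (integrable_rpow_of_le hσ (by positivity)
              (by linarith) x).integrableOn (Eventually.of_forall fun y => by positivity)
              (LE.le.eventuallyLE inter_subset_right)
        _ ≤ M * powConst n n * r ^ ((n : ℝ) + 1 - n) :=
            setIntegral_rpow_le_of_le hσ (by positivity) (by linarith) x x₀ hr0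
        _ = δ := by rw [add_sub_cancel_left, Real.rpow_one]
    have hbd : ∀ {u : Euc n → ℝ} {B : Set (Euc n)} (C : ℝ), Measurable u → (∀ x, ‖u x‖ ≤ C) →
        IntegrableOn u B σ := fun C hu hC => (Integrable.of_bound hu.aestronglyMeasurable C
          (Eventually.of_forall hC)).integrableOn
    have mff : Measurable fun x => ‖f x‖ ^ 2 := hfm.norm.pow_const 2
    have mfg : Measurable fun x => ⟪f x, g x⟫ := Measurable.inner (𝕜 := ℝ) hfm hgc.measurable
    have mgg : Measurable fun x => ‖g x‖ ^ 2 := hgc.measurable.norm.pow_const 2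
    have bfg : ∀ x, ‖⟪f x, g x⟫‖ ≤ Cf * δ := fun x =>
      (norm_inner_le_norm _ _).trans (by gcongr; exacts [hfb x, hgb x])
    have iff' : ∀ B, IntegrableOn (fun x => ‖f x‖ ^ 2) B σ := fun B => hbd (Cf ^ 2) mff fun x => by
      rw [norm_pow, norm_norm]; gcongr; exact hfb x
    have ifg : ∀ B, IntegrableOn (fun x => ⟪f x, g x⟫) B σ := fun B => hbd _ mfg bfg
    have igg : ∀ B, IntegrableOn (fun x => ‖g x‖ ^ 2) B σ := fun B => hbd (δ ^ 2) mgg fun x => by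
      rw [norm_pow, norm_norm]; gcongr; exact hgb x
    have hexp : ∀ B, ∫ x in B, ‖f x - g x‖ ^ 2 ∂σ =
        ∫ x in B, ‖f x‖ ^ 2 ∂σ - 2 * ∫ x in B, ⟪f x, g x⟫ ∂σ + ∫ x in B, ‖g x‖ ^ 2 ∂σ := by
      intro B
      simp only [norm_sub_sq_real]
      have i1 : IntegrableOn (fun x => ‖f x‖ ^ 2 - 2 * ⟪f x, g x⟫) B σ :=
        (iff' B).sub ((ifg B).const_mul 2)
      rw [integral_add i1 (igg B),
        integral_sub (iff' B) ((ifg B).const_mul 2), integral_const_mul]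
    have hE : energy σ H (A \ S) = ∫ x in A, ‖f x - g x‖ ^ 2 ∂σ - ∫ x in S, ‖f x - g x‖ ^ 2 ∂σ := by
      unfold energy
      simp only [field_sdiff hn hσ hSm hSA]
      refine setIntegral_sdiff hSm (hbd ((Cf + δ) ^ 2) ((hfm.sub hgc.measurable).norm.pow_const 2)
        fun x => ?_) hSA
      rw [norm_pow, norm_norm]
      gcongr
      exact (norm_sub_le _ _).trans (add_le_add (hfb x) (hgb x))
    -- the cross term is the one that produces the adjoint transform
    have hcross : ∫ x in A, ⟪f x, g x⟫ ∂σ = ∫ y in S, adjField σ H A y ∂σ :=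
      setIntegral_inner_rieszKernel_comm hn hσ hfm hfb A S
    have hSg : 0 ≤ ∫ x in S, ‖g x‖ ^ 2 ∂σ := integral_nonneg fun x => by positivity
    have hSfg : ∫ x in S, ⟪f x, g x⟫ ∂σ ≤ Cf * δ * σ.real S := by
      refine (le_abs_self _).trans ?_
      rw [← Real.norm_eq_abs]
      exact norm_setIntegral_le_of_norm_le_const (measure_lt_top _ _) fun x _ => bfg x
    -- the quadratic term: one factor is bounded by `δ`, the other by the potential of `S`
    have hAg : ∫ x in A, ‖g x‖ ^ 2 ∂σ ≤ δ * (D * σ.real S) := by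
      have hprod := integrable_prod_rpow (s := n) (σ₁ := σ.restrict A) (σ₂ := σ.restrict S)
        (restrict_le_smul hσ A) (by positivity) (by linarith)
      calc _ ≤ ∫ x in A, δ * ∫ y in S, ‖x - y‖ ^ (-(n : ℝ)) ∂σ ∂σ := by
            refine setIntegral_mono (igg A) (hprod.integral_prod_left.const_mul δ) fun x => ?_
            simp only
            rw [sq]
            exact mul_le_mul (hgb x) (hg1 x) (norm_nonneg _) hδ0
        _ = δ * ∫ y in S, ∫ x in A, ‖x - y‖ ^ (-(n : ℝ)) ∂σ ∂σ := by
            rw [integral_const_mul, integral_integral_swap hprod]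
        _ ≤ δ * ∫ y in S, D ∂σ := by
            refine mul_le_mul_of_nonneg_left ?_ hδ0
            refine setIntegral_mono hprod.integral_prod_right (integrable_const _) fun y => ?_
            have h1 := integral_rpow_le_of_le (σ := σ.restrict A) (s := n) (restrict_le_smul hσ A)
              (by positivity) (by linarith) y
            simp only [norm_sub_rev y] at h1
            refine h1.trans ?_
            simp only [hD]
            gcongr
            rw [measureReal_restrict_apply_univ]
            exact measureReal_mono (subset_univ _)
        _ = _ := by rw [setIntegral_const, smul_eq_mul]; ring
    have hVS : (lam + ε) * σ.real S ≤
        ∫ x in S, ‖f x‖ ^ 2 ∂σ + 2 * ∫ y in S, adjField σ H A y ∂σ := by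
      have ia : IntegrableOn (adjField σ H A) S σ := by
        refine hbd (Cf * D) hadj.measurable fun y => ?_
        refine (norm_integral_le_of_norm_le (g := fun x => Cf * ‖y - x‖ ^ (-(n : ℝ)))
          ((integrable_rpow_of_le (restrict_le_smul hσ A) (by positivity) (by linarith)
            y).const_mul Cf) (Eventually.of_forall fun x => ?_)).trans ?_
        · refine (norm_inner_le_norm _ _).trans ?_
          rw [norm_rieszKernel_rpow _ hn, mul_comm, norm_sub_rev]
          gcongr
          exact hfb _
        · rw [integral_const_mul]
          gcongr
          refine (integral_rpow_le_of_le (restrict_le_smul hσ A) (by positivity)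
            (by linarith) y).trans ?_
          simp only [hD]
          gcongr
          rw [measureReal_restrict_apply_univ]
          exact measureReal_mono (subset_univ _)
      rw [← integral_const_mul, ← integral_add (iff' S) (ia.const_mul 2), mul_comm,
        ← smul_eq_mul, ← setIntegral_const]
      refine setIntegral_mono_on (integrable_const _).integrableOn ((iff' S).add (ia.const_mul 2))
        hSm fun x hx => ?_
      exact (hx.1.2 : lam + ε < firstVar σ H A x).le
    have hst := hstable S hSA hSm hSpos
    rw [hE, hexp, hexp, hcross] at hst
    have hEA : energy σ H A = ∫ x in A, ‖f x‖ ^ 2 ∂σ := rfl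
    rw [hEA] at hst
    have : ε * σ.real S ≤ δ * (D + 2 * Cf) * σ.real S := by nlinarith
    have := le_of_mul_le_mul_right this hSpos
    linarith
  have : {x | ¬ firstVar σ H A x ≤ lam} ⊆
      ⋃ k : ℕ, {x | lam + 1 / ((k : ℝ) + 1) < firstVar σ H A x} := by
    intro x hx
    simp only [mem_ofPred_eq, not_le] at hx
    obtain ⟨k, hk⟩ := exists_nat_one_div_lt (sub_pos.2 hx)
    exact mem_iUnion.2 ⟨k, by simp only [mem_ofPred_eq]; linarith⟩
  exact measure_mono_null this (measure_iUnion_null fun k => key _ (by positivity))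

end Variation

/-! ### Subharmonicity of the first variation -/

/-- The properties in the ball `B(x₁,R)` of a field which is generated by masses outside of that
ball: it is harmonic, expressed by the mean value property, and it has no flux through spheres
centred at `x₁`. -/
structure IsExternalField (H : Euc n → Euc n) (x₁ : Euc n) (R : ℝ) : Prop where
  continuousOn : ContinuousOn H (ball x₁ R)
  wmean_eq : ∀ x r, 0 < r → closedBall x r ⊆ ball x₁ R → wmean H x r = wmass n • H x
  wflux_eq : ∀ r, 0 < r → r < R → wflux H x₁ r = 0

lemma wmean_add {F : Type*} [NormedAddCommGroup F] [NormedSpace ℝ F] {u v : Euc n → F}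
    {x : Euc n} {r : ℝ} (hr : 0 ≤ r) (hu : ContinuousOn u (closedBall x r))
    (hv : ContinuousOn v (closedBall x r)) :
    wmean (fun y => u y + v y) x r = wmean u x r + wmean v x r := by
  unfold wmean
  rw [← integral_add (integrable_wmean hr hu) (integrable_wmean hr hv)]
  simp only [smul_add]

lemma wmean_mono {u v : Euc n → ℝ} {x : Euc n} {r : ℝ} (hr : 0 ≤ r)
    (hu : ContinuousOn u (closedBall x r)) (hv : ContinuousOn v (closedBall x r))
    (h : ∀ y ∈ closedBall x r, u y ≤ v y) : wmean u x r ≤ wmean v x r := by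
  refine integral_mono (integrable_wmean hr hu) (integrable_wmean hr hv) fun w => ?_
  by_cases hw : bump 3 w = 0
  · simp [hw]
  · exact mul_le_mul_of_nonneg_left (h _ (add_smul_mem_closedBall hr
      (norm_lt_one_of_bump_ne_zero (by norm_num) hw).le)) (bump_nonneg _ _)

lemma wmean_const (c : ℝ) (x : Euc n) (r : ℝ) : wmean (fun _ => c) x r = wmass n * c := by
  simp [wmean, wmass, integral_mul_const]

lemma wmean_const_mul (c : ℝ) (u : Euc n → ℝ) (x : Euc n) (r : ℝ) :
    wmean (fun y => c * u y) x r = c * wmean u x r := by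
  unfold wmean
  rw [← integral_const_mul]
  congr 1; ext w; simp only [smul_eq_mul]; ring

/-- The positive part of the first variation above the level `lam`. -/
def excess (σ : Measure (Euc n)) (H : Euc n → Euc n) (A : Set (Euc n)) (lam : ℝ) (x : Euc n) : ℝ :=
  max (firstVar σ H A x - lam) 0

lemma excess_nonneg (σ : Measure (Euc n)) (H : Euc n → Euc n) (A : Set (Euc n)) (lam : ℝ)
    (x : Euc n) : 0 ≤ excess σ H A lam x :=
  le_max_right _ _

section

variable {σ : Measure (Euc n)} {M : ℝ≥0} [IsFiniteMeasure σ] {H : Euc n → Euc n} {CH : ℝ}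
  {x₁ : Euc n} {R : ℝ}

lemma continuousOn_field (hn : 1 ≤ n) (hσ : σ ≤ M • volume) (hE : IsExternalField H x₁ R)
    (A : Set (Euc n)) : ContinuousOn (field σ H A) (ball x₁ R) :=
  hE.continuousOn.add
    (continuous_integral_rieszKernel hn (restrict_le_smul hσ A)).continuousOn

lemma ae_notMem_closedBall {ν : Measure (Euc n)} {s : Set (Euc n)}
    (h : s ⊆ ν.supportᶜ) : ∀ᵐ y ∂ν, y ∉ s := by
  have : ν.support ∈ ae ν := Measure.support_mem_ae
  filter_upwards [this] with y hy hys using h hys hy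

lemma wmean_field (hn : 1 ≤ n) (hσ : σ ≤ M • volume) (hE : IsExternalField H x₁ R)
    (A : Set (Euc n)) {x : Euc n} {r : ℝ} (hr : 0 < r)
    (hsub : closedBall x r ⊆ ball x₁ R \ (σ.restrict A).support) :
    wmean (field σ H A) x r = wmass n • field σ H A x := by
  have hσA := restrict_le_smul hσ A
  have hb : closedBall x r ⊆ ball x₁ R := fun y hy => (hsub hy).1
  unfold field
  rw [wmean_add hr.le (hE.continuousOn.mono hb)
    (continuous_integral_rieszKernel hn hσA).continuousOn, hE.wmean_eq x r hr hb, smul_add]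
  congr 1
  rw [wmean_integral, ← integral_smul]
  · refine integral_congr_ae ?_
    filter_upwards [ae_notMem_closedBall fun y hy => (hsub hy).2] with y hy
    refine wmean_rieszKernel hr.le ?_
    rw [mem_closedBall, dist_comm, not_le] at hy
    exact hy
  · exact integrable_prod_of_weaklySingular (Q := fun x y => rieszKernel (x - y)) (s := n) (C := 1)
      (measurable_rieszKernel.comp (measurable_fst.sub measurable_snd)).stronglyMeasurable
      hr zero_le_one
      (by positivity) (by linarith) fun x y => norm_rieszKernel_sub_le_rpow hn x y

lemma wmean_adjField (hn : 1 ≤ n) (hσ : σ ≤ M • volume) (hH : Measurable H)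
    (hHb : ∀ x, ‖H x‖ ≤ CH) (A : Set (Euc n)) {x : Euc n} {r : ℝ} (hr : 0 < r)
    (hsub : closedBall x r ⊆ (σ.restrict A).supportᶜ) :
    wmean (adjField σ H A) x r = wmass n • adjField σ H A x := by
  have hfm := measurable_field hn hσ hH A
  have hfb := norm_field_le hn hσ hHb A
  set Q : Euc n → Euc n → ℝ := fun z y => ⟪rieszKernel (y - z), field σ H A y⟫ with hQ
  have hQm : StronglyMeasurable (Function.uncurry Q) := by
    refine Measurable.stronglyMeasurable ?_
    exact Measurable.inner (𝕜 := ℝ)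
      (measurable_rieszKernel.comp (measurable_snd.sub measurable_fst)) (hfm.comp measurable_snd)
  have hQb : ∀ z y, ‖Q z y‖ ≤ (CH + (M * powConst n n + σ.real univ)) * ‖z - y‖ ^ (-(n : ℝ)) := by
    intro z y
    refine (norm_inner_le_norm _ _).trans ?_
    rw [norm_rieszKernel_rpow _ hn, mul_comm, norm_sub_rev]
    gcongr
    exact hfb _
  have hint := integrable_prod_of_weaklySingular (ν := σ.restrict A) (x := x) hQm hr
    ((norm_nonneg _).trans (hfb 0)) (by positivity) (by linarith) hQb
  have h1 : wmean (adjField σ H A) x r = ∫ y in A, wmean (fun z => Q z y) x r ∂σ :=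
    wmean_integral hint
  rw [h1, show adjField σ H A x = ∫ y in A, Q x y ∂σ from rfl, smul_eq_mul, ← integral_const_mul]
  refine integral_congr_ae ?_
  filter_upwards [ae_notMem_closedBall hsub] with y hy
  have hy' : r < dist x y := by
    rw [mem_closedBall, dist_comm, not_le] at hy
    exact hy
  have e : ∀ z, Q z y = ⟪-field σ H A y, rieszKernel (z - y)⟫ := fun z => by
    change ⟪rieszKernel (y - z), field σ H A y⟫ = _
    rw [← neg_sub z y, rieszKernel_neg, inner_neg_left, inner_neg_left, real_inner_comm]
  have hi : Integrable (fun w => bump 3 w • rieszKernel (x + r • w - y)) :=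
    integrable_wmean (u := fun z => rieszKernel (z - y)) hr.le (continuousOn_rieszKernel_sub y hy)
  simp only [e]
  rw [wmean_inner (u := fun z => rieszKernel (z - y)) hi, wmean_rieszKernel hr.le hy',
    inner_smul_right]

lemma continuousOn_firstVar (hn : 1 ≤ n) (hσ : σ ≤ M • volume) (hH : Measurable H)
    (hHb : ∀ x, ‖H x‖ ≤ CH) (hE : IsExternalField H x₁ R) (A : Set (Euc n)) :
    ContinuousOn (firstVar σ H A) (ball x₁ R) :=
  ((continuousOn_field hn hσ hE A).norm.pow 2).add
    ((continuous_adjField hn hσ hH hHb A).continuousOn.const_smul (2 : ℝ))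

lemma contDiffOn_firstVar (hn : 1 ≤ n) (hσ : σ ≤ M • volume) (hH : Measurable H)
    (hHb : ∀ x, ‖H x‖ ≤ CH) (hE : IsExternalField H x₁ R) (A : Set (Euc n)) :
    ContDiffOn ℝ 2 (firstVar σ H A) (ball x₁ R \ (σ.restrict A).support) := by
  have hO : IsOpen (ball x₁ R \ (σ.restrict A).support) :=
    isOpen_ball.sdiff Measure.isClosed_support
  have h1 := contDiffOn_of_wmean_eq hO ((continuousOn_field hn hσ hE A).mono sdiff_subset)
    fun x r hr h => wmean_field hn hσ hE A hr h
  have h2 := contDiffOn_of_wmean_eq hO (continuous_adjField hn hσ hH hHb A).continuousOn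
    fun x r hr h => wmean_adjField hn hσ hH hHb A hr (h.trans fun y hy => hy.2)
  exact (h1.norm_sq ℝ).add (contDiffOn_const.mul h2)

/-- The first variation is subharmonic off the support of the measure. -/
lemma wmass_mul_firstVar_le (hn : 1 ≤ n) (hσ : σ ≤ M • volume) (hH : Measurable H)
    (hHb : ∀ x, ‖H x‖ ≤ CH) (hE : IsExternalField H x₁ R) (A : Set (Euc n)) {x : Euc n} {r : ℝ}
    (hr : 0 < r) (hsub : closedBall x r ⊆ ball x₁ R \ (σ.restrict A).support) :
    wmass n * firstVar σ H A x ≤ wmean (firstVar σ H A) x r := by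
  have hb : closedBall x r ⊆ ball x₁ R := fun y hy => (hsub hy).1
  have hfc : ContinuousOn (field σ H A) (closedBall x r) :=
    (continuousOn_field hn hσ hE A).mono hb
  have hac : ContinuousOn (fun y => 2 * adjField σ H A y) (closedBall x r) :=
    ((continuous_adjField hn hσ hH hHb A).const_smul (2 : ℝ)).continuousOn
  have e : wmean (firstVar σ H A) x r =
      wmean (fun y => ‖field σ H A y‖ ^ 2) x r + 2 * (wmass n * adjField σ H A x) := by
    rw [show firstVar σ H A = fun y => ‖field σ H A y‖ ^ 2 + 2 * adjField σ H A y from rfl,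
      wmean_add (u := fun y => ‖field σ H A y‖ ^ 2) hr.le (hfc.norm.pow 2) hac, wmean_const_mul,
      wmean_adjField hn hσ hH hHb A hr (hsub.trans fun y hy => hy.2), smul_eq_mul]
  have h2 : wmass n * ‖field σ H A x‖ ^ 2 ≤ wmean (fun y => ‖field σ H A y‖ ^ 2) x r := by
    have hic : ContinuousOn (fun y => 2 * ⟪field σ H A x, field σ H A y⟫) (closedBall x r) :=
      (ContinuousOn.inner (𝕜 := ℝ) continuousOn_const hfc).const_smul (2 : ℝ)
    -- `|G(y)|² ≥ 2⟨G(x), G(y)⟩ - |G(x)|²`, where the right side is harmonic in `y`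
    have h3 : wmean (fun y => 2 * ⟪field σ H A x, field σ H A y⟫ + -‖field σ H A x‖ ^ 2) x r ≤
        wmean (fun y => ‖field σ H A y‖ ^ 2) x r := by
      refine wmean_mono hr.le (hic.add continuousOn_const) (hfc.norm.pow 2) fun y _ => ?_
      have := norm_sub_sq_real (field σ H A x) (field σ H A y)
      nlinarith [sq_nonneg ‖field σ H A x - field σ H A y‖]
    rw [wmean_add hr.le hic continuousOn_const, wmean_const, wmean_const_mul,
      wmean_inner (integrable_wmean hr.le hfc), wmean_field hn hσ hE A hr hsub,
      inner_smul_right, real_inner_self_eq_norm_sq] at h3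
    linarith
  rw [e, firstVar]
  linarith

/-- By continuity the almost everywhere bound holds at every point of the support. -/
lemma firstVar_le_of_mem_support (hn : 1 ≤ n) (hσ : σ ≤ M • volume) (hH : Measurable H)
    (hHb : ∀ x, ‖H x‖ ≤ CH) (hE : IsExternalField H x₁ R) {A : Set (Euc n)} {lam : ℝ}
    (hV : ∀ᵐ x ∂σ.restrict A, firstVar σ H A x ≤ lam) {x : Euc n} (hx : x ∈ ball x₁ R)
    (hxs : x ∈ (σ.restrict A).support) : firstVar σ H A x ≤ lam := by
  by_contra! hlt
  have h1 := ((continuousOn_firstVar hn hσ hH hHb hE A).continuousAt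
    (isOpen_ball.mem_nhds hx)).eventually_const_lt hlt
  have h2 := (Measure.mem_support_iff_forall x).1 hxs _ h1
  refine h2.ne' (measure_mono_null (fun y hy => ?_) hV)
  exact not_le.2 (show lam < firstVar σ H A y from hy)

lemma continuousOn_excess (hn : 1 ≤ n) (hσ : σ ≤ M • volume) (hH : Measurable H)
    (hHb : ∀ x, ‖H x‖ ≤ CH) (hE : IsExternalField H x₁ R) (A : Set (Euc n)) (lam : ℝ) :
    ContinuousOn (excess σ H A lam) (ball x₁ R) :=
  ((continuousOn_firstVar hn hσ hH hHb hE A).sub continuousOn_const).sup continuousOn_const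

/-- The cube of the excess is subharmonic in the whole ball. The cube makes it a function of class
`C²`, also across the support of the measure, where the excess vanishes. -/
lemma wmass_mul_excess_le (hn : 1 ≤ n) (hσ : σ ≤ M • volume) (hH : Measurable H)
    (hHb : ∀ x, ‖H x‖ ≤ CH) (hE : IsExternalField H x₁ R) {A : Set (Euc n)} {lam lam' : ℝ}
    (hV : ∀ᵐ x ∂σ.restrict A, firstVar σ H A x ≤ lam) (hlam : lam < lam') {x : Euc n} {r : ℝ}
    (hr : 0 ≤ r) (hsub : closedBall x r ⊆ ball x₁ R) :
    wmass n * excess σ H A lam' x ^ 3 ≤ wmean (fun y => excess σ H A lam' y ^ 3) x r := by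
  set V := firstVar σ H A with hVdef
  have hVc := continuousOn_firstVar hn hσ hH hHb hE A
  have hO : IsOpen (ball x₁ R \ (σ.restrict A).support) :=
    isOpen_ball.sdiff Measure.isClosed_support
  have hmem : ∀ y ∈ ball x₁ R, lam < V y → y ∈ ball x₁ R \ (σ.restrict A).support :=
    fun y hy h => ⟨hy, fun hs => absurd
      (firstVar_le_of_mem_support hn hσ hH hHb hE hV hy hs) (not_le.2 h)⟩
  refine le_wmean_of_local (u := fun y => excess σ H A lam' y ^ 3) isOpen_ball ?_ ?_ hr hsub
  -- where `V < lam'` the cube vanishes, and elsewhere `V` is of class `C²` since `lam < lam'`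
  · intro y hy
    rcases lt_or_ge (V y) lam' with h | h
    · have : (fun y => excess σ H A lam' y ^ 3) =ᶠ[𝓝 y] fun _ => 0 := by
        filter_upwards [(hVc.continuousAt (isOpen_ball.mem_nhds hy)).eventually_lt_const h]
          with z hz
        rw [excess, max_eq_right (by linarith)]; simp
      exact (contDiffAt_const.congr_of_eventuallyEq this).contDiffWithinAt
    · have hm := hmem y hy (hlam.trans_le h)
      have h1 : ContDiffAt ℝ 2 V y := (contDiffOn_firstVar hn hσ hH hHb hE A).contDiffAt
        (hO.mem_nhds hm)
      exact ((contDiff_posPart_pow 2 2 le_rfl).contDiffAt.comp y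
        (h1.sub contDiffAt_const)).contDiffWithinAt
  · intro y hy
    refine Eventually.frequently ?_
    rcases le_or_gt (V y) lam' with h | h
    · filter_upwards [self_mem_nhdsWithin] with s hs
      rw [excess, max_eq_right (by linarith)]
      simp only [ne_eq, OfNat.ofNat_ne_zero, not_false_eq_true, zero_pow, mul_zero]
      exact integral_nonneg fun w => smul_nonneg (bump_nonneg _ _)
        (pow_nonneg (excess_nonneg _ _ _ _ _) _)
    · have hm := hmem y hy (hlam.trans h)
      obtain ⟨ε, hε, hball⟩ := Metric.nhds_basis_closedBall.mem_iff.1 (hO.mem_nhds hm)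
      filter_upwards [Ioc_mem_nhdsGT hε] with s hs
      have hsb := (closedBall_subset_closedBall hs.2).trans hball
      have hsb' : closedBall y s ⊆ ball x₁ R := fun z hz => (hsb hz).1
      have hsub := wmass_mul_firstVar_le hn hσ hH hHb hE A hs.1 hsb
      set a := V y - lam' with ha
      have ha0 : 0 < a := sub_pos.2 h
      have hexa : excess σ H A lam' y = a := max_eq_left ha0.le
      have hc1 : ContinuousOn (fun z => 3 * a ^ 2 * V z) (closedBall y s) :=
        (hVc.mono hsb').const_smul (3 * a ^ 2)
      -- the convex function `max t 0 ^ 3` lies above its tangent `3 a² t - 2 a³` at `a`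
      have h3 : wmean (fun z => 3 * a ^ 2 * V z + (a ^ 3 - 3 * a ^ 2 * V y)) y s ≤
          wmean (fun z => excess σ H A lam' z ^ 3) y s := by
        refine wmean_mono hs.1.le (hc1.add continuousOn_const)
          (((continuousOn_excess hn hσ hH hHb hE A lam').mono hsb').pow 3) fun z _ => ?_
        have e : 3 * a ^ 2 * V z + (a ^ 3 - 3 * a ^ 2 * V y) =
            3 * a ^ 2 * (V z - lam') - 2 * a ^ 3 := by rw [ha]; ring
        rw [e]
        set t := V z - lam'
        change _ ≤ max t 0 ^ 3
        have h4 : t ≤ max t 0 := le_max_left _ _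
        have h5 : 0 ≤ max t 0 := le_max_right _ _
        nlinarith [mul_nonneg (add_nonneg h5 (mul_pos two_pos ha0).le) (sq_nonneg (max t 0 - a)),
          mul_le_mul_of_nonneg_left h4 (sq_nonneg a)]
      rw [wmean_add hs.1.le hc1 continuousOn_const, wmean_const, wmean_const_mul] at h3
      rw [hexa]
      nlinarith [mul_le_mul_of_nonneg_left hsub (by positivity : 0 ≤ 3 * a ^ 2)]

end

/-! ### Supremum bounds for functions with subharmonic powers -/

lemma setIntegral_comp_add_smul (q : Euc n → ℝ) (x : Euc n) {d : ℝ} (hd : 0 < d) :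
    ∫ w in closedBall 0 1, q (x + d • w) = (d ^ (n + 1))⁻¹ * ∫ y in closedBall x d, q y := by
  have h := Measure.setIntegral_comp_smul_of_pos (volume : Measure (Euc n))
    (fun z : Euc n => q (x + z)) (closedBall 0 1) hd
  rw [smul_unitClosedBall_of_nonneg hd.le] at h
  simp only [finrank_euclideanSpace, Fintype.card_fin, smul_eq_mul] at h
  rw [h]
  congr 1
  rw [← integral_indicator measurableSet_closedBall, ← integral_indicator measurableSet_closedBall,
    ← integral_add_left_eq_self (fun y => (closedBall x d).indicator q y) x]
  congr 1; ext z
  simp [indicator]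

/-- Let `q⁶` have the sub-mean value property. Then `q` is bounded by its own means. The point
is that the means of `q` itself, rather than of `q⁶`, are used. -/
lemma le_setIntegral_of_submean_pow {q : Euc n → ℝ} {x₁ : Euc n} {R : ℝ} (hR : 0 < R)
    (hq : ContinuousOn q (closedBall x₁ R)) (hq0 : ∀ x, 0 ≤ q x)
    (hsub : ∀ x r, 0 < r → closedBall x r ⊆ closedBall x₁ R →
      wmass n * q x ^ 6 ≤ wmean (fun y => q y ^ 6) x r) {x : Euc n}
    (hx : x ∈ closedBall x₁ (R / 2)) :
    q x ≤ 2 ^ (7 * (n + 1)) / (wmass n * R ^ (n + 1)) * ∫ y in closedBall x₁ R, q y := by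
  set I := ∫ y in closedBall x₁ R, q y with hI
  have hI0 : 0 ≤ I := integral_nonneg hq0
  have hc0 := wmass_pos n
  -- at a maximum point `x'` of this weighted function, `q ≤ 2^{n+1} q(x')` in the ball whose
  -- radius is half the distance to the boundary; there `q⁶` is at most `(2^{n+1} q(x'))⁵ q`
  obtain ⟨x', hx', hmax⟩ := (isCompact_closedBall x₁ R).exists_isMaxOn
    (f := fun x => (R - dist x x₁) ^ (n + 1) * q x) ⟨x₁, mem_closedBall_self hR.le⟩
    ((by fun_prop : Continuous fun x => (R - dist x x₁) ^ (n + 1)).continuousOn.mul hq)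
  have hxR : x ∈ closedBall x₁ R := closedBall_subset_closedBall (by linarith) hx
  have hbound : (R - dist x' x₁) ^ (n + 1) * q x' ≤ 2 ^ (6 * (n + 1)) / wmass n * I := by
    rw [mem_closedBall] at hx'
    rcases (sub_nonneg.2 hx').eq_or_lt with h0 | hpos
    · rw [← h0]; simp; positivity
    rcases (hq0 x').eq_or_lt with hq0' | hqpos
    · rw [← hq0', mul_zero]; positivity
    obtain ⟨d, hd⟩ : ∃ d, R - dist x' x₁ = 2 * d := ⟨(R - dist x' x₁) / 2, by ring⟩
    have hd0 : 0 < d := by linarith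
    have hdsub : closedBall x' d ⊆ closedBall x₁ R := closedBall_subset_closedBall' (by linarith)
    have hle : ∀ y ∈ closedBall x' d, q y ≤ 2 ^ (n + 1) * q x' := by
      intro y hy
      have h1 := hmax (hdsub hy)
      simp only [mem_ofPred_eq, hd] at h1
      have h2 : d ≤ R - dist y x₁ := by
        rw [mem_closedBall] at hy
        have := dist_triangle y x' x₁
        linarith
      have h3 : d ^ (n + 1) * q y ≤ d ^ (n + 1) * (2 ^ (n + 1) * q x') := by
        calc _ ≤ (R - dist y x₁) ^ (n + 1) * q y := by gcongr; exact hq0 y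
          _ ≤ _ := h1
          _ = _ := by rw [mul_pow]; ring
      exact le_of_mul_le_mul_left h3 (by positivity)
    have h1 := hsub x' d hd0 hdsub
    have hqd : ContinuousOn q (closedBall x' d) := hq.mono hdsub
    have h2 : wmean (fun y => q y ^ 6) x' d ≤
        (2 ^ (n + 1) * q x') ^ 5 * ∫ w in closedBall 0 1, q (x' + d • w) := by
      rw [← integral_const_mul, ← integral_indicator measurableSet_closedBall]
      refine integral_mono (integrable_wmean hd0.le (hqd.pow 6)) ?_ fun w => ?_
      · refine IntegrableOn.integrable_indicator ?_ measurableSet_closedBall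
        exact ((continuousOn_comp_add_smul hd0.le hqd).integrableOn_compact
          (isCompact_closedBall _ _)).const_mul _
      · by_cases hw : bump 3 w = 0
        · simp only [hw, zero_smul]
          exact indicator_nonneg (fun w _ => mul_nonneg
            (pow_nonneg (mul_nonneg (by positivity) (hq0 _)) _) (hq0 _)) w
        · have hw1 := (norm_lt_one_of_bump_ne_zero (by norm_num) hw).le
          simp only
          rw [indicator_of_mem (by simpa using hw1), smul_eq_mul]
          have h3 := hle _ (add_smul_mem_closedBall hd0.le hw1)
          have h4 := hq0 (x' + d • w)
          calc _ ≤ 1 * q (x' + d • w) ^ 6 := by gcongr; exact bump_le_one _ _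
            _ = q (x' + d • w) ^ 5 * q (x' + d • w) := by ring
            _ ≤ _ := by gcongr
    have h3 : ∫ w in closedBall 0 1, q (x' + d • w) ≤ (d ^ (n + 1))⁻¹ * I := by
      rw [setIntegral_comp_add_smul q x' hd0]
      gcongr
      exact setIntegral_mono_set (hq.integrableOn_compact (isCompact_closedBall _ _))
        (Eventually.of_forall hq0) (LE.le.eventuallyLE hdsub)
    have h4 : wmass n * q x' ^ 6 ≤ (2 ^ (n + 1) * q x') ^ 5 * ((d ^ (n + 1))⁻¹ * I) :=
      h1.trans (h2.trans (by gcongr))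
    have h5 : q x' ^ 5 * (wmass n * q x') ≤
        q x' ^ 5 * ((2 ^ (n + 1)) ^ 5 * ((d ^ (n + 1))⁻¹ * I)) := by
      calc _ = wmass n * q x' ^ 6 := by ring
        _ ≤ _ := h4
        _ = _ := by ring
    have h6 := le_of_mul_le_mul_left h5 (by positivity)
    rw [hd]
    calc (2 * d) ^ (n + 1) * q x' = (2 * d) ^ (n + 1) / wmass n * (wmass n * q x') := by
          field_simp
      _ ≤ (2 * d) ^ (n + 1) / wmass n * ((2 ^ (n + 1)) ^ 5 * ((d ^ (n + 1))⁻¹ * I)) := by gcongr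
      _ = 2 ^ (6 * (n + 1)) / wmass n * I := by
          rw [mul_pow]
          field_simp
          ring
  have h7 := (hmax hxR).trans hbound
  simp only at h7
  rw [mem_closedBall] at hx
  have h8 : (R / 2) ^ (n + 1) * q x ≤ 2 ^ (6 * (n + 1)) / wmass n * I := by
    refine le_trans ?_ h7
    have := hq0 x
    gcongr
    linarith
  calc q x = (2 / R) ^ (n + 1) * ((R / 2) ^ (n + 1) * q x) := by
        rw [← mul_assoc, ← mul_pow]; field_simp; simp
    _ ≤ (2 / R) ^ (n + 1) * (2 ^ (6 * (n + 1)) / wmass n * I) := by gcongr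
    _ = _ := by
        rw [div_pow]
        field_simp
        ring_nf

/-! ### The maximum principle and decay across good balls -/

/-- Strict subharmonicity of the squared distance to a point. -/
lemma wmass_mul_norm_sub_sq_lt (x x₁ : Euc n) {t : ℝ} (ht : 0 < t) :
    wmass n * ‖x - x₁‖ ^ 2 < wmean (fun y => ‖y - x₁‖ ^ 2) x t := by
  set v := x - x₁ with hv
  have i1 : Integrable (fun w : Euc n => bump 3 w * ‖v‖ ^ 2) :=
    (integrable_bump (by norm_num)).mul_const _
  have i2 : Integrable (fun w : Euc n => bump 3 w * ⟪v, w⟫) :=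
    integrable_bump_smul (by norm_num) (by fun_prop)
  have i3 : Integrable (fun w : Euc n => bump 3 w * ‖w‖ ^ 2) :=
    integrable_bump_smul (by norm_num) (by fun_prop)
  have e : ∀ w : Euc n, bump 3 w • ‖x + t • w - x₁‖ ^ 2 =
      bump 3 w * ‖v‖ ^ 2 + 2 * t * (bump 3 w * ⟪v, w⟫) + t ^ 2 * (bump 3 w * ‖w‖ ^ 2) := by
    intro w
    have : x + t • w - x₁ = v + t • w := by rw [hv]; abel
    rw [this, norm_add_sq_real, inner_smul_right, norm_smul, mul_pow, Real.norm_eq_abs, sq_abs,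
      smul_eq_mul]
    ring
  have h0 : ∫ w : Euc n, bump 3 w * ⟪v, w⟫ = 0 := by
    have := integral_neg_eq_self (fun w : Euc n => bump 3 w * ⟪v, w⟫) volume
    simp only [bump_neg, inner_neg_right, mul_neg, integral_neg] at this
    linarith
  have hpos : 0 < ∫ w : Euc n, bump 3 w * ‖w‖ ^ 2 := by
    rw [integral_pos_iff_support_of_nonneg (fun w => mul_nonneg (bump_nonneg _ _) (sq_nonneg _)) i3]
    have : ball (0 : Euc n) 1 \ {0} ⊆ Function.support fun w : Euc n => bump 3 w * ‖w‖ ^ 2 := by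
      rintro w ⟨hw, hw0⟩
      have h1 : ‖w‖ < 1 := by simpa using hw
      have h2 : 0 < ‖w‖ := norm_pos_iff.2 hw0
      exact (mul_pos (bump_pos 3 h1) (by positivity)).ne'
    refine lt_of_lt_of_le ?_ (measure_mono this)
    rw [measure_sdiff_null (measure_singleton _)]
    exact measure_ball_pos _ _ one_pos
  unfold wmean
  simp only [e]
  have i12 : Integrable (fun w : Euc n => bump 3 w * ‖v‖ ^ 2 + 2 * t * (bump 3 w * ⟪v, w⟫)) :=
    i1.add (i2.const_mul _)
  rw [integral_add i12 (i3.const_mul _), integral_add i1 (i2.const_mul _),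
    integral_const_mul, integral_const_mul, h0, integral_mul_const]
  unfold wmass
  have := mul_pos (pow_pos ht 2) hpos
  linarith

/-- Maximum principle on the ball `B(x₁,R)` minus the set `Z`. -/
lemma le_of_submean {g : Euc n → ℝ} {x₁ : Euc n} {R S : ℝ} {Z : Set (Euc n)}
    (hg : ContinuousOn g (closedBall x₁ R))
    (hbd : ∀ x ∈ closedBall x₁ R, x ∈ Z ∨ dist x x₁ = R → g x ≤ S)
    (hsub : ∀ x ∈ ball x₁ R, x ∉ Z →
      ∃ t, 0 < t ∧ closedBall x t ⊆ closedBall x₁ R ∧ wmass n * g x ≤ wmean g x t) :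
    ∀ x ∈ closedBall x₁ R, g x ≤ S := by
  intro x₀ hx₀
  by_contra! hlt
  -- a small multiple of `|x - x₁|²` makes the sub-mean value inequality strict
  obtain ⟨ε, hε, hεS⟩ : ∃ ε : ℝ, 0 < ε ∧ S + ε * R ^ 2 < g x₀ := by
    refine ⟨(g x₀ - S) / (2 * (R ^ 2 + 1)), div_pos (by linarith) (by positivity), ?_⟩
    have : (g x₀ - S) / (2 * (R ^ 2 + 1)) * R ^ 2 < g x₀ - S := by
      rw [div_mul_eq_mul_div, div_lt_iff₀ (by positivity)]
      nlinarith [sq_nonneg R]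
    linarith
  set gε : Euc n → ℝ := fun x => g x + ε * ‖x - x₁‖ ^ 2 with hgε
  have hcn : Continuous fun x : Euc n => ε * ‖x - x₁‖ ^ 2 := by fun_prop
  have hgc : ContinuousOn gε (closedBall x₁ R) := hg.add hcn.continuousOn
  obtain ⟨x', hx', hmax⟩ := (isCompact_closedBall x₁ R).exists_isMaxOn ⟨x₀, hx₀⟩ hgc
  have hgx' : S + ε * R ^ 2 < gε x' := by
    refine lt_of_lt_of_le ?_ (hmax hx₀)
    simp only [hgε]
    have : 0 ≤ ε * ‖x₀ - x₁‖ ^ 2 := by positivity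
    linarith
  have hns : ‖x' - x₁‖ ≤ R := by rwa [mem_closedBall, dist_eq_norm] at hx'
  have hnot : ¬ (x' ∈ Z ∨ dist x' x₁ = R) := by
    intro h
    have h1 := hbd x' hx' h
    have h2 : ε * ‖x' - x₁‖ ^ 2 ≤ ε * R ^ 2 := by gcongr
    simp only [hgε] at hgx'
    linarith
  push Not at hnot
  obtain ⟨t, ht, htR, hsubt⟩ := hsub x' (lt_of_le_of_ne hx' hnot.2) hnot.1
  have h1 : wmean gε x' t ≤ wmass n * gε x' := by
    rw [← wmean_const (gε x') x' t]
    exact wmean_mono ht.le (hgc.mono htR) continuousOn_const fun y hy => hmax (htR hy)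
  rw [hgε, wmean_add ht.le (hg.mono htR) hcn.continuousOn, wmean_const_mul] at h1
  have h2 := mul_lt_mul_of_pos_left (wmass_mul_norm_sub_sq_lt x' x₁ ht) hε
  simp only at h1
  linarith

/-- The maximal density is lower semicontinuous. -/
lemma measurable_maximalDensity (μ : Measure (Euc n)) : Measurable (maximalDensity μ) := by
  refine LowerSemicontinuous.measurable fun x a ha => ?_
  simp only [maximalDensity, lt_iSup_iff] at ha
  obtain ⟨r, hr, ha⟩ := ha
  have hr0 : ENNReal.ofReal r ^ n ≠ 0 := by
    exact pow_ne_zero _ (by simpa using hr)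
  have hrt : ENNReal.ofReal r ^ n ≠ ⊤ := ENNReal.pow_ne_top ENNReal.ofReal_ne_top
  rw [ballDensity, ENNReal.lt_div_iff_mul_lt (Or.inl hr0) (Or.inl hrt)] at ha
  have hat : a ≠ ⊤ := by
    rintro rfl
    rw [ENNReal.top_mul hr0] at ha
    exact not_top_lt ha
  have hc : Continuous fun s : ℝ => a * ENNReal.ofReal s ^ n :=
    (ENNReal.continuous_const_mul hat).comp ((ENNReal.continuous_pow n).comp
      ENNReal.continuous_ofReal)
  have hev : ∀ᶠ s in 𝓝[>] r, a * ENNReal.ofReal s ^ n < μ (closedBall x r) :=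
    ((hc.tendsto r).eventually_lt_const ha).filter_mono nhdsWithin_le_nhds
  obtain ⟨s, hs, hrs⟩ := (hev.and self_mem_nhdsWithin).exists
  have hrs : r < s := hrs
  filter_upwards [ball_mem_nhds x (sub_pos.2 hrs)] with z hz
  simp only [maximalDensity, lt_iSup_iff]
  refine ⟨s, hr.trans hrs, ?_⟩
  have hs0 : ENNReal.ofReal s ^ n ≠ 0 := pow_ne_zero _ (by simpa using hr.trans hrs)
  rw [ballDensity, ENNReal.lt_div_iff_mul_lt (Or.inl hs0)
    (Or.inl (ENNReal.pow_ne_top ENNReal.ofReal_ne_top))]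
  refine hs.trans_le (measure_mono (closedBall_subset_closedBall' ?_))
  rw [mem_ball, dist_comm] at hz
  linarith

/-- The geometric constant in the estimate of `powKernel`-potentials by the maximal density. -/
def potConst (n : ℕ) : ℝ := 2 ^ (n : ℝ) * (1 - (1 / 2) ^ (1 / 2 : ℝ))⁻¹

lemma half_rpow_half_lt_one : ((1 : ℝ) / 2) ^ (1 / 2 : ℝ) < 1 :=
  Real.rpow_lt_one (by norm_num) (by norm_num) (by norm_num)

lemma potConst_pos (n : ℕ) : 0 < potConst n := by
  have := half_rpow_half_lt_one
  exact mul_pos (by positivity) (inv_pos.2 (by linarith))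

/-- The power potential of the part of `σ` in a ball is controlled by the maximal density, by
a decomposition into dyadic shells. -/
lemma setLIntegral_powKernel_le {σ : Measure (Euc n)} (hn : 1 ≤ n) {x₁ x : Euc n} {r a : ℝ}
    (hr : 0 < r) (ha : 0 ≤ a) (hx : x ∈ closedBall x₁ r)
    (hM : maximalDensity (σ.restrict (closedBall x₁ r)) x ≤ ENNReal.ofReal a) :
    ∫⁻ y in closedBall x₁ r, ENNReal.ofReal (powKernel (x - y)) ∂σ ≤
      ENNReal.ofReal (potConst n * a * r ^ (1 / 2 : ℝ)) := by
  set s : ℝ := n - 1 / 2 with hs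
  have hn' : (1 : ℝ) ≤ n := by exact_mod_cast hn
  have hs0 : 0 < s := by linarith
  set τ := σ.restrict (closedBall x₁ r) with hτ
  set ρ : ℕ → ℝ := fun k => 2 * r * (1 / 2) ^ k with hρ
  have hρ0 : ∀ k, 0 < ρ k := fun k => by positivity
  have hpt : ∀ y ∈ closedBall x₁ r, ENNReal.ofReal (powKernel (x - y)) ≤
      ∑' k, (closedBall x (ρ k)).indicator (fun _ => ENNReal.ofReal (ρ (k + 1) ^ (-s))) y := by
    intro y hy
    rcases eq_or_ne x y with rfl | hxy
    · rw [sub_self, powKernel, norm_zero, Real.zero_rpow (by linarith)]; simp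
    · have hpos : 0 < ‖x - y‖ := norm_pos_iff.2 (sub_ne_zero.2 hxy)
      have hle : ‖x - y‖ / (2 * r) ≤ 1 := by
        rw [div_le_one (by positivity), ← dist_eq_norm]
        rw [mem_closedBall] at hx hy
        have := dist_triangle_right x y x₁
        linarith
      obtain ⟨k, hk1, hk2⟩ := exists_nat_pow_near_of_lt_one (by positivity) hle
        (by norm_num : (0 : ℝ) < 1 / 2) (by norm_num)
      rw [lt_div_iff₀ (by positivity)] at hk1
      rw [div_le_iff₀ (by positivity)] at hk2
      refine le_trans ?_ (ENNReal.le_tsum k)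
      rw [indicator_of_mem]
      · refine ENNReal.ofReal_le_ofReal (Real.rpow_le_rpow_of_nonpos (hρ0 _) ?_ (by linarith))
        simp only [hρ]
        linarith
      · rw [mem_closedBall, dist_comm, dist_eq_norm]
        simp only [hρ]
        linarith
  have hball : ∀ k, τ (closedBall x (ρ k)) ≤ ENNReal.ofReal (a * ρ k ^ n) := by
    intro k
    have h1 : ballDensity τ x (ρ k) ≤ ENNReal.ofReal a :=
      le_trans (le_iSup₂ (f := fun (r : ℝ) (_ : 0 < r) => ballDensity τ x r) (ρ k) (hρ0 k)) hM
    rw [ballDensity, ENNReal.div_le_iff (pow_ne_zero _ (by simpa using hρ0 k))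
      (ENNReal.pow_ne_top ENNReal.ofReal_ne_top), ← ENNReal.ofReal_pow (hρ0 k).le,
      ← ENNReal.ofReal_mul ha] at h1
    exact h1
  set q : ℝ := (1 / 2 : ℝ) ^ (1 / 2 : ℝ) with hq
  have hq1 : q < 1 := half_rpow_half_lt_one
  have hq0 : 0 < q := by positivity
  have hterm : ∀ k, ρ (k + 1) ^ (-s) * (a * ρ k ^ n) =
      2 ^ (n : ℝ) * a * r ^ (1 / 2 : ℝ) * q ^ k := by
    intro k
    have e1 : ρ (k + 1) = ρ k * (1 / 2) := by simp only [hρ, pow_succ]; ring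
    have e2 : ρ k ^ (-s) * ρ k ^ n = ρ k ^ (1 / 2 : ℝ) := by
      rw [← Real.rpow_natCast (ρ k) n, ← Real.rpow_add (hρ0 k)]
      congr 1; rw [hs]; ring
    have e3 : ρ k ^ (1 / 2 : ℝ) = 2 ^ (1 / 2 : ℝ) * r ^ (1 / 2 : ℝ) * q ^ k := by
      simp only [hρ]
      rw [Real.mul_rpow (by positivity) (by positivity), Real.mul_rpow (by positivity) hr.le, hq,
        ← Real.rpow_natCast, ← Real.rpow_natCast, ← Real.rpow_mul (by norm_num),
        ← Real.rpow_mul (by norm_num), mul_comm (k : ℝ)]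
    have e4 : ((1 : ℝ) / 2) ^ (-s) * 2 ^ (1 / 2 : ℝ) = 2 ^ (n : ℝ) := by
      rw [one_div, Real.inv_rpow (by norm_num), Real.rpow_neg (by norm_num), inv_inv,
        ← Real.rpow_add (by norm_num)]
      congr 1; rw [hs]; ring
    rw [e1, Real.mul_rpow (hρ0 k).le (by norm_num)]
    calc _ = (ρ k ^ (-s) * ρ k ^ n) * a * (1 / 2) ^ (-s) := by ring
      _ = ((1 / 2) ^ (-s) * 2 ^ (1 / 2 : ℝ)) * a * r ^ (1 / 2 : ℝ) * q ^ k := by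
        rw [e2, e3]; ring
      _ = _ := by rw [e4]
  calc _ ≤ ∫⁻ y, ∑' k, (closedBall x (ρ k)).indicator
        (fun _ => ENNReal.ofReal (ρ (k + 1) ^ (-s))) y ∂τ := by
        refine lintegral_mono_ae ?_
        filter_upwards [ae_restrict_mem measurableSet_closedBall] with y hy using hpt y hy
    _ = ∑' k, ENNReal.ofReal (ρ (k + 1) ^ (-s)) * τ (closedBall x (ρ k)) := by
        rw [lintegral_tsum fun k => (measurable_const.indicator
          measurableSet_closedBall).aemeasurable]
        simp [lintegral_indicator measurableSet_closedBall]
    _ ≤ ∑' k, ENNReal.ofReal (2 ^ (n : ℝ) * a * r ^ (1 / 2 : ℝ) * q ^ k) := by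
        refine ENNReal.tsum_le_tsum fun k => ?_
        rw [← hterm k, ENNReal.ofReal_mul (by positivity)]
        gcongr
        exact hball k
    _ = ENNReal.ofReal (∑' k, 2 ^ (n : ℝ) * a * r ^ (1 / 2 : ℝ) * q ^ k) := by
        rw [ENNReal.ofReal_tsum_of_nonneg (fun k => by positivity)]
        exact (summable_geometric_of_lt_one hq0.le hq1).mul_left _
    _ = _ := by
        rw [tsum_mul_left, tsum_geometric_of_lt_one hq0.le hq1, potConst]
        congr 1; ring

/-- The factor gained in the supremum of a subharmonic function when crossing a good ball. -/
def decayConst (n : ℕ) (C₂ : ℝ) : ℝ :=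
  min (1 / (64 * 6 ^ ((n : ℝ) - 1 / 2) * potConst n * C₂)) (1 / 2)

lemma decayConst_pos (n : ℕ) {C₂ : ℝ} (hC₂ : 0 < C₂) : 0 < decayConst n C₂ := by
  have := potConst_pos n
  exact lt_min (by positivity) (by norm_num)

lemma decayConst_le (n : ℕ) (C₂ : ℝ) : decayConst n C₂ ≤ 1 / 2 := min_le_right _ _

section Decay

variable {σ : Measure (Euc n)} {M : ℝ≥0}

lemma ae_ne_of_le (hσ : σ ≤ M • volume) (x : Euc n) : ∀ᵐ y ∂σ, y ≠ x := by
  have h : σ ≪ volume := (Measure.absolutelyContinuous_of_le hσ).trans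
    Measure.smul_absolutelyContinuous
  exact h.ae_le (by simp [ae_iff] : ∀ᵐ y ∂volume, y ≠ x)

variable [IsFiniteMeasure σ]

/-- In a good ball there is a compact set of large measure where the maximal density is bounded. -/
lemma exists_isCompact_of_isGoodBall {C₂ : ℝ} (hC₂ : 0 < C₂) {x₁ : Euc n} {r : ℝ} (hr : 0 < r)
    (hgood : IsGoodBall σ C₂ x₁ r) {W : Set (Euc n)} (hW : MeasurableSet W)
    (hσW : σ.real (closedBall x₁ r \ W) ≤ σ.real (closedBall x₁ r) / 2) :
    ∃ F ⊆ W ∩ closedBall x₁ r, IsCompact F ∧ σ.real (closedBall x₁ r) / 8 ≤ σ.real F ∧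
      ∀ x ∈ F, maximalDensity (σ.restrict (closedBall x₁ r)) x ≤
        ENNReal.ofReal (4 * C₂ * (σ.real (closedBall x₁ r) / r ^ n)) := by
  obtain ⟨hpos, hint⟩ := hgood
  set B := closedBall x₁ r with hB
  set m := σ.real B with hm
  have hm0 : 0 < m := ENNReal.toReal_pos hpos.ne' (measure_ne_top _ _)
  have hσB : σ B = ENNReal.ofReal m := (ENNReal.ofReal_toReal (measure_ne_top _ _)).symm
  have hbd : ballDensity σ x₁ r = ENNReal.ofReal (m / r ^ n) := by
    rw [ballDensity, ← hB, hσB, ← ENNReal.ofReal_pow hr.le,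
      ENNReal.ofReal_div_of_pos (by positivity)]
  set t := 4 * C₂ * (m / r ^ n) with ht
  have ht0 : 0 < t := by positivity
  set N := {x | ENNReal.ofReal t ≤ maximalDensity (σ.restrict B) x} with hN
  have hNm : MeasurableSet N := measurableSet_le measurable_const (measurable_maximalDensity _)
  -- Chebyshev's inequality, by the choice of the level `t`
  have hmark : σ.real (B ∩ N) ≤ m / 4 := by
    have h1 := mul_meas_ge_le_lintegral (μ := σ.restrict B)
      (measurable_maximalDensity (σ.restrict B)) (ENNReal.ofReal t)
    have h2 := h1.trans hint
    rw [hbd, hσB, ← ENNReal.ofReal_mul hC₂.le, ← ENNReal.ofReal_mul (by positivity),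
      Measure.restrict_apply hNm, inter_comm,
      ← ENNReal.ofReal_toReal (measure_ne_top σ (B ∩ N)), ← ENNReal.ofReal_mul ht0.le,
      ENNReal.ofReal_le_ofReal_iff (by positivity)] at h2
    change t * σ.real (B ∩ N) ≤ _ at h2
    have h3 : t * σ.real (B ∩ N) ≤ t * (m / 4) := h2.trans (le_of_eq (by rw [ht]; ring))
    exact le_of_mul_le_mul_left h3 ht0
  set G := (W ∩ B) \ N with hG
  have hGm : MeasurableSet G := (hW.inter measurableSet_closedBall).diff hNm
  have hGσ : m / 4 ≤ σ.real G := by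
    have hsub : B ⊆ G ∪ ((B \ W) ∪ (B ∩ N)) := by
      intro y hy
      by_cases h1 : y ∈ W <;> by_cases h2 : y ∈ N <;> simp [hG, h1, h2, hy]
    have := (measureReal_mono hsub (μ := σ)).trans (measureReal_union_le _ _)
    have h2 := measureReal_union_le (μ := σ) (B \ W) (B ∩ N)
    linarith
  have hlt : ENNReal.ofReal (m / 8) < σ G := by
    rw [ENNReal.ofReal_lt_iff_lt_toReal (by positivity) (measure_ne_top _ _)]
    change m / 8 < σ.real G
    linarith
  obtain ⟨F, hFG, hFc, hF⟩ := hGm.exists_lt_isCompact hlt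
  refine ⟨F, hFG.trans sdiff_subset, hFc, ?_, fun x hx => ?_⟩
  · exact ((ENNReal.ofReal_lt_iff_lt_toReal (by positivity) (measure_ne_top _ _)).1 hF).le
  · have := (hFG hx).2
    simp only [hN, mem_ofPred_eq, not_le] at this
    exact this.le

lemma norm_powKernel_le (x y : Euc n) :
    ‖powKernel (x - y)‖ ≤ 1 * ‖x - y‖ ^ (-((n : ℝ) - 1 / 2)) := by
  rw [Real.norm_of_nonneg (powKernel_nonneg _), one_mul, powKernel]

lemma integrable_powKernel (hn : 1 ≤ n) (hσ : σ ≤ M • volume) (x : Euc n) :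
    Integrable (fun y => powKernel (x - y)) σ := by
  have : (1 : ℝ) ≤ n := by exact_mod_cast hn
  exact integrable_of_norm_le_rpow hσ (by linarith) (by linarith)
    (measurable_powKernel.comp (by fun_prop)).aestronglyMeasurable (norm_powKernel_le x)

/-- The potential of the part of `σ` on `F` is bounded everywhere if the maximal density is bounded
on `F`: passing from `x` to a nearest point of `F` at most doubles the distances to `F`. -/
lemma setIntegral_powKernel_le (hn : 1 ≤ n) (hσ : σ ≤ M • volume) {x₁ : Euc n} {r a : ℝ}
    (hr : 0 < r) (ha : 0 ≤ a) {F : Set (Euc n)} (hFc : IsCompact F) (hFB : F ⊆ closedBall x₁ r)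
    (hFM : ∀ x ∈ F, maximalDensity (σ.restrict (closedBall x₁ r)) x ≤ ENNReal.ofReal a)
    (x : Euc n) :
    ∫ y in F, powKernel (x - y) ∂σ ≤
      2 ^ ((n : ℝ) - 1 / 2) * (potConst n * a * r ^ (1 / 2 : ℝ)) := by
  have hn' : (1 : ℝ) ≤ n := by exact_mod_cast hn
  have hpc := potConst_pos n
  have hF : ∀ x ∈ F, ∫ y in F, powKernel (x - y) ∂σ ≤ potConst n * a * r ^ (1 / 2 : ℝ) := by
    intro x hx
    rw [integral_eq_lintegral_of_nonneg_ae (Eventually.of_forall fun y => powKernel_nonneg _)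
      (measurable_powKernel.comp (by fun_prop)).aestronglyMeasurable]
    refine ENNReal.toReal_le_of_le_ofReal (by positivity) ?_
    exact (lintegral_mono_set hFB).trans
      (setLIntegral_powKernel_le hn hr ha (hFB hx) (hFM x hx))
  rcases F.eq_empty_or_nonempty with rfl | hne
  · simp; positivity
  obtain ⟨x', hx', hdist⟩ := hFc.exists_infDist_eq_dist hne x
  refine le_trans ?_ (mul_le_mul_of_nonneg_left (hF x' hx') (by positivity))
  rw [← integral_const_mul]
  refine setIntegral_mono_on_ae (integrable_powKernel hn hσ x).integrableOn
    ((integrable_powKernel hn hσ x').integrableOn.const_mul _) hFc.measurableSet ?_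
  -- the junk value `powKernel 0 = 0` only matters on a null set
  filter_upwards [ae_ne_of_le hσ x'] with y hyx hy
  have h1 : dist x x' ≤ dist x y := by rw [← hdist]; exact infDist_le_dist_of_mem hy
  rcases eq_or_ne x y with rfl | hxy
  · have : x = x' := by rw [dist_self] at h1; exact dist_le_zero.1 h1
    rw [← this, sub_self, powKernel, norm_zero, Real.zero_rpow (by linarith)]; simp
  · have hpos : 0 < ‖x - y‖ := norm_pos_iff.2 (sub_ne_zero.2 hxy)
    have hxy' : x' ≠ y := hyx.symm
    have hle : ‖x' - y‖ ≤ 2 * ‖x - y‖ := by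
      simp only [← dist_eq_norm]
      have := dist_triangle_left x' y x
      linarith
    have hpos' : 0 < ‖x' - y‖ := norm_pos_iff.2 (sub_ne_zero.2 hxy')
    unfold powKernel
    calc _ = 2 ^ ((n : ℝ) - 1 / 2) * (2 * ‖x - y‖) ^ (-((n : ℝ) - 1 / 2)) := by
          rw [Real.mul_rpow (by norm_num) hpos.le, ← mul_assoc, ← Real.rpow_add (by norm_num)]
          simp
      _ ≤ _ := by
          gcongr ?_ * ?_
          exact Real.rpow_le_rpow_of_nonpos hpos' hle (by linarith)

/-- Across a good ball, the supremum of a subharmonic function which vanishes on most of the ball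
decreases by a fixed factor, by comparison with a potential of a measure on the zero set. -/
lemma le_of_isGoodBall (hn : 1 ≤ n) (hσ : σ ≤ M • volume) {C₂ : ℝ} (hC₂ : 0 < C₂) {x₁ : Euc n}
    {r : ℝ} (hr : 0 < r) (hgood : IsGoodBall σ C₂ x₁ r) {f : Euc n → ℝ}
    (hf : ContinuousOn f (closedBall x₁ (16 * r)))
    (hsub : ∀ x t, 0 < t → closedBall x t ⊆ closedBall x₁ (16 * r) →
      wmass n * f x ≤ wmean f x t) {W : Set (Euc n)} (hW : MeasurableSet W)
    (hfW : ∀ x ∈ W ∩ closedBall x₁ r, f x = 0)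
    (hσW : σ.real (closedBall x₁ r \ W) ≤ σ.real (closedBall x₁ r) / 2) {S : ℝ} (hS0 : 0 ≤ S)
    (hS : ∀ x ∈ closedBall x₁ (16 * r), f x ≤ S) {x : Euc n} (hx : x ∈ closedBall x₁ (2 * r)) :
    f x ≤ (1 - decayConst n C₂) * S := by
  have hn' : (1 : ℝ) ≤ n := by exact_mod_cast hn
  set s : ℝ := n - 1 / 2 with hs
  have hs0 : 0 < s := by linarith
  obtain ⟨F, hFW, hFc, hFm, hFM⟩ := exists_isCompact_of_isGoodBall hC₂ hr hgood hW hσW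
  have hFB : F ⊆ closedBall x₁ r := hFW.trans inter_subset_right
  set m := σ.real (closedBall x₁ r) with hm
  have hm0 : 0 < m := ENNReal.toReal_pos hgood.1.ne' (measure_ne_top _ _)
  set mF := σ.real F with hmF
  have hmF0 : 0 < mF := by linarith
  set a := 4 * C₂ * (m / r ^ n) with ha
  have ha0 : 0 < a := by positivity
  have hpc := potConst_pos n
  set P := 2 ^ s * (potConst n * a * r ^ (1 / 2 : ℝ)) with hP
  have hP0 : 0 < P := by positivity
  set p : Euc n → ℝ := fun x => ∫ y in F, powKernel (x - y) ∂σ with hp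
  have hpP : ∀ x, p x ≤ P := fun x => setIntegral_powKernel_le hn hσ hr ha0.le hFc hFB hFM x
  have hσF := restrict_le_smul hσ F
  have hpc : Continuous p := continuous_integral_of_weaklySingular (s := s) (C := 1)
    (Q := fun x y => powKernel (x - y)) hσF hs0.le (by linarith) zero_le_one
    (fun x => (measurable_powKernel.comp (by fun_prop)).aestronglyMeasurable)
    (fun x y h => ContinuousAt.comp (f := fun x => x - y)
      (continuousAt_powKernel (sub_ne_zero.2 h)) (by fun_prop)) norm_powKernel_le
  have hpsub : ∀ x t, 0 < t → Disjoint (closedBall x t) F → wmass n * p x ≤ wmean p x t := by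
    intro x t ht hdisj
    have hint := integrable_prod_of_weaklySingular (ν := σ.restrict F) (x := x) (s := s) (C := 1)
      (Q := fun x y => powKernel (x - y))
      (measurable_powKernel.comp (measurable_fst.sub measurable_snd)).stronglyMeasurable
      ht zero_le_one hs0.le (by linarith) norm_powKernel_le
    have e : wmean p x t = ∫ y in F, wmean (fun z => powKernel (z - y)) x t ∂σ :=
      wmean_integral hint
    rw [e, hp, ← integral_const_mul]
    refine setIntegral_mono_on ((integrable_powKernel hn hσ x).integrableOn.const_mul _)
      hint.integral_prod_right hFc.measurableSet fun y hy => ?_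
    refine wmass_mul_powKernel_le hn ht.le ?_
    by_contra h
    rw [not_lt, dist_comm] at h
    exact disjoint_left.1 hdisj (mem_closedBall.2 h) hy
  set b := (15 * r) ^ (-s) * mF with hb
  have hpb : ∀ x, dist x x₁ = 16 * r → p x ≤ b := by
    intro x hx
    calc p x ≤ ∫ y in F, (15 * r) ^ (-s) ∂σ := by
          refine setIntegral_mono_on (integrable_powKernel hn hσ x).integrableOn
            (integrable_const _) hFc.measurableSet fun y hy => ?_
          refine Real.rpow_le_rpow_of_nonpos (by positivity) ?_ (by linarith)
          have h1 := mem_closedBall.1 (hFB hy)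
          have h2 := dist_triangle x y x₁
          rw [← dist_eq_norm]
          linarith
      _ = b := by rw [setIntegral_const, smul_eq_mul, mul_comm]
  have hpx : ∀ x ∈ closedBall x₁ (2 * r), (3 * r) ^ (-s) * mF ≤ p x := by
    intro x hx
    calc (3 * r) ^ (-s) * mF = ∫ y in F, (3 * r) ^ (-s) ∂σ := by
          rw [setIntegral_const, smul_eq_mul, mul_comm]
      _ ≤ p x := by
          refine setIntegral_mono_on_ae (integrable_const _).integrableOn
            (integrable_powKernel hn hσ x).integrableOn hFc.measurableSet ?_
          filter_upwards [ae_ne_of_le hσ x] with y hyx hy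
          refine Real.rpow_le_rpow_of_nonpos (norm_pos_iff.2 (sub_ne_zero.2 hyx.symm)) ?_
            (by linarith)
          have h1 := mem_closedBall.1 (hFB hy)
          have h2 := dist_triangle_right x y x₁
          rw [← dist_eq_norm]
          rw [mem_closedBall] at hx
          linarith
  -- on `F` the function `f` vanishes and `p ≤ P`; on the outer sphere `f ≤ S` and `p ≤ b`
  have hmain : f x + S / P * (p x - b) ≤ S := by
    refine le_of_submean (g := fun x => f x + S / P * (p x - b)) (x₁ := x₁) (R := 16 * r)
      (Z := F) ?_ ?_ ?_ x (closedBall_subset_closedBall (by linarith) hx)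
    · exact hf.add (by fun_prop : Continuous fun x => S / P * (p x - b)).continuousOn
    · rintro y hy (hyF | hyR)
      · have h1 : p y - b ≤ P := by
          have : 0 ≤ b := by positivity
          linarith [hpP y]
        rw [hfW y (hFW hyF), zero_add]
        calc S / P * (p y - b) ≤ S / P * P := by gcongr
          _ = S := by field_simp
      · have h1 : p y - b ≤ 0 := by linarith [hpb y hyR]
        have h2 : S / P * (p y - b) ≤ 0 := mul_nonpos_of_nonneg_of_nonpos (by positivity) h1
        linarith [hS y hy]
    · intro y hy hyF
      have hO : IsOpen (ball x₁ (16 * r) \ F) := isOpen_ball.sdiff hFc.isClosed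
      obtain ⟨t, ht, hsubt⟩ := Metric.nhds_basis_closedBall.mem_iff.1 (hO.mem_nhds ⟨hy, hyF⟩)
      have htb : closedBall y t ⊆ closedBall x₁ (16 * r) := fun z hz =>
        ball_subset_closedBall (hsubt hz).1
      refine ⟨t, ht, htb, ?_⟩
      have h1 := hsub y t ht htb
      have h2 := hpsub y t ht (disjoint_left.2 fun z hz hzF => (hsubt hz).2 hzF)
      have h3 : wmean (fun x => f x + S / P * (p x - b)) y t =
          wmean f y t + (S / P * wmean p y t - wmass n * (S / P * b)) := by
        rw [wmean_add ht.le (hf.mono htb) (by fun_prop : Continuous fun x =>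
          S / P * (p x - b)).continuousOn, wmean_const_mul]
        have : wmean (fun x => p x - b) y t = wmean p y t - wmass n * b := by
          simp only [sub_eq_add_neg]
          rw [wmean_add ht.le hpc.continuousOn continuousOn_const, wmean_const]
          ring
        rw [this]; ring
      rw [h3]
      have h4 : S / P * (wmass n * p y) ≤ S / P * wmean p y t := by gcongr
      linarith
  -- the gain `(3r)^{-s} - (15r)^{-s}` in the potential, compared with its supremum
  have hgain : decayConst n C₂ * P ≤ (3 * r) ^ (-s) * mF - b := by
    have h5 : ((15 : ℝ) * r) ^ (-s) ≤ (3 * r) ^ (-s) / 2 := by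
      have : (15 : ℝ) * r = 5 * (3 * r) := by ring
      rw [this, Real.mul_rpow (by norm_num) (by positivity), mul_comm, div_eq_mul_one_div]
      gcongr
      rw [Real.rpow_neg (by norm_num), one_div]
      gcongr
      calc (2 : ℝ) ≤ 4 ^ (1 / 2 : ℝ) := by
            rw [← Real.sqrt_eq_rpow, show (4 : ℝ) = 2 ^ 2 by norm_num,
              Real.sqrt_sq (by norm_num)]
        _ ≤ 5 ^ (1 / 2 : ℝ) := by gcongr; norm_num
        _ ≤ 5 ^ s := Real.rpow_le_rpow_of_exponent_le (by norm_num) (by linarith)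
    have h6 : decayConst n C₂ ≤ 1 / (64 * 6 ^ s * potConst n * C₂) := min_le_left _ _
    have e1 : 1 / (64 * 6 ^ s * potConst n * C₂) * P = (3 * r) ^ (-s) / 2 * (m / 8) := by
      have e2 : (6 : ℝ) ^ s = 2 ^ s * 3 ^ s := by
        rw [← Real.mul_rpow (by norm_num) (by norm_num)]; norm_num
      have e3 : r ^ (1 / 2 : ℝ) = r ^ n * r ^ (-s) := by
        rw [← Real.rpow_natCast, ← Real.rpow_add hr]; congr 1; rw [hs]; ring
      rw [hP, ha, e2, e3, Real.mul_rpow (by norm_num) hr.le,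
        Real.rpow_neg (by norm_num : (0 : ℝ) ≤ 3)]
      have := potConst_pos n
      field_simp
      norm_num
    calc decayConst n C₂ * P ≤ 1 / (64 * 6 ^ s * potConst n * C₂) * P := by gcongr
      _ = (3 * r) ^ (-s) / 2 * (m / 8) := e1
      _ ≤ (3 * r) ^ (-s) / 2 * mF := by gcongr
      _ ≤ _ := by
        rw [hb]
        have := mul_le_mul_of_nonneg_right h5 hmF0.le
        linarith
  have h7 : decayConst n C₂ * S ≤ S / P * (p x - b) := by
    calc decayConst n C₂ * S = S / P * (decayConst n C₂ * P) := by field_simp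
      _ ≤ S / P * (p x - b) := by
        gcongr
        linarith [hpx x hx]
  linarith

end Decay

/-! ### Bounds for the field and for its adjoint transform -/

lemma setIntegral_rpow_volume_le {s : ℝ} (hs0 : 0 ≤ s) (hs : s < n + 1) (y z : Euc n) {r : ℝ}
    (hr : 0 < r) :
    ∫ x in closedBall z r, ‖x - y‖ ^ (-s) ≤ powConst n s * r ^ ((n : ℝ) + 1 - s) := by
  simp only [norm_sub_rev _ y]
  rw [integral_eq_lintegral_of_nonneg_ae (Eventually.of_forall fun _ => by positivity)
    (by fun_prop : Measurable fun x => ‖y - x‖ ^ (-s)).aestronglyMeasurable]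
  refine ENNReal.toReal_le_of_le_ofReal ?_ (setLIntegral_rpow_le hs0 hs y z hr)
  have := powConst_pos n s
  positivity

lemma volume_real_closedBall_le (x : Euc n) {r : ℝ} (hr : 0 ≤ r) :
    (volume : Measure (Euc n)).real (closedBall x r) ≤ powConst n n * r ^ (n + 1) := by
  rw [Measure.real, Measure.addHaar_closedBall' _ _ hr, ENNReal.toReal_mul,
    ENNReal.toReal_ofReal (by positivity), finrank_euclideanSpace, Fintype.card_fin, mul_comm]
  gcongr
  unfold powConst
  refine le_add_of_nonneg_left (integral_nonneg fun z => by positivity)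

section

variable {σ : Measure (Euc n)} {M : ℝ≥0} [IsFiniteMeasure σ]

/-- The potential of `u σ|_A` with kernel `|x - y|^{-n}` is integrable over balls. -/
lemma setIntegral_potential_le {u : Euc n → ℝ} {C : ℝ} (hu : Measurable u) (hu0 : ∀ y, 0 ≤ u y)
    (huC : ∀ y, u y ≤ C) (A : Set (Euc n)) (z : Euc n) {r : ℝ} (hr : 0 < r) :
    IntegrableOn (fun x => ∫ y in A, ‖x - y‖ ^ (-(n : ℝ)) * u y ∂σ) (closedBall z r) ∧
    ∫ x in closedBall z r, ∫ y in A, ‖x - y‖ ^ (-(n : ℝ)) * u y ∂σ ≤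
      powConst n n * r * ∫ y in A, u y ∂σ := by
  have : IsFiniteMeasure ((volume : Measure (Euc n)).restrict (closedBall z r)) :=
    ⟨by rw [Measure.restrict_apply_univ]; exact measure_closedBall_lt_top⟩
  have h1 : (volume : Measure (Euc n)).restrict (closedBall z r) ≤ (1 : ℝ≥0) • volume := by
    rw [one_smul]; exact Measure.restrict_le_self
  have hprod : Integrable (fun p : Euc n × Euc n => ‖p.1 - p.2‖ ^ (-(n : ℝ)) * u p.2)
      (((volume : Measure (Euc n)).restrict (closedBall z r)).prod (σ.restrict A)) := by
    refine ((integrable_prod_rpow (σ₂ := σ.restrict A) (s := n) h1 (by positivity)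
      (by linarith)).const_mul C).mono' (Measurable.aestronglyMeasurable ?_)
      (Eventually.of_forall fun p => ?_)
    · exact (by fun_prop : Measurable fun p : Euc n × Euc n => ‖p.1 - p.2‖ ^ (-(n : ℝ))).mul
        (hu.comp measurable_snd)
    · rw [norm_mul, Real.norm_of_nonneg (by positivity), Real.norm_of_nonneg (hu0 _), mul_comm]
      gcongr
      exact huC _
  refine ⟨hprod.integral_prod_left, ?_⟩
  have hui : Integrable u (σ.restrict A) := Integrable.of_bound hu.aestronglyMeasurable C
    (Eventually.of_forall fun y => by rw [Real.norm_of_nonneg (hu0 y)]; exact huC y)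
  rw [integral_integral_swap hprod, ← integral_const_mul]
  refine integral_mono hprod.integral_prod_right (hui.const_mul _) fun y => ?_
  simp only
  rw [integral_mul_const]
  gcongr
  · exact hu0 y
  · refine (setIntegral_rpow_volume_le (by positivity) (by linarith) y z hr).trans (le_of_eq ?_)
    rw [add_sub_cancel_left, Real.rpow_one]

variable {H : Euc n → Euc n} {CH : ℝ}

lemma setIntegral_abs_adjField_le (hn : 1 ≤ n) (hσ : σ ≤ M • volume) (hH : Measurable H)
    (hHb : ∀ x, ‖H x‖ ≤ CH) (A : Set (Euc n)) (z : Euc n) {r : ℝ} (hr : 0 < r) :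
    ∫ x in closedBall z r, |adjField σ H A x| ≤
      powConst n n * r * ∫ y in A, ‖field σ H A y‖ ∂σ := by
  have hfm := measurable_field hn hσ hH A
  have hfb := norm_field_le hn hσ hHb A
  obtain ⟨h1, h2⟩ := setIntegral_potential_le (σ := σ) hfm.norm (fun y => norm_nonneg _) hfb A z hr
  refine le_trans (integral_mono ?_ h1 fun x => ?_) h2
  · exact ((continuous_adjField hn hσ hH hHb A).abs.continuousOn.integrableOn_compact
      (isCompact_closedBall _ _))
  · rw [← Real.norm_eq_abs]
    refine norm_integral_le_of_norm_le ?_ (Eventually.of_forall fun y => ?_)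
    · refine ((integrable_rpow_of_le (s := n) (restrict_le_smul hσ A) (by positivity)
        (by linarith) x).mul_const (CH + (M * powConst n n + σ.real univ))).mono' ?_
        (Eventually.of_forall fun y => ?_)
      · exact ((by fun_prop : Measurable fun y => ‖x - y‖ ^ (-(n : ℝ))).mul
          hfm.norm).aestronglyMeasurable
      · rw [norm_mul, Real.norm_of_nonneg (by positivity), norm_norm]
        gcongr
        exact hfb y
    · refine (norm_inner_le_norm _ _).trans ?_
      rw [norm_rieszKernel_rpow _ hn, norm_sub_rev]

lemma setIntegral_norm_field_le (hn : 1 ≤ n) (hσ : σ ≤ M • volume) {x₁ : Euc n}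
    {r b : ℝ} (hHr : ∀ x ∈ closedBall x₁ r, ‖H x‖ ≤ b) (hE : ContinuousOn (field σ H A)
      (closedBall x₁ r)) (hr : 0 < r) :
    ∫ x in closedBall x₁ r, ‖field σ H A x‖ ≤
      powConst n n * r * (b * r ^ n + σ.real univ) := by
  obtain ⟨h1, h2⟩ := setIntegral_potential_le (σ := σ) (u := fun _ => 1) (C := 1) measurable_const
    (fun _ => zero_le_one) (fun _ => le_rfl) A x₁ hr
  have hb0 : 0 ≤ b := (norm_nonneg _).trans (hHr x₁ (mem_closedBall_self hr.le))
  have hpc := powConst_pos n n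
  have hvol := volume_real_closedBall_le x₁ hr.le
  have hc : IntegrableOn (fun _ : Euc n => b) (closedBall x₁ r) volume :=
    integrableOn_const measure_closedBall_lt_top.ne
  calc _ ≤ ∫ x in closedBall x₁ r, (b + ∫ y in A, ‖x - y‖ ^ (-(n : ℝ)) * 1 ∂σ) := by
        refine setIntegral_mono_on (hE.norm.integrableOn_compact (isCompact_closedBall _ _))
          (hc.add h1) measurableSet_closedBall
          fun x hx => ?_
        refine (norm_add_le _ _).trans (add_le_add (hHr x hx) ?_)
        refine norm_integral_le_of_norm_le ?_ (Eventually.of_forall fun y => ?_)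
        · simpa using integrable_rpow_of_le (s := n) (restrict_le_smul hσ A) (by positivity)
            (by linarith) x
        · rw [norm_rieszKernel_rpow _ hn, mul_one]
    _ ≤ b * (powConst n n * r ^ (n + 1)) + powConst n n * r * σ.real univ := by
        rw [integral_add hc h1, setIntegral_const, smul_eq_mul, mul_comm _ b]
        refine add_le_add (by gcongr) (h2.trans ?_)
        gcongr
        rw [setIntegral_const, smul_eq_mul, mul_one]
        exact measureReal_mono (subset_univ _)
    _ = _ := by ring

/-- Young's inequality with a free parameter `t`. -/
lemma setIntegral_norm_field_le_energy (hn : 1 ≤ n) (hσ : σ ≤ M • volume) (hH : Measurable H)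
    (hHb : ∀ x, ‖H x‖ ≤ CH) (A : Set (Euc n)) {t : ℝ} (ht : 0 < t) :
    ∫ y in A, ‖field σ H A y‖ ∂σ ≤ t * σ.real univ + energy σ H A / t := by
  have hfm := measurable_field hn hσ hH A
  have hfb := norm_field_le hn hσ hHb A
  have i1 : IntegrableOn (fun y => ‖field σ H A y‖) A σ :=
    Integrable.of_bound hfm.norm.aestronglyMeasurable _
      (Eventually.of_forall fun y => by rw [norm_norm]; exact hfb y)
  have i2 : IntegrableOn (fun y => ‖field σ H A y‖ ^ 2) A σ :=
    Integrable.of_bound (hfm.norm.pow_const 2).aestronglyMeasurable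
      ((CH + (M * powConst n n + σ.real univ)) ^ 2)
      (Eventually.of_forall fun y => by rw [norm_pow, norm_norm]; gcongr; exact hfb y)
  calc _ ≤ ∫ y in A, (t + ‖field σ H A y‖ ^ 2 / t) ∂σ := by
        refine integral_mono i1 ((integrable_const t).add (i2.div_const t)) fun y => ?_
        simp only
        set a := ‖field σ H A y‖
        have : a = (a * t) / t := by field_simp
        rw [this, show t + (a * t / t) ^ 2 / t = (t ^ 2 + a ^ 2) / t by field_simp]
        gcongr
        nlinarith [sq_nonneg (a - t), sq_nonneg a, sq_nonneg t]
    _ = t * σ.real A + energy σ H A / t := by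
        rw [integral_add (integrable_const t) (i2.div_const t), setIntegral_const, smul_eq_mul,
          integral_div, mul_comm]
        rfl
    _ ≤ _ := by
        have : σ.real A ≤ σ.real univ := measureReal_mono (subset_univ _)
        gcongr

/-- Gauss's law for the field in a ball in which the external field has no sources. -/
lemma wflux_field (hn : 1 ≤ n) (hσ : σ ≤ M • volume) {x₁ : Euc n} {R r : ℝ}
    (hE : IsExternalField H x₁ R) (A : Set (Euc n)) (hr : 0 < r) (hrR : r < R) :
    wflux (field σ H A) x₁ r =
      ∫ y in A, sphereConst n / (8 * r ^ n) * bump 4 (r⁻¹ • (y - x₁)) ∂σ := by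
  have hσA := restrict_le_smul hσ A
  have hint := integrable_prod_of_weaklySingular (ν := σ.restrict A) (x := x₁) (s := n) (C := 1)
    (Q := fun x y => rieszKernel (x - y))
    (measurable_rieszKernel.comp (measurable_fst.sub measurable_snd)).stronglyMeasurable hr
    zero_le_one (by positivity) (by linarith) fun x y => norm_rieszKernel_sub_le_rpow hn x y
  have h1 := wflux_integral (Q := fun x y => rieszKernel (x - y))
    (Eventually.of_forall fun w => integrable_rieszKernel hn hσA (x₁ + r • w)) hint
  have hadd : wflux (field σ H A) x₁ r =
      wflux H x₁ r + wflux (fun x => ∫ y in A, rieszKernel (x - y) ∂σ) x₁ r := by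
    unfold wflux field
    rw [← integral_add]
    · simp only [inner_add_right, mul_add]
    · exact integrable_bump_smul (by norm_num) (ContinuousOn.inner (𝕜 := ℝ) continuousOn_id
        (continuousOn_comp_add_smul hr.le (hE.continuousOn.mono (closedBall_subset_ball hrR))))
    · exact integrable_bump_smul (by norm_num) (ContinuousOn.inner (𝕜 := ℝ) continuousOn_id
        (continuousOn_comp_add_smul hr.le (continuous_integral_rieszKernel hn hσA).continuousOn))
  rw [hadd, hE.wflux_eq r hr hrR, zero_add, h1]
  exact integral_congr_ae (Eventually.of_forall fun y => wflux_rieszKernel hn x₁ y hr)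

end

/-! ### Iteration over the good scales -/

/-- Decay of a subharmonic function over the good scales `2^j r₁`, `j ∈ G`. -/
lemma le_pow_card_of_isGoodBall (hn : 1 ≤ n) {σ : Measure (Euc n)} {M : ℝ≥0} [IsFiniteMeasure σ]
    (hσ : σ ≤ M • volume) {C₂ : ℝ} (hC₂ : 0 < C₂) {x₁ : Euc n} {r₁ : ℝ} (hr₁ : 0 < r₁) {J : ℕ}
    {G : Finset ℕ} (hGJ : ∀ j ∈ G, j ≤ J) (hG : ∀ j ∈ G, IsGoodBall σ C₂ x₁ (2 ^ j * r₁))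
    {f : Euc n → ℝ} (hf : ContinuousOn f (closedBall x₁ (16 * (2 ^ J * r₁))))
    (hsub : ∀ x t, 0 < t → closedBall x t ⊆ closedBall x₁ (16 * (2 ^ J * r₁)) →
      wmass n * f x ≤ wmean f x t) {W : Set (Euc n)} (hW : MeasurableSet W)
    (hfW : ∀ x ∈ W ∩ closedBall x₁ (16 * (2 ^ J * r₁)), f x = 0)
    (hσW : ∀ j ∈ G, σ.real (closedBall x₁ (2 ^ j * r₁) \ W) ≤
      σ.real (closedBall x₁ (2 ^ j * r₁)) / 2) {S : ℝ} (hS0 : 0 ≤ S)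
    (hS : ∀ x ∈ closedBall x₁ (16 * (2 ^ J * r₁)), f x ≤ S) {x : Euc n}
    (hx : x ∈ closedBall x₁ (2 * r₁)) :
    f x ≤ (1 - decayConst n C₂ / 3) ^ G.card * S := by
  set c := decayConst n C₂ with hc
  have hc0 : 0 < c := decayConst_pos n hC₂
  have hc1 : c ≤ 1 / 2 := decayConst_le n C₂
  set θ := 1 - c / 3 with hθ
  have hθ0 : 0 < θ := by linarith
  have hθ1 : θ ≤ 1 := by linarith
  -- crossing a good ball leads from `16 B` to `2 B`, that is through three scales, so only the
  -- cube root of the gain is attributed to each of them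
  have hθ3 : 1 - c ≤ θ ^ 3 := by
    have : θ ^ 3 - (1 - c) = c ^ 2 / 3 - c ^ 3 / 27 := by rw [hθ]; ring
    nlinarith [sq_nonneg c, mul_nonneg (sq_nonneg c) (by linarith : (0 : ℝ) ≤ 1 / 2 - c)]
  have key : ∀ k j : ℕ, j + k = J + 3 → ∀ x ∈ closedBall x₁ (2 * (2 ^ j * r₁)),
      f x ≤ θ ^ (G.filter (j ≤ ·)).card * S := by
    intro k
    induction k using Nat.strong_induction_on with
    | _ k ih =>
      intro j hjk x hx
      have hmono : ∀ i, i ≤ J + 3 → 2 * (2 ^ i * r₁) ≤ 16 * (2 ^ J * r₁) := by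
        intro i hi
        have h1 : (2 : ℝ) ^ i ≤ 2 ^ (J + 3) := pow_le_pow_right₀ (by norm_num) hi
        have h2 : (2 : ℝ) ^ (J + 3) = 8 * 2 ^ J := by rw [pow_add]; norm_num; ring
        nlinarith
      have hxJ : x ∈ closedBall x₁ (16 * (2 ^ J * r₁)) :=
        closedBall_subset_closedBall (hmono j (by omega)) hx
      rcases Nat.lt_or_ge J j with hJj | hjJ
      · have : G.filter (j ≤ ·) = ∅ := by
          refine Finset.filter_eq_empty_iff.2 fun i hi hij => ?_
          have := hGJ i hi
          omega
        rw [this, Finset.card_empty, pow_zero, one_mul]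
        exact hS x hxJ
      by_cases hj : j ∈ G
      · have hball : closedBall x₁ (16 * (2 ^ j * r₁)) =
            closedBall x₁ (2 * (2 ^ (j + 3) * r₁)) := by
          congr 1; rw [pow_add]; ring
        have hsubJ : closedBall x₁ (16 * (2 ^ j * r₁)) ⊆ closedBall x₁ (16 * (2 ^ J * r₁)) := by
          rw [hball]; exact closedBall_subset_closedBall (hmono _ (by omega))
        have h1 := ih (k - 3) (by omega) (j + 3) (by omega)
        rw [← hball] at h1
        have hB16 : closedBall x₁ (2 ^ j * r₁) ⊆ closedBall x₁ (16 * (2 ^ j * r₁)) :=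
          closedBall_subset_closedBall (by have : 0 < 2 ^ j * r₁ := by positivity
                                           linarith)
        have h2 := le_of_isGoodBall hn hσ hC₂ (by positivity) (hG j hj) (hf.mono hsubJ)
          (fun x t ht h => hsub x t ht (h.trans hsubJ)) hW
          (fun y hy => hfW y ⟨hy.1, hsubJ (hB16 hy.2)⟩) (hσW j hj)
          (by positivity) h1 hx
        refine h2.trans ?_
        have hcard : (G.filter (j ≤ ·)).card ≤ 3 + (G.filter (j + 3 ≤ ·)).card := by
          have : G.filter (j ≤ ·) ⊆ Finset.Ico j (j + 3) ∪ G.filter (j + 3 ≤ ·) := by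
            intro i hi
            simp only [Finset.mem_filter, Finset.mem_union, Finset.mem_Ico] at hi ⊢
            by_cases h : j + 3 ≤ i
            · exact Or.inr ⟨hi.1, h⟩
            · exact Or.inl ⟨hi.2, by omega⟩
          refine (Finset.card_le_card this).trans ((Finset.card_union_le _ _).trans ?_)
          simp
        calc _ ≤ θ ^ 3 * (θ ^ (G.filter (j + 3 ≤ ·)).card * S) := by gcongr
          _ = θ ^ (3 + (G.filter (j + 3 ≤ ·)).card) * S := by rw [pow_add]; ring
          _ ≤ _ := by
            gcongr ?_ * S
            exact pow_le_pow_of_le_one hθ0.le hθ1 hcard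
      · have h1 := ih (k - 1) (by omega) (j + 1) (by omega) x
          (closedBall_subset_closedBall (by
            rw [pow_succ]
            have : 0 < 2 ^ j * r₁ := by positivity
            linarith) hx)
        have : G.filter (j ≤ ·) = G.filter (j + 1 ≤ ·) := by
          refine Finset.filter_congr fun i hi => ?_
          have : i ≠ j := fun h => hj (h ▸ hi)
          omega
        rwa [this]
  have h := key (J + 3) 0 (by omega) x (by simpa using hx)
  simpa using h

/-! ### The lower bound for the energy -/

/-- The size, relative to the density, of the field that is too small to carry the flux of the
mass of a ball of relative density `α`. -/
def levelConst (n : ℕ) (α : ℝ) : ℝ :=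
  81 * sphereConst n * α / (4096 * 2 ^ n) / (8 * wmass n)

lemma levelConst_pos (n : ℕ) {α : ℝ} (hα : 0 < α) : 0 < levelConst n α := by
  have := sphereConst_pos n
  have := wmass_pos n
  unfold levelConst
  positivity

/-- The constant in the supremum bound for the square root of the excess. -/
def topConst (n : ℕ) (B L : ℝ) : ℝ :=
  2 ^ (8 * (n + 1)) / wmass n * powConst n n * (B + 2 + 2 * L)

section

variable {σ : Measure (Euc n)} {M : ℝ≥0} {H : Euc n → Euc n} {CH : ℝ} {A : Set (Euc n)}

/-- The excess is at most `|G|² + 2 |T|`, and `√(2 |T|) ≤ t + |T| / t`. -/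
lemma sqrt_excess_le {lam t : ℝ} (hlam : 0 ≤ lam) (ht : 0 < t) (x : Euc n) :
    √(excess σ H A lam x) ≤ ‖field σ H A x‖ + t + |adjField σ H A x| / t := by
  refine Real.sqrt_le_iff.2 ⟨by positivity, max_le ?_ (by positivity)⟩
  have h1 := le_abs_self (adjField σ H A x)
  have h2 : t * (|adjField σ H A x| / t) = |adjField σ H A x| := by field_simp
  have h3 : 0 ≤ |adjField σ H A x| / t := by positivity
  unfold firstVar
  nlinarith [norm_nonneg (field σ H A x), mul_nonneg (norm_nonneg (field σ H A x)) ht.le,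
    mul_nonneg (norm_nonneg (field σ H A x)) h3]

/-- Since `|G|² = V - 2 T`, the field is small where the excess and the adjoint transform are. -/
lemma norm_field_le_of_excess {lam s : ℝ} (hs : 0 < s) {x : Euc n}
    (h : lam + excess σ H A lam x ≤ s ^ 2) :
    ‖field σ H A x‖ ≤ s + |adjField σ H A x| / s := by
  refine abs_le_of_sq_le_sq' ?_ (by positivity) |>.2
  have h1 := neg_abs_le (adjField σ H A x)
  have h2 : s * (|adjField σ H A x| / s) = |adjField σ H A x| := by field_simp
  have h3 : firstVar σ H A x - lam ≤ excess σ H A lam x := le_max_left _ _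
  unfold firstVar at h3
  nlinarith [sq_nonneg (|adjField σ H A x| / s)]

variable [IsFiniteMeasure σ]

/-- The bound for the excess to start with: its square root is bounded in mean, by the potential
estimates for the field and the adjoint transform, and its cube has the sub-mean value property. -/
lemma excess_le_of_integral_field_le (hn : 1 ≤ n) (hσ : σ ≤ M • volume) (hH : Measurable H)
    (hHb : ∀ x, ‖H x‖ ≤ CH) {x₁ : Euc n} {R T B L lam lam' : ℝ} (hE : IsExternalField H x₁ R)
    (hV : ∀ᵐ x ∂σ.restrict A, firstVar σ H A x ≤ lam) (hlam0 : 0 ≤ lam) (hlam : lam < lam')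
    (hR : 0 < R) (hT : 0 < T) (hL : 0 ≤ L) (hHB : ∀ x ∈ ball x₁ R, ‖H x‖ ≤ B * T)
    (hmass : σ.real univ ≤ L * T * R ^ n)
    (hint : ∫ y in A, ‖field σ H A y‖ ∂σ ≤ (L + 1) * T ^ 2 * R ^ n)
    {x : Euc n} (hx : x ∈ closedBall x₁ (R / 4)) :
    excess σ H A lam' x ^ 3 ≤ (topConst n B L * T) ^ 6 := by
  set q : Euc n → ℝ := fun x => √(excess σ H A lam' x) with hq
  have hq6 : ∀ y, q y ^ 6 = excess σ H A lam' y ^ 3 := fun y => by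
    rw [hq, show 6 = 2 * 3 from rfl, pow_mul, Real.sq_sqrt (excess_nonneg _ _ _ _ _)]
  have hR2 : 0 < R / 2 := by positivity
  have hsub : closedBall x₁ (R / 2) ⊆ ball x₁ R := closedBall_subset_ball (by linarith)
  have hqc : ContinuousOn q (closedBall x₁ (R / 2)) :=
    ((continuousOn_excess hn hσ hH hHb hE A lam').mono hsub).sqrt
  have hfc := (continuousOn_field hn hσ hE A).mono hsub
  have hTc := continuous_adjField hn hσ hH hHb A
  have hK := isCompact_closedBall x₁ (R / 2)
  have hpc := powConst_pos n n
  have hw := wmass_pos n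
  have hB0 : 0 ≤ B * T := (norm_nonneg _).trans (hHB x₁ (mem_ball_self hR))
  have hB : 0 ≤ B := nonneg_of_mul_nonneg_left hB0 hT
  have hI : ∫ y in closedBall x₁ (R / 2), q y ≤
      powConst n n * R ^ (n + 1) * T * (B + 2 + 2 * L) := by
    have i1 : IntegrableOn (fun y => ‖field σ H A y‖) (closedBall x₁ (R / 2)) :=
      hfc.norm.integrableOn_compact hK
    have i2 : IntegrableOn (fun _ : Euc n => T) (closedBall x₁ (R / 2)) :=
      continuousOn_const.integrableOn_compact hK
    have i3 : IntegrableOn (fun y => |adjField σ H A y| / T) (closedBall x₁ (R / 2)) :=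
      (hTc.abs.div_const T).continuousOn.integrableOn_compact hK
    have i12 : IntegrableOn (fun y => ‖field σ H A y‖ + T) (closedBall x₁ (R / 2)) := i1.add i2
    have e1 := setIntegral_norm_field_le (A := A) hn hσ (fun y hy => hHB y (hsub hy)) hfc hR2
    have e2 := volume_real_closedBall_le x₁ hR2.le
    have e3 := setIntegral_abs_adjField_le hn hσ hH hHb A x₁ hR2
    calc _ ≤ ∫ y in closedBall x₁ (R / 2),
          (‖field σ H A y‖ + T + |adjField σ H A y| / T) :=
          integral_mono (hqc.integrableOn_compact hK) (i12.add i3)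
            fun y => sqrt_excess_le (hlam0.trans hlam.le) hT y
      _ = (∫ y in closedBall x₁ (R / 2), ‖field σ H A y‖) +
            volume.real (closedBall x₁ (R / 2)) * T +
            (∫ y in closedBall x₁ (R / 2), |adjField σ H A y|) / T := by
          rw [integral_add i12 i3, integral_add i1 i2, setIntegral_const, smul_eq_mul,
            integral_div]
      _ ≤ powConst n n * R * (B * T * R ^ n + L * T * R ^ n) +
            powConst n n * R ^ (n + 1) * T +
            powConst n n * R * ((L + 1) * T ^ 2 * R ^ n) / T := by
          have hR' : R / 2 ≤ R := by linarith
          gcongr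
          · refine e1.trans ?_
            gcongr
          · refine e2.trans ?_
            gcongr
          · refine e3.trans ?_
            have : 0 ≤ ∫ y in A, ‖field σ H A y‖ ∂σ := integral_nonneg fun y => norm_nonneg _
            gcongr
      _ = _ := by field_simp; ring
  have hmain := le_setIntegral_of_submean_pow hR2 hqc (fun y => Real.sqrt_nonneg _)
    (fun y r hr h => by
      simp only [hq6]
      exact wmass_mul_excess_le hn hσ hH hHb hE hV hlam hr.le (h.trans hsub))
    (by convert hx using 2; ring : x ∈ closedBall x₁ (R / 2 / 2))
  rw [← hq6]
  refine pow_le_pow_left₀ (Real.sqrt_nonneg _) (hmain.trans ?_) 6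
  calc _ ≤ 2 ^ (7 * (n + 1)) / (wmass n * (R / 2) ^ (n + 1)) *
        (powConst n n * R ^ (n + 1) * T * (B + 2 + 2 * L)) := by gcongr
    _ = _ := by
      rw [topConst, div_pow, show 8 * (n + 1) = 7 * (n + 1) + (n + 1) by ring,
        pow_add 2 (7 * (n + 1))]
      field_simp

/-- A field that is small on the ball `2 B₁`, up to a small adjoint transform, cannot carry the
flux of the mass of `B₁`. -/
lemma flux_contradiction (hn : 1 ≤ n) (hσ : σ ≤ M • volume) (hH : Measurable H)
    (hHb : ∀ x, ‖H x‖ ≤ CH) {x₁ : Euc n} {R r₁ T α g : ℝ} (hE : IsExternalField H x₁ R)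
    (hA : MeasurableSet A) (hr₁ : 0 < r₁) (hrR : 2 * r₁ < R) (hT : 0 < T) (hα : 0 < α)
    (hmass : α * T * r₁ ^ n / 2 ≤ σ.real (A ∩ closedBall x₁ r₁))
    (hfield : ∀ x ∈ closedBall x₁ (2 * r₁), ‖field σ H A x‖ ≤
      2 * levelConst n α * T + |adjField σ H A x| / (2 * levelConst n α * T))
    (hint : ∫ y in A, ‖field σ H A y‖ ∂σ ≤ g)
    (hg : powConst n n * g ≤ 2 * wmass n * levelConst n α ^ 2 * T ^ 2 * r₁ ^ n) : False := by
  set ζ := levelConst n α with hζ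
  have hζ0 : 0 < ζ := levelConst_pos n hα
  have hw := wmass_pos n
  have hs := sphereConst_pos n
  have hpc := powConst_pos n n
  have hrel : 81 * sphereConst n * α / (4096 * 2 ^ n) = 8 * wmass n * ζ := by
    rw [hζ, levelConst]; field_simp
  have h2r : 0 < 2 * r₁ := by positivity
  have hsub : closedBall x₁ (2 * r₁) ⊆ ball x₁ R := closedBall_subset_ball hrR
  have hfc := (continuousOn_field hn hσ hE A).mono hsub
  have hTc := continuous_adjField hn hσ hH hHb A
  -- the flux is at least the one of the mass in `A ∩ B₁`
  have lower : 8 * wmass n * ζ * T ≤ wflux (field σ H A) x₁ (2 * r₁) := by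
    rw [wflux_field hn hσ hE A h2r hrR]
    have hb : Integrable (fun y => sphereConst n / (8 * (2 * r₁) ^ n) *
        bump 4 ((2 * r₁)⁻¹ • (y - x₁))) (σ.restrict A) := by
      refine Integrable.of_bound (C := sphereConst n / (8 * (2 * r₁) ^ n) * 1)
        (Measurable.aestronglyMeasurable ?_) (Eventually.of_forall fun y => ?_)
      · have : Measurable fun y : Euc n => bump 4 ((2 * r₁)⁻¹ • (y - x₁)) :=
          ((continuous_bump 4).comp
            (by fun_prop : Continuous fun y : Euc n => (2 * r₁)⁻¹ • (y - x₁))).measurable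
        exact this.const_mul _
      · rw [Real.norm_of_nonneg (by have := bump_nonneg 4 ((2 * r₁)⁻¹ • (y - x₁)); positivity)]
        gcongr
        exact bump_le_one _ _
    calc 8 * wmass n * ζ * T
        = sphereConst n / (8 * (2 * r₁) ^ n) * (3 / 4) ^ 4 * (α * T * r₁ ^ n / 2) := by
          rw [← hrel, mul_pow]; field_simp; norm_num
      _ ≤ sphereConst n / (8 * (2 * r₁) ^ n) * (3 / 4) ^ 4 * σ.real (A ∩ closedBall x₁ r₁) := by
          gcongr
      _ = ∫ y in A ∩ closedBall x₁ r₁, sphereConst n / (8 * (2 * r₁) ^ n) * (3 / 4) ^ 4 ∂σ := by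
          rw [setIntegral_const, smul_eq_mul, mul_comm]
      _ ≤ ∫ y in A ∩ closedBall x₁ r₁, sphereConst n / (8 * (2 * r₁) ^ n) *
            bump 4 ((2 * r₁)⁻¹ • (y - x₁)) ∂σ := by
          refine setIntegral_mono_on (integrable_const _)
            (IntegrableOn.mono_set hb inter_subset_left)
            (hA.inter measurableSet_closedBall) fun y hy => ?_
          gcongr
          unfold bump
          gcongr
          refine le_max_of_le_left ?_
          have h1 : ‖y - x₁‖ ≤ r₁ := by simpa [dist_eq_norm] using hy.2
          have h2 : ‖(2 * r₁)⁻¹ • (y - x₁)‖ ≤ 1 / 2 := by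
            rw [norm_smul, norm_inv, Real.norm_of_nonneg h2r.le, inv_mul_le_iff₀ h2r]
            linarith
          nlinarith [norm_nonneg ((2 * r₁)⁻¹ • (y - x₁))]
      _ ≤ _ := by
          refine setIntegral_mono_set hb (Eventually.of_forall fun y => ?_)
            (inter_subset_left.eventuallyLE)
          have := bump_nonneg 4 ((2 * r₁)⁻¹ • (y - x₁))
          simp only [Pi.zero_apply]
          positivity
  -- and at most the mean of the norm of the field
  have hmap : ∀ w : Euc n, ‖w‖ ≤ 1 → x₁ + (2 * r₁) • w ∈ closedBall x₁ (2 * r₁) :=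
    fun w hw => add_smul_mem_closedBall h2r.le hw
  have i0 : Integrable (fun w : Euc n => bump 3 w * ‖field σ H A (x₁ + (2 * r₁) • w)‖) :=
    integrable_bump_smul (by norm_num) (continuousOn_comp_add_smul h2r.le hfc).norm
  have i1 : Integrable (fun w : Euc n => bump 3 w * (2 * ζ * T)) :=
    integrable_bump_smul (by norm_num) continuousOn_const
  have i2 : IntegrableOn (fun w : Euc n => |adjField σ H A (x₁ + (2 * r₁) • w)| / (2 * ζ * T))
      (closedBall 0 1) :=
    (Continuous.continuousOn (by fun_prop)).integrableOn_compact (isCompact_closedBall _ _)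
  have upper : |wflux (field σ H A) x₁ (2 * r₁)| ≤ 2 * ζ * T * wmass n +
      ((2 * r₁) ^ (n + 1))⁻¹ * (powConst n n * (2 * r₁) * g) / (2 * ζ * T) := by
    refine (norm_wflux_le i0).trans ?_
    calc _ ≤ ∫ w : Euc n, (bump 3 w * (2 * ζ * T) + (closedBall (0 : Euc n) 1).indicator
          (fun w => |adjField σ H A (x₁ + (2 * r₁) • w)| / (2 * ζ * T)) w) := by
          refine integral_mono i0 (i1.add (i2.integrable_indicator measurableSet_closedBall))
            fun w => ?_
          simp only
          by_cases hw1 : ‖w‖ ≤ 1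
          · rw [indicator_of_mem (by simpa using hw1)]
            refine (mul_le_mul_of_nonneg_left (hfield _ (hmap w hw1)) (bump_nonneg _ _)).trans ?_
            rw [mul_add]
            gcongr
            exact mul_le_of_le_one_left (by positivity) (bump_le_one _ _)
          · rw [bump_eq_zero (by norm_num) (not_le.1 hw1).le, zero_mul, zero_mul, zero_add]
            exact indicator_nonneg (fun _ _ => by positivity) _
      _ = 2 * ζ * T * wmass n + (∫ w in closedBall (0 : Euc n) 1,
            |adjField σ H A (x₁ + (2 * r₁) • w)|) / (2 * ζ * T) := by
          rw [integral_add i1 (i2.integrable_indicator measurableSet_closedBall),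
            integral_indicator measurableSet_closedBall, integral_mul_const, integral_div, wmass,
            mul_comm]
      _ ≤ _ := by
          rw [setIntegral_comp_add_smul (fun y => |adjField σ H A y|) x₁ h2r]
          gcongr
          refine (setIntegral_abs_adjField_le hn hσ hH hHb A x₁ h2r).trans ?_
          gcongr
  have hup2 : ((2 * r₁) ^ (n + 1))⁻¹ * (powConst n n * (2 * r₁) * g) / (2 * ζ * T) ≤
      wmass n * ζ * T := by
    have h2n : (1 : ℝ) ≤ 2 ^ n := one_le_pow₀ (by norm_num)
    rw [div_le_iff₀ (by positivity), inv_mul_le_iff₀ (by positivity), pow_succ, mul_pow]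
    calc powConst n n * (2 * r₁) * g = (powConst n n * g) * (2 * r₁) := by ring
      _ ≤ (2 * wmass n * ζ ^ 2 * T ^ 2 * r₁ ^ n) * (2 * r₁) := by gcongr
      _ ≤ 2 ^ n * ((2 * wmass n * ζ ^ 2 * T ^ 2 * r₁ ^ n) * (2 * r₁)) :=
          le_mul_of_one_le_left (by positivity) h2n
      _ = _ := by ring
  have hpos : 0 < wmass n * ζ * T := by positivity
  have := le_abs_self (wflux (field σ H A) x₁ (2 * r₁))
  linarith

/-- The lower bound for the energy in terms of dimensionless data: the energy of the measure `σ`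
in the external field `H` is not small with respect to `T ^ 3 * R ^ n`, where `T` is a density. -/
theorem lt_energy (hn : 1 ≤ n) (hσ : σ ≤ M • volume) (hH : Measurable H)
    (hHb : ∀ x, ‖H x‖ ≤ CH) {x₁ : Euc n} {R r₁ T α B L C₂ ε : ℝ} (hE : IsExternalField H x₁ R)
    (hr₁ : 0 < r₁) (hR : 0 < R) (hT : 0 < T) (hα : 0 < α) (hL : 0 ≤ L) (hC₂ : 0 < C₂)
    (hHB : ∀ x ∈ ball x₁ R, ‖H x‖ ≤ B * T) (hmass : σ.real univ ≤ L * T * R ^ n)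
    (hdens : α * T * r₁ ^ n ≤ σ.real (closedBall x₁ r₁))
    {J : ℕ} (hJ : 16 * (2 ^ J * r₁) ≤ R / 4)
    {G : Finset ℕ} (hGJ : ∀ j ∈ G, j ≤ J) (hG : ∀ j ∈ G, IsGoodBall σ C₂ x₁ (2 ^ j * r₁))
    (hcard : (1 - decayConst n C₂ / 3) ^ G.card * topConst n B L ^ 6 ≤ levelConst n α ^ 6)
    (hε0 : 0 < ε) (hε1 : ε ≤ 1) (hε2 : 2 * ε ^ 2 * R ^ n ≤ levelConst n α ^ 2 * α * r₁ ^ n)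
    (hε3 : powConst n n * (ε * (L + 1) * R ^ n) ≤ 2 * wmass n * levelConst n α ^ 2 * r₁ ^ n) :
    ε ^ 2 * T ^ 3 * R ^ n < energy σ H univ := by
  by_contra! hen
  set ζ := levelConst n α with hζ
  have hζ0 : 0 < ζ := levelConst_pos n hα
  have hlam0 : 0 < ζ ^ 2 * T ^ 2 := by positivity
  obtain ⟨A, hA, hA1, hA2⟩ := exists_stable_subset σ (energy σ H) (ζ ^ 2 * T ^ 2)
    (tendsto_energy_iInter hn hσ hH hHb)
  have hV := firstVar_le_of_stable hn hσ hH hHb hA hA2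
  have henA0 : 0 ≤ energy σ H A := integral_nonneg fun x => by positivity
  have henA : energy σ H A ≤ ε ^ 2 * T ^ 3 * R ^ n := by
    have : 0 ≤ ζ ^ 2 * T ^ 2 * σ.real Aᶜ := by positivity
    linarith
  -- little mass is removed
  have hAc : σ.real Aᶜ ≤ α * T * r₁ ^ n / 2 := by
    have h1 : ζ ^ 2 * T ^ 2 * σ.real Aᶜ ≤ ζ ^ 2 * T ^ 2 * (α * T * r₁ ^ n / 2) := by
      calc _ ≤ ε ^ 2 * T ^ 3 * R ^ n := by linarith
        _ = (2 * ε ^ 2 * R ^ n) * T ^ 3 / 2 := by ring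
        _ ≤ (ζ ^ 2 * α * r₁ ^ n) * T ^ 3 / 2 := by gcongr
        _ = _ := by ring
    exact le_of_mul_le_mul_left h1 hlam0
  -- the choice `t = ε T` balances the two terms
  have hint : ∫ y in A, ‖field σ H A y‖ ∂σ ≤ ε * (L + 1) * T ^ 2 * R ^ n := by
    refine (setIntegral_norm_field_le_energy hn hσ hH hHb A (t := ε * T) (by positivity)).trans ?_
    calc _ ≤ ε * T * (L * T * R ^ n) + (ε ^ 2 * T ^ 3 * R ^ n) / (ε * T) := by gcongr
      _ = _ := by field_simp
  have hint' : ∫ y in A, ‖field σ H A y‖ ∂σ ≤ (L + 1) * T ^ 2 * R ^ n := by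
    refine hint.trans ?_
    rw [mul_assoc, mul_assoc, mul_assoc (L + 1)]
    exact mul_le_of_le_one_left (by positivity) hε1
  have hlam : ζ ^ 2 * T ^ 2 < 2 * (ζ ^ 2 * T ^ 2) := by linarith
  have hr₁J : r₁ ≤ 2 ^ J * r₁ := le_mul_of_one_le_left hr₁.le (one_le_pow₀ (by norm_num))
  have hsub4 : closedBall x₁ (16 * (2 ^ J * r₁)) ⊆ closedBall x₁ (R / 4) :=
    closedBall_subset_closedBall hJ
  have hsubR : closedBall x₁ (R / 4) ⊆ ball x₁ R := closedBall_subset_ball (by linarith)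
  -- the excess vanishes on `A ∩ supp(σ|_A)`, which carries all of `σ` but the little mass of `Aᶜ`
  have hdecay : ∀ x ∈ closedBall x₁ (2 * r₁), excess σ H A (2 * (ζ ^ 2 * T ^ 2)) x ^ 3 ≤
      (1 - decayConst n C₂ / 3) ^ G.card * (topConst n B L * T) ^ 6 := by
    intro x hx
    refine le_pow_card_of_isGoodBall hn hσ hC₂ hr₁ hGJ hG
      (f := fun x => excess σ H A (2 * (ζ ^ 2 * T ^ 2)) x ^ 3)
      (((continuousOn_excess hn hσ hH hHb hE A _).mono (hsub4.trans hsubR)).pow 3)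
      (fun y t ht h => wmass_mul_excess_le hn hσ hH hHb hE hV hlam ht.le
        (h.trans (hsub4.trans hsubR)))
      (W := A ∩ (σ.restrict A).support) (hA.inter Measure.isClosed_support.measurableSet)
      (fun y hy => ?_) (fun j hj => ?_) (by positivity) (fun y hy => ?_) hx
    · have := firstVar_le_of_mem_support hn hσ hH hHb hE hV (hsubR (hsub4 hy.2)) hy.1.2
      rw [excess, max_eq_right (by linarith), zero_pow (by norm_num)]
    · have h0 : σ.real (A \ (σ.restrict A).support) = 0 := by
        have h1 : σ.restrict A (σ.restrict A).supportᶜ = 0 := Measure.support_mem_ae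
        rw [Measure.restrict_apply Measure.isClosed_support.measurableSet.compl] at h1
        rw [Measure.real, sdiff_eq, inter_comm, h1, ENNReal.toReal_zero]
      calc σ.real (closedBall x₁ (2 ^ j * r₁) \ (A ∩ (σ.restrict A).support))
          ≤ σ.real (Aᶜ ∪ A \ (σ.restrict A).support) := by
            refine measureReal_mono fun y hy => ?_
            by_cases hyA : y ∈ A
            · exact Or.inr ⟨hyA, fun hys => hy.2 ⟨hyA, hys⟩⟩
            · exact Or.inl hyA
        _ ≤ σ.real Aᶜ + σ.real (A \ (σ.restrict A).support) := measureReal_union_le _ _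
        _ ≤ σ.real (closedBall x₁ r₁) / 2 := by rw [h0]; linarith
        _ ≤ _ := by
            have : σ.real (closedBall x₁ r₁) ≤ σ.real (closedBall x₁ (2 ^ j * r₁)) :=
              measureReal_mono (closedBall_subset_closedBall
                (le_mul_of_one_le_left hr₁.le (one_le_pow₀ (by norm_num))))
            linarith
    · exact excess_le_of_integral_field_le hn hσ hH hHb hE hV hlam0.le hlam hR hT hL hHB hmass
        hint' (hsub4 hy)
  have hexc : ∀ x ∈ closedBall x₁ (2 * r₁), excess σ H A (2 * (ζ ^ 2 * T ^ 2)) x ≤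
      ζ ^ 2 * T ^ 2 := by
    intro x hx
    refine le_of_pow_le_pow_left₀ (n := 3) (by norm_num) hlam0.le ((hdecay x hx).trans ?_)
    calc _ = ((1 - decayConst n C₂ / 3) ^ G.card * topConst n B L ^ 6) * T ^ 6 := by ring
      _ ≤ ζ ^ 6 * T ^ 6 := by gcongr
      _ = _ := by ring
  refine flux_contradiction hn hσ hH hHb hE hA hr₁ (by linarith) hT hα ?_ (fun x hx => ?_) hint ?_
  · have h1 : σ.real (closedBall x₁ r₁) ≤ σ.real (A ∩ closedBall x₁ r₁ ∪ Aᶜ) := by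
      refine measureReal_mono fun y hy => ?_
      by_cases hyA : y ∈ A
      · exact Or.inl ⟨hyA, hy⟩
      · exact Or.inr hyA
    have h2 : σ.real (A ∩ closedBall x₁ r₁ ∪ Aᶜ) ≤ _ := measureReal_union_le _ _
    linarith
  · refine norm_field_le_of_excess (lam := 2 * (ζ ^ 2 * T ^ 2)) (by positivity) ?_
    have := hexc x hx
    nlinarith
  · calc _ = powConst n n * (ε * (L + 1) * R ^ n) * T ^ 2 := by ring
      _ ≤ (2 * wmass n * ζ ^ 2 * r₁ ^ n) * T ^ 2 := by gcongr
      _ = _ := by ring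

end

/-! ### The region covered by the cubes of the lattice -/

section

variable {μ : Measure (Euc n)} (D : DavidMattilaLattice μ) {k : ℕ} {Q : Set (Euc n)}

lemma zero_lt_A₀ : 0 < D.A₀ := by
  have := D.one_lt_C₀
  have := D.lt_A₀
  linarith

lemma radius_pos (hQ : Q ∈ D.cubes k) : 0 < D.radius k Q :=
  lt_of_lt_of_le (inv_pos.2 (pow_pos (zero_lt_A₀ D) k)) (D.le_radius k Q hQ)

lemma center_mem_cube (hQ : Q ∈ D.cubes k) : D.center k Q ∈ Q :=
  D.ball_subset k Q hQ ⟨D.center_mem k Q hQ, mem_closedBall_self (radius_pos D hQ).le⟩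

lemma sideLength_pos (k : ℕ) : 0 < D.sideLength k := by
  have := pow_pos (zero_lt_A₀ D) k
  have := D.one_lt_C₀
  unfold DavidMattilaLattice.sideLength
  positivity

lemma subset_dilate (hQ : Q ∈ D.cubes k) : Q ⊆ D.dilate 2 k Q := by
  refine subset_sUnion_of_mem ⟨hQ, ?_⟩
  rw [infDist_zero_of_mem (center_mem_cube D hQ)]
  have := sideLength_pos D k
  positivity

lemma countable_cubes (k : ℕ) : (D.cubes k).Countable := by
  refine (D.disjoint_balls k).countable_of_nonempty_interior fun Q hQ => ?_
  refine ⟨D.center k Q, ball_subset_interior_closedBall (mem_ball_self ?_)⟩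
  have := radius_pos D hQ
  positivity

/-- The lattice has countably many cubes, since the balls of each generation are disjoint. -/
lemma measurableSet_region (x₀ : Euc n) (r₀ : ℝ) : MeasurableSet (D.region x₀ r₀) := by
  have hsub : {Q | Maximal (D.IsAdmissible x₀ r₀) Q} ⊆ ⋃ k, D.cubes k := by
    rintro Q ⟨⟨k, hk, -⟩, -⟩
    exact mem_iUnion.2 ⟨k, hk⟩
  refine MeasurableSet.sUnion ((countable_iUnion (countable_cubes D)).mono hsub) fun Q hQ => ?_
  obtain ⟨k, hk⟩ := mem_iUnion.1 (hsub hQ)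
  exact D.measurableSet k Q hk

lemma region_subset_closedBall (x₀ : Euc n) (r₀ : ℝ) :
    D.region x₀ r₀ ⊆ closedBall x₀ (3 / 2 * r₀) := by
  refine sUnion_subset ?_
  rintro Q ⟨⟨k, hk, h, -⟩, -⟩
  exact (subset_dilate D hk).trans h

lemma dist_le_sideLength (hQ : Q ∈ D.cubes k) {x y : Euc n} (hx : x ∈ Q) (hy : y ∈ Q) :
    dist x y ≤ D.sideLength k := by
  have h1 := mem_closedBall.1 (D.subset_ball k Q hQ hx).2
  have h2 := mem_closedBall'.1 (D.subset_ball k Q hQ hy).2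
  have h3 := D.radius_le k Q hQ
  have h4 := dist_triangle x (D.center k Q) y
  unfold DavidMattilaLattice.sideLength
  linarith

lemma dilate_subset_closedBall (hQ : Q ∈ D.cubes k) {x : Euc n} (hx : x ∈ Q) :
    D.dilate 2 k Q ⊆ closedBall x (5 * D.sideLength k) := by
  refine sUnion_subset ?_
  rintro P ⟨hP, hd⟩ y hy
  have hl := sideLength_pos D k
  obtain ⟨p, hp, hp'⟩ := (infDist_lt_iff ⟨y, hy⟩).1
    (lt_of_le_of_lt hd (by linarith : 2 * D.sideLength k < 3 * D.sideLength k))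
  have h1 := dist_le_sideLength D hP hy hp
  have h2 := dist_le_sideLength D hQ (center_mem_cube D hQ) hx
  have h3 := dist_triangle4 y p (D.center k Q) x
  rw [dist_comm p] at h3
  rw [mem_closedBall]
  linarith

/-- The region `R₀` covers the part of the support in `B₀`, since small cubes that meet `B₀` are
admissible. -/
lemma support_inter_closedBall_subset_region (x₀ : Euc n) {r₀ : ℝ} (hr₀ : 0 < r₀) :
    μ.support ∩ closedBall x₀ r₀ ⊆ D.region x₀ r₀ := by
  classical
  rintro x ⟨hxs, hx⟩
  have hex : ∃ k, ∃ Q ∈ D.cubes k, x ∈ Q ∧ D.dilate 2 k Q ⊆ closedBall x₀ (3 / 2 * r₀) := by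
    have hA : 1 < D.A₀ := by
      have := D.one_lt_C₀
      have := D.lt_A₀
      linarith
    have hC : 0 < D.C₀ := by linarith [D.one_lt_C₀]
    obtain ⟨k, hk⟩ := exists_pow_lt_of_lt_one
      (show 0 < r₀ / (560 * D.C₀) by positivity) (inv_lt_one_of_one_lt₀ hA)
    have hxk : x ∈ ⋃₀ D.cubes k := by rwa [D.sUnion_cubes]
    obtain ⟨Q, hQ, hxQ⟩ := hxk
    refine ⟨k, Q, hQ, hxQ, (dilate_subset_closedBall D hQ hxQ).trans
      (closedBall_subset_closedBall' ?_)⟩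
    rw [inv_pow, lt_div_iff₀ (by positivity)] at hk
    rw [mem_closedBall] at hx
    unfold DavidMattilaLattice.sideLength
    linarith
  -- the cube of the first possible generation is maximal, by nestedness
  obtain ⟨Q, hQ, hxQ, hQd⟩ := Nat.find_spec hex
  refine ⟨Q, ⟨⟨_, hQ, hQd, x, hxQ, hx⟩, ?_⟩, hxQ⟩
  rintro P ⟨l, hP, hPd, -⟩ hle
  have hxP : x ∈ P := hle hxQ
  have hl : Nat.find hex ≤ l := Nat.find_min' hex ⟨P, hP, hxP, hPd⟩
  rcases hl.lt_or_eq with h | h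
  · rcases D.nested _ _ h P hP Q hQ with hd | hd
    · exact absurd hxQ (disjoint_left.1 hd hxP)
    · exact hd
  · subst h
    have : P = Q := by
      by_contra hne
      exact disjoint_left.1 (D.pairwiseDisjoint _ hP hQ hne) hxP hxQ
    exact this.le

lemma measure_closedBall_le_region (x₀ : Euc n) {r₀ : ℝ} (hr₀ : 0 < r₀) :
    μ (closedBall x₀ r₀) ≤ μ (D.region x₀ r₀) := by
  have h : closedBall x₀ r₀ ⊆ D.region x₀ r₀ ∪ μ.supportᶜ := fun x hx => by
    by_cases hxs : x ∈ μ.support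
    · exact Or.inl (support_inter_closedBall_subset_region D x₀ hr₀ ⟨hxs, hx⟩)
    · exact Or.inr hxs
  refine (measure_mono h).trans ((measure_union_le _ _).trans (le_of_eq ?_))
  have : μ μ.supportᶜ = 0 := Measure.support_mem_ae
  rw [this, add_zero]

end

/-! ### Densities -/

/-- A density that is bounded `μ`-almost everywhere is bounded almost everywhere with respect to
Lebesgue measure, since `μ` charges the set where it is positive. -/
lemma le_smul_of_withDensity {μ : Measure (Euc n)} {s : Set (Euc n)} {h : Euc n → ℝ≥0}
    (hm : Measurable h) {M : ℝ≥0} (hM : ∀ᵐ x ∂μ, h x ≤ M)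
    (hμ : μ.restrict s = (volume.restrict s).withDensity (fun x => (h x : ℝ≥0∞))) :
    μ.restrict s ≤ M • volume := by
  have h1 : ∀ᵐ x ∂μ.restrict s, h x ≤ M := ae_restrict_of_ae hM
  rw [hμ, ae_withDensity_iff (by fun_prop)] at h1
  have h2 : (fun x => (h x : ℝ≥0∞)) ≤ᵐ[volume.restrict s] fun _ => (M : ℝ≥0∞) := by
    filter_upwards [h1] with x hx
    by_cases h0 : h x = 0
    · simp [h0]
    · exact ENNReal.coe_le_coe.2 (hx (by simpa using h0))
  rw [hμ]
  refine (withDensity_mono h2).trans ?_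
  rw [withDensity_const]
  refine Measure.le_iff.2 fun t ht => ?_
  simp only [Measure.smul_apply, smul_eq_mul, ENNReal.smul_def]
  gcongr
  exact Measure.restrict_le_self

lemma ballDensity_ne_top {μ : Measure (Euc n)} [IsLocallyFiniteMeasure μ] (x : Euc n) {r : ℝ}
    (hr : 0 < r) : ballDensity μ x r ≠ ⊤ :=
  ENNReal.div_ne_top measure_closedBall_lt_top.ne
    (pow_ne_zero _ (ENNReal.ofReal_pos.2 hr).ne')

lemma toReal_ballDensity {μ : Measure (Euc n)} (x : Euc n) {r : ℝ} (hr : 0 < r) :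
    (ballDensity μ x r).toReal = μ.real (closedBall x r) / r ^ n := by
  rw [ballDensity, ENNReal.toReal_div, ENNReal.toReal_pow, ENNReal.toReal_ofReal hr.le,
    Measure.real]

lemma measure_real_two_mul_le {μ : Measure (Euc n)} [IsLocallyFiniteMeasure μ] {x : Euc n}
    {r C : ℝ} (hr : 0 < r) (hC : 0 < C) (h : IsPDoubling μ C x r) :
    μ.real (closedBall x (2 * r)) ≤ 2 ^ (n + 1) * C * μ.real (closedBall x r) := by
  have h1 : (2 ^ 1 : ℝ≥0∞)⁻¹ * ballDensity μ x (2 ^ 1 * r) ≤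
      ENNReal.ofReal C * ballDensity μ x r :=
    (ENNReal.le_tsum (f := fun j : ℕ => (2 ^ j : ℝ≥0∞)⁻¹ * ballDensity μ x (2 ^ j * r)) 1).trans h
  have h2 := ENNReal.toReal_mono (ENNReal.mul_ne_top ENNReal.ofReal_ne_top
    (ballDensity_ne_top x hr)) h1
  simp only [pow_one, ENNReal.toReal_mul, ENNReal.toReal_inv, ENNReal.toReal_ofNat,
    ENNReal.toReal_ofReal hC.le, toReal_ballDensity x hr,
    toReal_ballDensity x (by positivity : 0 < 2 * r)] at h2
  rw [← mul_div_assoc, ← mul_div_assoc, div_le_div_iff₀ (by positivity) (by positivity),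
    mul_pow] at h2
  have hrn : 0 < r ^ n := by positivity
  refine le_of_mul_le_mul_right ?_ hrn
  rw [pow_succ]
  linarith

/-- The tail of the Riesz kernel is controlled by the Poisson density. -/
lemma lintegral_tail_le (μ : Measure (Euc n)) (x : Euc n) {r : ℝ} (hr : 0 < r) :
    ∫⁻ y in (closedBall x (2 * r))ᶜ, ENNReal.ofReal (r / dist y x ^ (n + 1)) ∂μ ≤
      2 ^ (n + 1) * poissonDensity μ x r := by
  have hpt : ∀ y ∈ (closedBall x (2 * r))ᶜ, ENNReal.ofReal (r / dist y x ^ (n + 1)) ≤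
      ∑' j : ℕ, (closedBall x (2 ^ j * r)).indicator
        (fun _ => 2 ^ (n + 1) * ((2 ^ j : ℝ≥0∞)⁻¹ * (ENNReal.ofReal (2 ^ j * r) ^ n)⁻¹)) y := by
    intro y hy
    rw [mem_compl_iff, mem_closedBall, not_le] at hy
    have hd : 0 < dist y x := by linarith
    obtain ⟨j, hj1, hj2⟩ := exists_nat_pow_near (x := dist y x / r) (y := 2)
      (by rw [le_div_iff₀ hr]; linarith) (by norm_num)
    rw [le_div_iff₀ hr] at hj1
    rw [div_lt_iff₀ hr] at hj2
    refine le_trans ?_ (ENNReal.le_tsum (j + 1))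
    rw [indicator_of_mem (mem_closedBall.2 hj2.le)]
    have e : (2 : ℝ≥0∞) ^ (n + 1) * (((2 : ℝ≥0∞) ^ (j + 1))⁻¹ *
        (ENNReal.ofReal (2 ^ (j + 1) * r) ^ n)⁻¹) =
        ENNReal.ofReal (2 ^ (n + 1) * ((2 ^ (j + 1))⁻¹ * ((2 ^ (j + 1) * r) ^ n)⁻¹)) := by
      conv_rhs => rw [ENNReal.ofReal_mul (by positivity), ENNReal.ofReal_mul (by positivity),
        ENNReal.ofReal_inv_of_pos (by positivity), ENNReal.ofReal_inv_of_pos (by positivity),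
        ENNReal.ofReal_pow (by positivity), ENNReal.ofReal_pow (by positivity),
        ENNReal.ofReal_pow (by positivity), ENNReal.ofReal_ofNat]
    rw [e]
    refine ENNReal.ofReal_le_ofReal ?_
    calc r / dist y x ^ (n + 1) ≤ r / (2 ^ j * r) ^ (n + 1) := by gcongr
      _ = _ := by
        rw [mul_pow, mul_pow, pow_succ r, pow_succ 2 j, mul_pow, pow_succ (2 ^ j), pow_succ 2 n]
        field_simp
  calc _ ≤ ∫⁻ y in (closedBall x (2 * r))ᶜ, ∑' j : ℕ, (closedBall x (2 ^ j * r)).indicator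
        (fun _ => 2 ^ (n + 1) * ((2 ^ j : ℝ≥0∞)⁻¹ * (ENNReal.ofReal (2 ^ j * r) ^ n)⁻¹)) y ∂μ :=
        setLIntegral_mono' measurableSet_closedBall.compl hpt
    _ ≤ ∫⁻ y, ∑' j : ℕ, (closedBall x (2 ^ j * r)).indicator
        (fun _ => 2 ^ (n + 1) * ((2 ^ j : ℝ≥0∞)⁻¹ * (ENNReal.ofReal (2 ^ j * r) ^ n)⁻¹)) y ∂μ :=
        setLIntegral_le_lintegral _ _
    _ = _ := by
        rw [lintegral_tsum fun j => (measurable_const.indicator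
          measurableSet_closedBall).aemeasurable, poissonDensity, ← ENNReal.tsum_mul_left]
        refine tsum_congr fun j => ?_
        rw [lintegral_indicator_const measurableSet_closedBall, ballDensity, ENNReal.div_eq_inv_mul]
        ring

/-! ### The field of the mass outside the region -/

lemma wflux_const (v x : Euc n) (r : ℝ) : wflux (fun _ => v) x r = 0 := by
  have h := integral_neg_eq_self (fun w : Euc n => bump 3 w * ⟪w, v⟫) volume
  simp only [bump_neg, inner_neg_left, mul_neg, integral_neg] at h
  unfold wflux
  linarith

lemma measurable_uncurry_rieszKernel :
    Measurable fun p : Euc n × Euc n => rieszKernel (p.1 - p.2) :=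
  measurable_rieszKernel.comp (measurable_fst.sub measurable_snd)

lemma IsExternalField.congr {H H' : Euc n → Euc n} {x₁ : Euc n} {R : ℝ}
    (hE : IsExternalField H x₁ R) (h : EqOn H' H (ball x₁ R)) : IsExternalField H' x₁ R where
  continuousOn := hE.continuousOn.congr h
  wmean_eq x r hr hsub := by
    rw [h (hsub (mem_closedBall_self hr.le)), ← hE.wmean_eq x r hr hsub]
    exact wmean_congr hr.le (h.mono hsub)
  wflux_eq r hr hrR := by
    rw [← hE.wflux_eq r hr hrR]
    unfold wflux
    congr 1
    ext w
    by_cases hw : bump 3 w = 0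
    · simp [hw]
    · rw [h (closedBall_subset_ball hrR (add_smul_mem_closedBall hr.le
        (norm_lt_one_of_bump_ne_zero (by norm_num) hw).le))]

lemma IsExternalField.add {H H' : Euc n → Euc n} {x₁ : Euc n} {R : ℝ}
    (hE : IsExternalField H x₁ R) (hE' : IsExternalField H' x₁ R) :
    IsExternalField (fun x => H x + H' x) x₁ R where
  continuousOn := hE.continuousOn.add hE'.continuousOn
  wmean_eq x r hr hsub := by
    rw [wmean_add hr.le (hE.continuousOn.mono hsub) (hE'.continuousOn.mono hsub),
      hE.wmean_eq x r hr hsub, hE'.wmean_eq x r hr hsub, smul_add]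
  wflux_eq r hr hrR := by
    have hc : ∀ {u : Euc n → Euc n}, IsExternalField u x₁ R →
        Integrable (fun w => bump 3 w * ⟪w, u (x₁ + r • w)⟫) := fun hu =>
      integrable_bump_smul (by norm_num) (ContinuousOn.inner (𝕜 := ℝ) continuousOn_id
        (continuousOn_comp_add_smul hr.le (hu.continuousOn.mono (closedBall_subset_ball hrR))))
    have : wflux (fun x => H x + H' x) x₁ r = wflux H x₁ r + wflux H' x₁ r := by
      unfold wflux
      rw [← integral_add (hc hE) (hc hE')]
      simp only [inner_add_right, mul_add]
    rw [this, hE.wflux_eq r hr hrR, hE'.wflux_eq r hr hrR, add_zero]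

lemma isExternalField_const (v x₁ : Euc n) (R : ℝ) : IsExternalField (fun _ => v) x₁ R where
  continuousOn := continuousOn_const
  wmean_eq x r _ _ := by simp [wmean, wmass, integral_smul_const]
  wflux_eq r _ _ := wflux_const v x₁ r

/-- The field generated by a measure `ν` without mass in a ball, renormalized by subtracting
the constants `k y`, is an external field there. -/
lemma isExternalField_integral (hn : 1 ≤ n) {ν : Measure (Euc n)} [SFinite ν] {x₁ : Euc n} {R : ℝ}
    (k : Euc n → Euc n) (hν : ∀ᵐ y ∂ν, y ∉ ball x₁ R)
    (hcont : ContinuousOn (fun x => ∫ y, (rieszKernel (x - y) - k y) ∂ν) (ball x₁ R))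
    (hi : ∀ x ∈ ball x₁ R, Integrable (fun y => rieszKernel (x - y) - k y) ν)
    (hint : ∀ x r, 0 < r → closedBall x r ⊆ ball x₁ R →
      Integrable (fun p : Euc n × Euc n => bump 3 p.1 • (rieszKernel (x + r • p.1 - p.2) - k p.2))
        ((volume : Measure (Euc n)).prod ν)) :
    IsExternalField (fun x => ∫ y, (rieszKernel (x - y) - k y) ∂ν) x₁ R where
  continuousOn := hcont
  wmean_eq x r hr hsub := by
    rw [wmean_integral (Q := fun x y => rieszKernel (x - y) - k y) (hint x r hr hsub),
      ← integral_smul]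
    refine integral_congr_ae ?_
    filter_upwards [hν] with y hy
    have hy' : y ∉ closedBall x r := fun h => hy (hsub h)
    have hxy : r < dist x y := by rwa [mem_closedBall, dist_comm, not_le] at hy'
    have h1 := wmean_add (v := fun _ => -k y) hr.le (continuousOn_rieszKernel_sub y hy')
      continuousOn_const
    rw [wmean_rieszKernel hr.le hxy] at h1
    simp only [← sub_eq_add_neg] at h1
    rw [h1, smul_sub, sub_eq_add_neg (wmass n • rieszKernel (x - y)), ← smul_neg]
    congr 1
    simp only [wmean, wmass, integral_smul_const]
  wflux_eq r hr hrR := by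
    have hsub := closedBall_subset_ball (x := x₁) hrR
    have e1 : wflux (fun x => ∫ y, (rieszKernel (x - y) - k y) ∂ν) x₁ r =
        ∫ w, ∫ y, bump 3 w * ⟪w, rieszKernel (x₁ + r • w - y) - k y⟫ ∂ν := by
      unfold wflux
      congr 1
      ext w
      by_cases hw : bump 3 w = 0
      · simp [hw]
      · rw [integral_const_mul, integral_inner (hi _ (hsub (add_smul_mem_closedBall hr.le
          (norm_lt_one_of_bump_ne_zero (by norm_num) hw).le)))]
    have hp : Integrable (fun p : Euc n × Euc n =>
        bump 3 p.1 * ⟪p.1, rieszKernel (x₁ + r • p.1 - p.2) - k p.2⟫)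
        ((volume : Measure (Euc n)).prod ν) := by
      have h0 := hint x₁ r hr hsub
      have hm : AEStronglyMeasurable (fun p : Euc n × Euc n => p.1)
          ((volume : Measure (Euc n)).prod ν) := measurable_fst.aestronglyMeasurable
      have h1 : Integrable (fun p : Euc n × Euc n =>
          ⟪p.1, bump 3 p.1 • (rieszKernel (x₁ + r • p.1 - p.2) - k p.2)⟫)
          ((volume : Measure (Euc n)).prod ν) := by
        refine h0.mono (hm.inner h0.aestronglyMeasurable) (Eventually.of_forall fun p => ?_)
        by_cases hw : bump 3 p.1 = 0
        · simp [hw]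
        · exact (norm_inner_le_norm _ _).trans (mul_le_of_le_one_left (norm_nonneg _)
            (norm_lt_one_of_bump_ne_zero (by norm_num) hw).le)
      simpa only [inner_smul_right] using h1
    rw [e1, integral_integral_swap hp]
    refine integral_eq_zero_of_ae ?_
    filter_upwards [hν] with y hy
    have hy' : y ∉ closedBall x₁ r := fun h => hy (hsub h)
    have hb : bump 4 (r⁻¹ • (y - x₁)) = 0 := by
      refine bump_eq_zero (by norm_num) ?_
      rw [mem_closedBall, not_le, dist_eq_norm] at hy'
      rw [norm_smul, norm_inv, Real.norm_of_nonneg hr.le, le_inv_mul_iff₀ hr, mul_one]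
      exact hy'.le
    have h1 := wflux_rieszKernel hn x₁ y hr
    rw [hb, mul_zero] at h1
    have h2 := wflux_const (k y) x₁ r
    unfold wflux at h1 h2
    have i1 : Integrable (fun w => bump 3 w * ⟪w, rieszKernel (x₁ + r • w - y)⟫) :=
      integrable_bump_smul (by norm_num) (ContinuousOn.inner (𝕜 := ℝ) continuousOn_id
        (continuousOn_comp_add_smul hr.le (continuousOn_rieszKernel_sub y hy')))
    have i2 : Integrable (fun w => bump 3 w * ⟪w, k y⟫) :=
      integrable_bump_smul (by norm_num) (ContinuousOn.inner (𝕜 := ℝ) continuousOn_id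
        continuousOn_const)
    simp only [inner_sub_right, mul_sub, Pi.zero_apply]
    rw [integral_sub i1 i2, h1, h2, sub_zero]

lemma isExternalField_near (hn : 1 ≤ n) {ν : Measure (Euc n)} [IsFiniteMeasure ν] {M : ℝ≥0}
    (hM : ν ≤ M • volume) {x₁ : Euc n} {R : ℝ} (hν : ∀ᵐ y ∂ν, y ∉ ball x₁ R) :
    IsExternalField (fun x => ∫ y, rieszKernel (x - y) ∂ν) x₁ R := by
  have h := isExternalField_integral hn (fun _ => 0) hν
    (by simpa using (continuous_integral_rieszKernel hn hM).continuousOn)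
    (fun x _ => by simpa using integrable_rieszKernel hn hM x)
    (fun x r hr _ => by
      simpa using integrable_prod_of_weaklySingular (ν := ν) (x := x)
        (Q := fun x y => rieszKernel (x - y)) (s := n) (C := 1)
        measurable_uncurry_rieszKernel.stronglyMeasurable hr zero_le_one (by positivity)
        (by linarith) fun x y => norm_rieszKernel_sub_le_rpow hn x y)
  simpa using h

section

variable {μ : Measure (Euc n)} {x₀ : Euc n} {r₀ : ℝ}

/-- The field of the mass outside `2 B₀`, normalized to vanish at the center `x₀`. -/
def farField (μ : Measure (Euc n)) (x₀ : Euc n) (r₀ : ℝ) (x : Euc n) : Euc n :=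
  ∫ y in (closedBall x₀ (2 * r₀))ᶜ, (rieszKernel (x - y) - rieszKernel (x₀ - y)) ∂μ

/-- The field of the mass in `2 B₀` that lies outside `S`. -/
def nearField (μ : Measure (Euc n)) (S : Set (Euc n)) (x₀ : Euc n) (r₀ : ℝ) (x : Euc n) : Euc n :=
  ∫ y in closedBall x₀ (2 * r₀) \ S, rieszKernel (x - y) ∂μ

lemma norm_rieszKernel_sub_center_le (hr₀ : 0 < r₀) {x y : Euc n}
    (hx : x ∈ closedBall x₀ (7 / 4 * r₀)) (hy : y ∈ (closedBall x₀ (2 * r₀))ᶜ) :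
    ‖rieszKernel (x - y) - rieszKernel (x₀ - y)‖ ≤
      2 * (n + 2) * 8 ^ (n + 1) * (r₀ / dist y x₀ ^ (n + 1)) := by
  rw [mem_compl_iff, mem_closedBall, not_le] at hy
  rw [mem_closedBall] at hx
  have hd : 0 < dist y x₀ := by linarith
  have h1 : dist y x₀ / 8 ≤ ‖x - y‖ := by
    have := dist_triangle y x x₀
    rw [← dist_eq_norm, dist_comm x y]
    linarith
  have h2 : dist y x₀ / 8 ≤ ‖x₀ - y‖ := by
    rw [← dist_eq_norm, dist_comm x₀ y]
    linarith
  refine (norm_rieszKernel_sub_le (by positivity) h1 h2).trans ?_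
  rw [sub_sub_sub_cancel_right, ← dist_eq_norm]
  calc _ ≤ (n + 2) * (2 * r₀) * ((dist y x₀ / 8) ^ (n + 1))⁻¹ := by gcongr; linarith
    _ = _ := by rw [div_pow]; field_simp

variable [IsLocallyFiniteMeasure μ] {C : ℝ}

lemma integrableOn_tail (hr₀ : 0 < r₀) (hP : IsPDoubling μ C x₀ r₀) :
    IntegrableOn (fun y => r₀ / dist y x₀ ^ (n + 1)) (closedBall x₀ (2 * r₀))ᶜ μ := by
  refine ⟨Measurable.aestronglyMeasurable (by fun_prop), ?_⟩
  rw [hasFiniteIntegral_iff_ofReal (Eventually.of_forall fun y => by positivity)]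
  refine lt_of_le_of_lt ((lintegral_tail_le μ x₀ hr₀).trans (mul_le_mul_right hP _)) ?_
  exact ENNReal.mul_lt_top (by finiteness) (ENNReal.mul_lt_top ENNReal.ofReal_lt_top
    (ballDensity_ne_top x₀ hr₀).lt_top)

lemma setIntegral_tail_le (hr₀ : 0 < r₀) (hC : 0 < C) (hP : IsPDoubling μ C x₀ r₀) :
    ∫ y in (closedBall x₀ (2 * r₀))ᶜ, r₀ / dist y x₀ ^ (n + 1) ∂μ ≤
      2 ^ (n + 1) * C * (μ.real (closedBall x₀ r₀) / r₀ ^ n) := by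
  rw [integral_eq_lintegral_of_nonneg_ae (Eventually.of_forall fun y => by positivity)
    (Measurable.aestronglyMeasurable (by fun_prop))]
  refine (ENNReal.toReal_mono ?_
    ((lintegral_tail_le μ x₀ hr₀).trans (mul_le_mul_right hP _))).trans (le_of_eq ?_)
  · exact ENNReal.mul_ne_top (by finiteness) (ENNReal.mul_ne_top ENNReal.ofReal_ne_top
      (ballDensity_ne_top x₀ hr₀))
  · rw [ENNReal.toReal_mul, ENNReal.toReal_mul, toReal_ballDensity x₀ hr₀,
      ENNReal.toReal_ofReal hC.le, ENNReal.toReal_pow, ENNReal.toReal_ofNat, mul_assoc]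

lemma integrableOn_rieszKernel_sub_center (hr₀ : 0 < r₀) (hP : IsPDoubling μ C x₀ r₀) {x : Euc n}
    (hx : x ∈ closedBall x₀ (7 / 4 * r₀)) :
    IntegrableOn (fun y => rieszKernel (x - y) - rieszKernel (x₀ - y))
      (closedBall x₀ (2 * r₀))ᶜ μ := by
  refine ((integrableOn_tail hr₀ hP).const_mul (2 * (n + 2) * 8 ^ (n + 1))).mono'
    (Measurable.aestronglyMeasurable ((measurable_rieszKernel.comp (by fun_prop)).sub
      (measurable_rieszKernel.comp (by fun_prop)))) ?_
  filter_upwards [ae_restrict_mem measurableSet_closedBall.compl] with y hy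
  exact norm_rieszKernel_sub_center_le hr₀ hx hy

lemma norm_farField_le (hr₀ : 0 < r₀) (hC : 0 < C) (hP : IsPDoubling μ C x₀ r₀) {x : Euc n}
    (hx : x ∈ closedBall x₀ (7 / 4 * r₀)) :
    ‖farField μ x₀ r₀ x‖ ≤
      2 * (n + 2) * 16 ^ (n + 1) * C * (μ.real (closedBall x₀ r₀) / r₀ ^ n) := by
  have h1 : ‖farField μ x₀ r₀ x‖ ≤ ∫ y in (closedBall x₀ (2 * r₀))ᶜ,
      2 * (n + 2) * 8 ^ (n + 1) * (r₀ / dist y x₀ ^ (n + 1)) ∂μ := by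
    refine norm_integral_le_of_norm_le ((integrableOn_tail hr₀ hP).const_mul _) ?_
    filter_upwards [ae_restrict_mem measurableSet_closedBall.compl] with y hy
    exact norm_rieszKernel_sub_center_le hr₀ hx hy
  refine h1.trans ?_
  rw [integral_const_mul]
  refine (mul_le_mul_of_nonneg_left (setIntegral_tail_le hr₀ hC hP) (by positivity)).trans
    (le_of_eq ?_)
  rw [show (16 : ℝ) = 8 * 2 by norm_num, mul_pow 8 2]
  ring

lemma continuousOn_farField (hr₀ : 0 < r₀) (hP : IsPDoubling μ C x₀ r₀) :
    ContinuousOn (farField μ x₀ r₀) (closedBall x₀ (7 / 4 * r₀)) := by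
  refine continuousOn_of_dominated (bound := fun y =>
    2 * (n + 2) * 8 ^ (n + 1) * (r₀ / dist y x₀ ^ (n + 1)))
    (fun x hx => (integrableOn_rieszKernel_sub_center hr₀ hP hx).aestronglyMeasurable)
    (fun x hx => ?_) ((integrableOn_tail hr₀ hP).const_mul _) ?_
  · filter_upwards [ae_restrict_mem measurableSet_closedBall.compl] with y hy
    exact norm_rieszKernel_sub_center_le hr₀ hx hy
  · filter_upwards [ae_restrict_mem measurableSet_closedBall.compl] with y hy
    refine (continuousOn_rieszKernel_sub y fun h => hy ?_).sub continuousOn_const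
    exact closedBall_subset_closedBall (by linarith) h

lemma isExternalField_farField (hn : 1 ≤ n) (hr₀ : 0 < r₀) (hP : IsPDoubling μ C x₀ r₀)
    {x₁ : Euc n} {R : ℝ} (hsub : ball x₁ R ⊆ closedBall x₀ (7 / 4 * r₀)) :
    IsExternalField (farField μ x₀ r₀) x₁ R := by
  refine isExternalField_integral hn (fun y => rieszKernel (x₀ - y)) ?_
    ((continuousOn_farField hr₀ hP).mono hsub)
    (fun x hx => integrableOn_rieszKernel_sub_center hr₀ hP (hsub hx)) fun x r hr hxr => ?_
  · filter_upwards [ae_restrict_mem measurableSet_closedBall.compl] with y hy h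
    exact hy (closedBall_subset_closedBall (by linarith) (hsub h))
  · refine integrable_prod_of_dominated (Q := fun x y => rieszKernel (x - y) - rieszKernel (x₀ - y))
      (measurable_uncurry_rieszKernel.sub
        (measurable_rieszKernel.comp (by fun_prop))).stronglyMeasurable hr.le
      ((integrableOn_tail hr₀ hP).const_mul (2 * (n + 2) * 8 ^ (n + 1))) ?_
    filter_upwards [ae_restrict_mem measurableSet_closedBall.compl] with y hy z hz
    exact norm_rieszKernel_sub_center_le hr₀ (hsub (hxr hz)) hy

/-- The kernel is antisymmetric. -/
lemma setIntegral_integral_rieszKernel_self (hn : 1 ≤ n) {σ : Measure (Euc n)} [IsFiniteMeasure σ]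
    {M : ℝ≥0} (hσ : σ ≤ M • volume) : ∫ x, ∫ y, rieszKernel (x - y) ∂σ ∂σ = 0 := by
  have hi : Integrable (fun p : Euc n × Euc n => rieszKernel (p.1 - p.2)) (σ.prod σ) := by
    refine (integrable_prod_rpow (σ₂ := σ) (s := n) hσ (by positivity) (by linarith)).mono'
      measurable_uncurry_rieszKernel.aestronglyMeasurable (Eventually.of_forall fun p => ?_)
    rw [norm_rieszKernel_rpow _ hn]
  have h := integral_integral_swap (f := fun x y => rieszKernel (x - y)) hi
  have h2 : ∫ y, ∫ x, rieszKernel (x - y) ∂σ ∂σ = -∫ y, ∫ x, rieszKernel (y - x) ∂σ ∂σ := by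
    rw [← integral_neg]
    simp only [← integral_neg, ← rieszKernel_neg, neg_sub]
  rw [h2] at h
  have h3 := add_eq_zero_iff_eq_neg.2 h
  rw [← two_smul ℝ] at h3
  exact (smul_eq_zero.1 h3).resolve_left two_ne_zero

end

/-! ### The oscillation of the Riesz transform as a field -/

lemma restrict_le_smul_of_subset {μ : Measure (Euc n)} {M : ℝ≥0} {S N : Set (Euc n)}
    (hM : μ.restrict N ≤ M • volume) (hSN : S ⊆ N) : μ.restrict S ≤ M • volume :=
  (Measure.restrict_mono hSN le_rfl).trans hM

section

variable {μ : Measure (Euc n)} [IsLocallyFiniteMeasure μ] {x₀ : Euc n} {r₀ C : ℝ}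
  {S : Set (Euc n)} {M : ℝ≥0}

/-- The field of the mass outside `S`, up to an additive constant. -/
def outerField (μ : Measure (Euc n)) (S : Set (Euc n)) (x₀ : Euc n) (r₀ : ℝ) (x : Euc n) :
    Euc n := nearField μ S x₀ r₀ x + farField μ x₀ r₀ x

lemma isFiniteMeasure_restrict (hSN : S ⊆ closedBall x₀ (2 * r₀)) :
    IsFiniteMeasure (μ.restrict S) :=
  ⟨by rw [Measure.restrict_apply_univ]
      exact (measure_mono hSN).trans_lt measure_closedBall_lt_top⟩

/-- The difference of two values of the Riesz transform, split into the contributions of `S`, of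
`2 B₀ \ S` and of the complement of `2 B₀`; only the last one needs the difference of kernels to
converge. -/
lemma integral_rieszKernel_sub_eq (hn : 1 ≤ n) (hr₀ : 0 < r₀) (hP : IsPDoubling μ C x₀ r₀)
    (hS : MeasurableSet S) (hSN : S ⊆ closedBall x₀ (2 * r₀))
    (hM : μ.restrict (closedBall x₀ (2 * r₀)) ≤ M • volume) {x z : Euc n}
    (hx : x ∈ closedBall x₀ (7 / 4 * r₀)) (hz : z ∈ closedBall x₀ (7 / 4 * r₀)) :
    ∫ y, (rieszKernel (x - y) - rieszKernel (z - y)) ∂μ =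
      ((∫ y in S, rieszKernel (x - y) ∂μ) + outerField μ S x₀ r₀ x) -
        ((∫ y in S, rieszKernel (z - y) ∂μ) + outerField μ S x₀ r₀ z) := by
  have : IsFiniteMeasure (μ.restrict (closedBall x₀ (2 * r₀))) := isFiniteMeasure_restrict le_rfl
  have hNm : MeasurableSet (closedBall x₀ (2 * r₀)) := measurableSet_closedBall
  have i1 : ∀ x : Euc n, IntegrableOn (fun y => rieszKernel (x - y)) (closedBall x₀ (2 * r₀)) μ :=
    fun x => integrable_rieszKernel hn hM x
  have i2 := fun {x : Euc n} (hx : x ∈ closedBall x₀ (7 / 4 * r₀)) =>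
    integrableOn_rieszKernel_sub_center hr₀ hP hx
  have i3 : IntegrableOn (fun y => rieszKernel (x - y) - rieszKernel (z - y))
      (closedBall x₀ (2 * r₀))ᶜ μ := by
    refine ((i2 hx).sub (i2 hz)).congr (Eventually.of_forall fun y => ?_)
    exact sub_sub_sub_cancel_right _ _ _
  have i4 : IntegrableOn (fun y => rieszKernel (x - y) - rieszKernel (z - y))
      (closedBall x₀ (2 * r₀)) μ := (i1 x).sub (i1 z)
  have hint : Integrable (fun y => rieszKernel (x - y) - rieszKernel (z - y)) μ := by
    rw [← integrableOn_univ, ← union_compl_self (closedBall x₀ (2 * r₀))]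
    exact i4.union i3
  have e1 : ∀ x : Euc n, ∫ y in closedBall x₀ (2 * r₀), rieszKernel (x - y) ∂μ =
      (∫ y in S, rieszKernel (x - y) ∂μ) + nearField μ S x₀ r₀ x := fun x => by
    rw [← integral_inter_add_sdiff hS (i1 x), inter_eq_self_of_subset_right hSN, nearField]
  have e2 : ∫ y in (closedBall x₀ (2 * r₀))ᶜ, (rieszKernel (x - y) - rieszKernel (z - y)) ∂μ =
      farField μ x₀ r₀ x - farField μ x₀ r₀ z := by
    rw [farField, farField, ← integral_sub (i2 hx) (i2 hz)]
    simp only [sub_sub_sub_cancel_right]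
  rw [← integral_add_compl hNm hint, integral_sub (i1 x) (i1 z), e1, e1, e2, outerField, outerField]
  abel

lemma continuousOn_outerField (hn : 1 ≤ n) (hr₀ : 0 < r₀) (hP : IsPDoubling μ C x₀ r₀)
    (hM : μ.restrict (closedBall x₀ (2 * r₀)) ≤ M • volume) :
    ContinuousOn (outerField μ S x₀ r₀) (closedBall x₀ (7 / 4 * r₀)) := by
  have : IsFiniteMeasure (μ.restrict (closedBall x₀ (2 * r₀) \ S)) :=
    isFiniteMeasure_restrict sdiff_subset
  exact (continuous_integral_rieszKernel hn
    (restrict_le_smul_of_subset hM sdiff_subset)).continuousOn.add (continuousOn_farField hr₀ hP)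

lemma integrableOn_outerField (hn : 1 ≤ n) (hr₀ : 0 < r₀) (hP : IsPDoubling μ C x₀ r₀)
    (hSX : S ⊆ closedBall x₀ (7 / 4 * r₀))
    (hM : μ.restrict (closedBall x₀ (2 * r₀)) ≤ M • volume) :
    IntegrableOn (outerField μ S x₀ r₀) S μ :=
  ((continuousOn_outerField hn hr₀ hP hM).integrableOn_compact
    (isCompact_closedBall _ _)).mono_set hSX

/-- The self-interaction of `S` has mean zero by antisymmetry of the kernel, so the oscillation
of the Riesz transform only involves the mean of the outer field. -/
lemma rieszOscillation_eq_add_sub (hn : 1 ≤ n) (hr₀ : 0 < r₀) (hP : IsPDoubling μ C x₀ r₀)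
    (hS : MeasurableSet S) (hSX : S ⊆ closedBall x₀ (7 / 4 * r₀)) (hS0 : μ S ≠ 0)
    (hM : μ.restrict (closedBall x₀ (2 * r₀)) ≤ M • volume) {x : Euc n}
    (hx : x ∈ closedBall x₀ (7 / 4 * r₀)) :
    rieszOscillation μ S x = (∫ y in S, rieszKernel (x - y) ∂μ) +
      (outerField μ S x₀ r₀ x - ⨍ z in S, outerField μ S x₀ r₀ z ∂μ) := by
  have hSN : S ⊆ closedBall x₀ (2 * r₀) :=
    hSX.trans (closedBall_subset_closedBall (by linarith))
  have hfin : IsFiniteMeasure (μ.restrict S) := isFiniteMeasure_restrict hSN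
  have hσ := restrict_le_smul_of_subset hM hSN
  have hr : μ.real S ≠ 0 := by
    rw [Measure.real, ENNReal.toReal_ne_zero]
    exact ⟨hS0, ((measure_mono hSN).trans_lt measure_closedBall_lt_top).ne⟩
  have i1 : IntegrableOn (fun z => ∫ y in S, rieszKernel (z - y) ∂μ) S μ :=
    Integrable.of_bound (continuous_integral_rieszKernel hn hσ).aestronglyMeasurable _
      (Eventually.of_forall (norm_integral_rieszKernel_le hn hσ))
  have i2 := integrableOn_outerField hn hr₀ hP hSX hM
  have e : (fun z => ∫ y, (rieszKernel (x - y) - rieszKernel (z - y)) ∂μ) =ᵐ[μ.restrict S]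
      fun z => ((∫ y in S, rieszKernel (x - y) ∂μ) + outerField μ S x₀ r₀ x) -
        ((∫ y in S, rieszKernel (z - y) ∂μ) + outerField μ S x₀ r₀ z) := by
    filter_upwards [ae_restrict_mem hS] with z hz
    exact integral_rieszKernel_sub_eq hn hr₀ hP hS hSN hM hx (hSX hz)
  have i12 : IntegrableOn (fun z => (∫ y in S, rieszKernel (z - y) ∂μ) + outerField μ S x₀ r₀ z)
      S μ := i1.add i2
  have h0 := setIntegral_integral_rieszKernel_self hn hσ
  rw [rieszOscillation, average_congr e, setAverage_eq, setAverage_eq,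
    integral_sub (integrable_const _) i12, integral_add i1 i2, h0, zero_add, setIntegral_const,
    smul_sub, smul_smul, inv_mul_cancel₀ hr, one_smul, add_sub_assoc]

/-- The interaction between `S` and its complement in `2 B₀` controls the mean of the near
field. -/
lemma norm_setIntegral_nearField_le (hn : 1 ≤ n) (hr₀ : 0 < r₀) {τ : ℝ} (hτ : 0 < τ)
    (hint : ∫⁻ y in closedBall x₀ (2 * r₀) \ S, ∫⁻ x in S, (edist x y ^ n)⁻¹ ∂μ ∂μ ≤
      ENNReal.ofReal τ * ballDensity μ x₀ r₀ * μ (closedBall x₀ (2 * r₀))) :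
    ‖∫ x in S, nearField μ S x₀ r₀ x ∂μ‖ ≤
      τ * (μ.real (closedBall x₀ r₀) / r₀ ^ n) * μ.real (closedBall x₀ (2 * r₀)) := by
  have hk : ∀ x y : Euc n, ‖rieszKernel (x - y)‖ₑ ≤ (edist x y ^ n)⁻¹ := by
    intro x y
    rcases eq_or_ne x y with rfl | hxy
    · rw [sub_self, rieszKernel_zero, enorm_zero]
      exact zero_le
    · have hd : 0 < ‖x - y‖ := norm_pos_iff.2 (sub_ne_zero.2 hxy)
      rw [edist_dist, dist_eq_norm, ← ENNReal.ofReal_pow hd.le,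
        ← ENNReal.ofReal_inv_of_pos (by positivity), ← ofReal_norm, norm_rieszKernel_rpow _ hn,
        Real.rpow_neg hd.le, Real.rpow_natCast]
  have h1 : ‖∫ x in S, nearField μ S x₀ r₀ x ∂μ‖ₑ ≤
      ENNReal.ofReal τ * ballDensity μ x₀ r₀ * μ (closedBall x₀ (2 * r₀)) := by
    calc _ ≤ ∫⁻ x in S, ‖nearField μ S x₀ r₀ x‖ₑ ∂μ := enorm_integral_le_lintegral_enorm _
      _ ≤ ∫⁻ x in S, ∫⁻ y in closedBall x₀ (2 * r₀) \ S, (edist x y ^ n)⁻¹ ∂μ ∂μ :=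
          lintegral_mono fun x => (enorm_integral_le_lintegral_enorm _).trans
            (lintegral_mono fun y => hk x y)
      _ = ∫⁻ y in closedBall x₀ (2 * r₀) \ S, ∫⁻ x in S, (edist x y ^ n)⁻¹ ∂μ ∂μ :=
          lintegral_lintegral_swap (Measurable.aemeasurable
            ((measurable_edist.pow_const n).inv))
      _ ≤ _ := hint
  rw [← ofReal_norm, ENNReal.ofReal_le_iff_le_toReal (ENNReal.mul_ne_top (ENNReal.mul_ne_top
    ENNReal.ofReal_ne_top (ballDensity_ne_top x₀ hr₀)) measure_closedBall_lt_top.ne)] at h1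
  refine h1.trans (le_of_eq ?_)
  rw [ENNReal.toReal_mul, ENNReal.toReal_mul, ENNReal.toReal_ofReal hτ.le,
    toReal_ballDensity x₀ hr₀]
  rfl

lemma norm_nearField_le (hn : 1 ≤ n) {x₁ : Euc n} {R : ℝ} (hR : 0 < R)
    (hfree : μ (ball x₁ (2 * R) \ S) = 0) {x : Euc n} (hx : x ∈ ball x₁ R) :
    ‖nearField μ S x₀ r₀ x‖ ≤ (R ^ n)⁻¹ * μ.real (closedBall x₀ (2 * r₀)) := by
  have hfin : IsFiniteMeasure (μ.restrict (closedBall x₀ (2 * r₀) \ S)) :=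
    isFiniteMeasure_restrict sdiff_subset
  have hae : ∀ᵐ y ∂μ.restrict (closedBall x₀ (2 * r₀) \ S), ‖rieszKernel (x - y)‖ ≤ (R ^ n)⁻¹ := by
    have h1 : ∀ᵐ y ∂μ.restrict Sᶜ, y ∉ ball x₁ (2 * R) := by
      rw [ae_iff]
      simp only [not_not]
      have : {a | a ∈ ball x₁ (2 * R)} = ball x₁ (2 * R) := rfl
      rw [this, Measure.restrict_apply measurableSet_ball, ← sdiff_eq, hfree]
    have h2 : ∀ᵐ y ∂μ.restrict (closedBall x₀ (2 * r₀) \ S), y ∉ ball x₁ (2 * R) :=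
      ae_mono (Measure.restrict_mono (fun y hy => hy.2) le_rfl) h1
    filter_upwards [h2] with y hy
    have hd : R ≤ ‖x - y‖ := by
      rw [mem_ball, not_lt] at hy
      rw [mem_ball] at hx
      have := dist_triangle y x x₁
      rw [← dist_eq_norm, dist_comm]
      linarith
    rw [norm_rieszKernel_rpow _ hn, Real.rpow_neg (norm_nonneg _), Real.rpow_natCast]
    gcongr
  refine (norm_integral_le_of_norm_le_const hae).trans ?_
  rw [measureReal_restrict_apply_univ]
  gcongr
  · exact measure_closedBall_lt_top.ne
  · exact sdiff_subset

/-- The bound for the external field relative to the density of `B₀`, where `q` is the ratio of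
the radius of `B₀` and the radius of the ball in which the field is free of sources. -/
def fieldConst (n : ℕ) (C τ q : ℝ) : ℝ :=
  2 * (2 * (n + 2) * 16 ^ (n + 1) * C) + 2 ^ (n + 1) * C * q ^ n + 2 ^ (n + 1) * C * τ

/-- The oscillation of the Riesz transform on `S` is the field of the restriction of `μ` to `S` in
an external field that is bounded in terms of the density of `B₀` near the point `x₁`. -/
theorem exists_isExternalField (hn : 1 ≤ n) (hr₀ : 0 < r₀) (hC : 0 < C)
    (hP : IsPDoubling μ C x₀ r₀) (hS : MeasurableSet S) (hSX : S ⊆ closedBall x₀ (3 / 2 * r₀))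
    (hBS : μ (closedBall x₀ r₀) ≤ μ S) (hB0 : 0 < μ.real (closedBall x₀ r₀))
    (hM : μ.restrict (closedBall x₀ (2 * r₀)) ≤ M • volume) {τ : ℝ} (hτ : 0 < τ)
    (hint : ∫⁻ y in closedBall x₀ (2 * r₀) \ S, ∫⁻ x in S, (edist x y ^ n)⁻¹ ∂μ ∂μ ≤
      ENNReal.ofReal τ * ballDensity μ x₀ r₀ * μ (closedBall x₀ (2 * r₀)))
    {x₁ : Euc n} (hx₁ : x₁ ∈ closedBall x₀ r₀) {R : ℝ} (hR : 0 < R) (hRr : R ≤ 3 / 4 * r₀)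
    (hfree : μ (ball x₁ (2 * R) \ S) = 0) :
    ∃ (H : Euc n → Euc n) (CH : ℝ), Measurable H ∧ (∀ x, ‖H x‖ ≤ CH) ∧ IsExternalField H x₁ R ∧
      (∀ x ∈ ball x₁ R, ‖H x‖ ≤
        fieldConst n C τ (r₀ / R) * (μ.real (closedBall x₀ r₀) / r₀ ^ n)) ∧
      ∀ x ∈ S, rieszOscillation μ S x = field (μ.restrict S) H univ x := by
  set T := μ.real (closedBall x₀ r₀) / r₀ ^ n with hT
  have hT0 : 0 < T := by positivity
  set X := closedBall x₀ (7 / 4 * r₀) with hX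
  have hSX' : S ⊆ X := hSX.trans (closedBall_subset_closedBall (by linarith))
  have hSN : S ⊆ closedBall x₀ (2 * r₀) :=
    hSX.trans (closedBall_subset_closedBall (by linarith))
  have hfin : IsFiniteMeasure (μ.restrict S) := isFiniteMeasure_restrict hSN
  have hSfin : μ S ≠ ⊤ := ((measure_mono hSN).trans_lt measure_closedBall_lt_top).ne
  have hS0 : 0 < μ.real S := hB0.trans_le (ENNReal.toReal_mono hSfin hBS)
  have hUX : ball x₁ R ⊆ X := fun y hy => by
    rw [mem_ball] at hy
    rw [mem_closedBall] at hx₁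
    rw [hX, mem_closedBall]
    have := dist_triangle y x₁ x₀
    linarith
  have hfinN : IsFiniteMeasure (μ.restrict (closedBall x₀ (2 * r₀) \ S)) :=
    isFiniteMeasure_restrict sdiff_subset
  have hN := measure_real_two_mul_le hr₀ hC hP
  have hcont := continuousOn_outerField (S := S) hn hr₀ hP hM
  set m := ⨍ z in S, outerField μ S x₀ r₀ z ∂μ with hm
  set a := 2 * (n + 2) * 16 ^ (n + 1) * C with ha
  have hfar : ∀ x ∈ X, ‖farField μ x₀ r₀ x‖ ≤ a * T := fun x hx => norm_farField_le hr₀ hC hP hx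
  have hmle : ‖m‖ ≤ a * T + 2 ^ (n + 1) * C * τ * T := by
    have inear : IntegrableOn (nearField μ S x₀ r₀) S μ :=
      ((continuous_integral_rieszKernel hn
        (restrict_le_smul_of_subset hM sdiff_subset)).continuousOn.integrableOn_compact
          (isCompact_closedBall x₀ (2 * r₀))).mono_set hSN
    have ifar : IntegrableOn (farField μ x₀ r₀) S μ :=
      ((continuousOn_farField hr₀ hP).integrableOn_compact (isCompact_closedBall _ _)).mono_set hSX'
    have h1 : ‖∫ z in S, outerField μ S x₀ r₀ z ∂μ‖ ≤
        (a * T + 2 ^ (n + 1) * C * τ * T) * μ.real S := by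
      unfold outerField
      rw [integral_add inear ifar]
      refine (norm_add_le _ _).trans ?_
      have h2 := norm_setIntegral_nearField_le hn hr₀ hτ hint
      have h3 : ‖∫ z in S, farField μ x₀ r₀ z ∂μ‖ ≤ a * T * μ.real S :=
        norm_setIntegral_le_of_norm_le_const (lt_top_iff_ne_top.2 hSfin) fun x hx =>
          hfar x (hSX' hx)
      have h4 : τ * T * μ.real (closedBall x₀ (2 * r₀)) ≤
          τ * T * (2 ^ (n + 1) * C * μ.real S) := by
        have : μ.real (closedBall x₀ r₀) ≤ μ.real S := ENNReal.toReal_mono hSfin hBS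
        refine mul_le_mul_of_nonneg_left (hN.trans ?_) (by positivity)
        gcongr
      linarith
    rw [hm, setAverage_eq, norm_smul, norm_inv, Real.norm_of_nonneg hS0.le, inv_mul_le_iff₀ hS0]
    linarith
  -- the external field is cut off outside `X`, which contains `S`, to make it bounded
  set H : Euc n → Euc n := X.indicator fun x => outerField μ S x₀ r₀ x - m with hH
  have hHc : ContinuousOn (fun x => outerField μ S x₀ r₀ x - m) X := hcont.sub continuousOn_const
  obtain ⟨CH, hCH⟩ := (isCompact_closedBall x₀ (7 / 4 * r₀)).exists_bound_of_continuousOn hHc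
  refine ⟨H, max CH 0, ?_, fun x => ?_, ?_, fun x hx => ?_, fun x hx => ?_⟩
  · classical
    rw [hH, ← piecewise_eq_indicator]
    exact hHc.measurable_piecewise continuousOn_const measurableSet_closedBall
  · by_cases hx : x ∈ X
    · rw [hH, indicator_of_mem hx]
      exact le_max_of_le_left (hCH x hx)
    · rw [hH, indicator_of_notMem hx, norm_zero]
      exact le_max_right _ _
  · have hnear : IsExternalField (nearField μ S x₀ r₀) x₁ R := by
      refine isExternalField_near hn (restrict_le_smul_of_subset hM sdiff_subset) ?_
      have h1 : ∀ᵐ y ∂μ.restrict Sᶜ, y ∉ ball x₁ R := by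
        rw [ae_iff]
        simp only [not_not]
        have : {a | a ∈ ball x₁ R} = ball x₁ R := rfl
        rw [this, Measure.restrict_apply measurableSet_ball, ← sdiff_eq]
        exact measure_mono_null (sdiff_subset_sdiff_left (ball_subset_ball (by linarith))) hfree
      exact ae_mono (Measure.restrict_mono (fun y hy => hy.2) le_rfl) h1
    refine ((hnear.add (isExternalField_farField hn hr₀ hP hUX)).add
      (isExternalField_const (-m) x₁ R)).congr fun x hx => ?_
    rw [hH, indicator_of_mem (hUX hx), sub_eq_add_neg, outerField]
  · rw [hH, indicator_of_mem (hUX hx), outerField]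
    have h1 := norm_nearField_le (x₀ := x₀) (r₀ := r₀) hn hR hfree hx
    have h2 := hfar x (hUX hx)
    have h3 : (R ^ n)⁻¹ * μ.real (closedBall x₀ (2 * r₀)) ≤
        2 ^ (n + 1) * C * (r₀ / R) ^ n * T := by
      calc _ ≤ (R ^ n)⁻¹ * (2 ^ (n + 1) * C * μ.real (closedBall x₀ r₀)) := by gcongr
        _ = _ := by rw [hT, div_pow]; field_simp
    have h4 := norm_sub_le (nearField μ S x₀ r₀ x + farField μ x₀ r₀ x) m
    have h5 := norm_add_le (nearField μ S x₀ r₀ x) (farField μ x₀ r₀ x)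
    rw [fieldConst, ← ha]
    linarith
  · rw [rieszOscillation_eq_add_sub hn hr₀ hP hS hSX'
      (fun h => hS0.ne' (by rw [Measure.real, h, ENNReal.toReal_zero])) hM (hSX' hx), field, hH,
      indicator_of_mem (hSX' hx), Measure.restrict_univ, add_comm]

end

lemma isGoodBall_restrict {μ : Measure (Euc n)} {C : ℝ} {x : Euc n} {r : ℝ} {S : Set (Euc n)}
    (hfree : μ (closedBall x r \ S) = 0) (h : IsGoodBall μ C x r) :
    IsGoodBall (μ.restrict S) C x r := by
  have e : (μ.restrict S).restrict (closedBall x r) = μ.restrict (closedBall x r) := by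
    rw [Measure.restrict_restrict measurableSet_closedBall]
    refine Measure.restrict_congr_set (ae_eq_set.2 ⟨?_, by rwa [sdiff_self_inter]⟩)
    rw [sdiff_eq_empty.2 inter_subset_left, measure_empty]
  have e' : μ.restrict S (closedBall x r) = μ (closedBall x r) := by
    rw [← Measure.restrict_apply_univ (μ := μ.restrict S), e, Measure.restrict_apply_univ]
  unfold IsGoodBall ballDensity
  rw [e, e']
  exact h

/-! ### The choice of the constants -/

/-- The square root of the lower bound for the normalized energy, in terms of a lower bound `d`
for the ratio of the radii of `B₁` and `B₀`. -/
def energyConst (n : ℕ) (α d : ℝ) : ℝ :=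
  min 1 (min (levelConst n α ^ 2 * α * d ^ n / 2)
    (2 * wmass n * levelConst n α ^ 2 * d ^ n / (powConst n n * (2 ^ (n + 1) / d + 1))))

lemma energyConst_pos (n : ℕ) {α d : ℝ} (hα : 0 < α) (hd : 0 < d) : 0 < energyConst n α d := by
  have := levelConst_pos n hα
  have := wmass_pos n
  have := powConst_pos n n
  exact lt_min one_pos (lt_min (by positivity) (by positivity))

lemma energyConst_le_one (n : ℕ) (α d : ℝ) : energyConst n α d ≤ 1 := min_le_left _ _

lemma two_mul_energyConst_sq_le (n : ℕ) {α d R r₀ r₁ : ℝ} (hα : 0 < α) (hd : 0 < d)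
    (hR0 : 0 ≤ R) (hR : R ≤ r₀) (hr₁ : d * r₀ ≤ r₁) :
    2 * energyConst n α d ^ 2 * R ^ n ≤ levelConst n α ^ 2 * α * r₁ ^ n := by
  have h0 := energyConst_pos n hα hd
  have h1 := energyConst_le_one n α d
  have h2 : energyConst n α d ≤ levelConst n α ^ 2 * α * d ^ n / 2 :=
    (min_le_right _ _).trans (min_le_left _ _)
  have hr₀ : 0 ≤ r₀ := hR0.trans hR
  calc 2 * energyConst n α d ^ 2 * R ^ n ≤ 2 * energyConst n α d * r₀ ^ n := by
        gcongr
        nlinarith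
    _ ≤ 2 * (levelConst n α ^ 2 * α * d ^ n / 2) * r₀ ^ n := by gcongr
    _ = levelConst n α ^ 2 * α * (d * r₀) ^ n := by rw [mul_pow]; ring
    _ ≤ _ := by gcongr

/-- The bound `C ≤ 1 / d` keeps the constant independent of the doubling constant `C`. -/
lemma powConst_mul_energyConst_le (n : ℕ) {α d C R r₀ r₁ : ℝ} (hα : 0 < α) (hd : 0 < d)
    (hR0 : 0 < R) (hR : R ≤ r₀) (hr₁ : d * r₀ ≤ r₁) (hC : 0 < C) (hCd : C ≤ 1 / d) :
    powConst n n * (energyConst n α d * (2 ^ (n + 1) * C * (r₀ / R) ^ n + 1) * R ^ n) ≤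
      2 * wmass n * levelConst n α ^ 2 * r₁ ^ n := by
  have hw := wmass_pos n
  have hp := powConst_pos n n
  have h0 := energyConst_pos n hα hd
  have h2 : energyConst n α d ≤
      2 * wmass n * levelConst n α ^ 2 * d ^ n / (powConst n n * (2 ^ (n + 1) / d + 1)) :=
    (min_le_right _ _).trans (min_le_right _ _)
  rw [le_div_iff₀ (by positivity)] at h2
  have hr₀ : 0 < r₀ := hR0.trans_le hR
  calc _ = powConst n n * (energyConst n α d * (2 ^ (n + 1) * C * r₀ ^ n + R ^ n)) := by
        rw [div_pow]; field_simp
    _ ≤ powConst n n * (energyConst n α d * (2 ^ (n + 1) * (1 / d) * r₀ ^ n + r₀ ^ n)) := by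
        gcongr
    _ = energyConst n α d * (powConst n n * (2 ^ (n + 1) / d + 1)) * r₀ ^ n := by ring
    _ ≤ 2 * wmass n * levelConst n α ^ 2 * d ^ n * r₀ ^ n := by gcongr
    _ = 2 * wmass n * levelConst n α ^ 2 * (d * r₀) ^ n := by rw [mul_pow]; ring
    _ ≤ _ := by gcongr

/-- If many of the balls `2 ^ j B₁`, `j ≤ N`, are good, then so are many of those with
`j ≤ N - k`. -/
lemma exists_finset_of_ncard_ge {p : ℕ → Prop} {η : ℝ} (hη : 0 < η) {N k m : ℕ}
    (hN : ((m + k : ℕ) : ℝ) / η ≤ N) (h : η * N ≤ ({j : ℕ | j ≤ N ∧ p j}.ncard : ℝ)) :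
    ∃ G : Finset ℕ, (∀ j ∈ G, j ≤ N - k) ∧ (∀ j ∈ G, p j) ∧ m ≤ G.card := by
  classical
  refine ⟨(Finset.range (N - k + 1)).filter p, fun j hj => ?_, fun j hj => ?_, ?_⟩
  · have := Finset.mem_range.1 (Finset.mem_filter.1 hj).1
    omega
  · exact (Finset.mem_filter.1 hj).2
  · have h1 : {j : ℕ | j ≤ N ∧ p j} ⊆
        ↑((Finset.range (N - k + 1)).filter p ∪ Finset.Ioc (N - k) N) := by
      rintro j ⟨hj, hpj⟩
      simp only [Finset.coe_union, Finset.coe_filter, Finset.mem_range, Finset.coe_Ioc]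
      by_cases hjk : j ≤ N - k
      · exact Or.inl ⟨by omega, hpj⟩
      · exact Or.inr ⟨by omega, hj⟩
    have h2 := Set.ncard_le_ncard h1 (Finset.finite_toSet _)
    rw [Set.ncard_coe_finset] at h2
    have h3 := h2.trans (Finset.card_union_le _ _)
    rw [Nat.card_Ioc] at h3
    have h4 : m + k ≤ {j : ℕ | j ≤ N ∧ p j}.ncard := by
      rw [div_le_iff₀ hη] at hN
      have : ((m + k : ℕ) : ℝ) ≤ ({j : ℕ | j ≤ N ∧ p j}.ncard : ℝ) := by linarith
      exact_mod_cast this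
    omega

lemma pow_floor_logb_mul_le {r₀ r₁ : ℝ} (hr₁ : 0 < r₁) (h : r₁ ≤ r₀) :
    2 ^ ⌊Real.logb 2 (r₀ / r₁)⌋₊ * r₁ ≤ r₀ := by
  have h1 : 1 ≤ r₀ / r₁ := by rwa [le_div_iff₀ hr₁, one_mul]
  have h2 := Nat.floor_le (Real.logb_nonneg (by norm_num : (1 : ℝ) < 2) h1)
  rw [Real.le_logb_iff_rpow_le (by norm_num) (by linarith), Real.rpow_natCast,
    le_div_iff₀ hr₁] at h2
  exact h2

lemma le_floor_logb {r₀ r₁ : ℝ} (hr₀ : 0 < r₀) (hr₁ : 0 < r₁) {N : ℕ} (h : 2 ^ N * r₁ ≤ r₀) :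
    N ≤ ⌊Real.logb 2 (r₀ / r₁)⌋₊ := by
  refine Nat.le_floor ?_
  rw [Real.le_logb_iff_rpow_le (by norm_num) (by positivity), Real.rpow_natCast,
    le_div_iff₀ hr₁]
  exact h

/-- The lower bound for a fixed configuration, for a source-free radius `R = ρ r₀ / 2`. -/
theorem le_lintegral_rieszOscillation (hn : 1 ≤ n) {α C₂ C₀ τ η ρ d : ℝ} (hα : 0 < α)
    (hC₂ : 0 < C₂) (hC₀ : 0 < C₀) (hτ : 0 < τ) (hη : 0 < η) (hρ : 0 < ρ) (hρ1 : ρ ≤ 1)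
    (hd : 0 < d) (hdC : C₀ ≤ 1 / d) (hdρ : d ≤ ρ) {m k : ℕ}
    (hm : (1 - decayConst n C₂ / 3) ^ m *
      topConst n (fieldConst n C₀ τ (2 / ρ)) (2 ^ (n + 1) * C₀ * (2 / ρ) ^ n) ^ 6 ≤
        levelConst n α ^ 6)
    (hk : 128 / ρ ≤ 2 ^ k) {μ : Measure (Euc n)} [IsLocallyFiniteMeasure μ] {S : Set (Euc n)}
    {x₀ x₁ : Euc n} {r₀ r₁ : ℝ} (hr₀ : 0 < r₀) (hP : IsPDoubling μ C₀ x₀ r₀)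
    (hS : MeasurableSet S) (hSX : S ⊆ closedBall x₀ (3 / 2 * r₀))
    (hBS : μ (closedBall x₀ r₀) ≤ μ S) {M : ℝ≥0}
    (hM : μ.restrict (closedBall x₀ (2 * r₀)) ≤ M • volume)
    (hx₁ : x₁ ∈ closedBall x₀ r₀) (hdr : d * r₀ ≤ r₁) (hr₁r₀ : r₁ ≤ r₀)
    (hdens : ENNReal.ofReal α * ballDensity μ x₀ r₀ ≤ ballDensity μ x₁ r₁)
    (hfree : μ (closedBall x₁ (ρ * r₀) \ S) = 0)
    (hN : ((m + k : ℕ) : ℝ) / η ≤ ⌊Real.logb 2 (r₀ / r₁)⌋₊)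
    (hkN : k ≤ ⌊Real.logb 2 (r₀ / r₁)⌋₊)
    (hgood : η * (⌊Real.logb 2 (r₀ / r₁)⌋₊ : ℝ) ≤
        ({j : ℕ | j ≤ ⌊Real.logb 2 (r₀ / r₁)⌋₊ ∧ IsGoodBall μ C₂ x₁ (2 ^ j * r₁)}.ncard : ℝ))
    (hint : ∫⁻ y in closedBall x₀ (2 * r₀) \ S, ∫⁻ x in S, (edist x y ^ n)⁻¹ ∂μ ∂μ ≤
      ENNReal.ofReal τ * ballDensity μ x₀ r₀ * μ (closedBall x₀ (2 * r₀))) :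
    ENNReal.ofReal (energyConst n α d ^ 2 * (d / 2) ^ n) * ballDensity μ x₀ r₀ ^ 2 *
      μ (closedBall x₀ r₀) ≤ ∫⁻ x in S, ‖rieszOscillation μ S x‖ₑ ^ 2 ∂μ := by
  have hBfin : μ (closedBall x₀ r₀) ≠ ⊤ := measure_closedBall_lt_top.ne
  -- if `B₀` has no mass, the left side vanishes
  rcases eq_or_ne (μ (closedBall x₀ r₀)) 0 with h0 | h0
  · rw [h0, mul_zero]
    exact zero_le
  have hB0 : 0 < μ.real (closedBall x₀ r₀) := ENNReal.toReal_pos h0 hBfin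
  have hr₁ : 0 < r₁ := lt_of_lt_of_le (by positivity) hdr
  set T := μ.real (closedBall x₀ r₀) / r₀ ^ n with hT
  have hT0 : 0 < T := by positivity
  set R := ρ / 2 * r₀ with hRdef
  have hR : 0 < R := by positivity
  have hRr : R ≤ r₀ / 2 := by rw [hRdef]; nlinarith
  have hq : r₀ / R = 2 / ρ := by rw [hRdef]; field_simp
  have hfree' : ∀ r ≤ ρ * r₀, μ (closedBall x₁ r \ S) = 0 := fun r hr =>
    measure_mono_null (sdiff_subset_sdiff_left (closedBall_subset_closedBall hr)) hfree
  obtain ⟨H, CH, hH, hHb, hE, hHB, hosc⟩ := exists_isExternalField hn hr₀ hC₀ hP hS hSX hBS hB0 hM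
    hτ hint hx₁ hR (by linarith) (measure_mono_null (sdiff_subset_sdiff_left
      (ball_subset_closedBall.trans (closedBall_subset_closedBall (by rw [hRdef]; linarith))))
      hfree)
  rw [hq] at hHB
  have hSN : S ⊆ closedBall x₀ (2 * r₀) :=
    hSX.trans (closedBall_subset_closedBall (by linarith))
  have hfin : IsFiniteMeasure (μ.restrict S) := isFiniteMeasure_restrict hSN
  have hσ := restrict_le_smul_of_subset hM hSN
  set N := ⌊Real.logb 2 (r₀ / r₁)⌋₊ with hNdef
  obtain ⟨G, hG1, hG2, hG3⟩ := exists_finset_of_ncard_ge hη hN hgood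
  have hJ : 2 ^ (N - k) * r₁ ≤ ρ * r₀ / 128 := by
    have h1 := pow_floor_logb_mul_le hr₁ hr₁r₀
    rw [← hNdef, ← Nat.sub_add_cancel hkN, pow_add] at h1
    rw [div_le_iff₀ hρ] at hk
    have h2 : (0 : ℝ) ≤ 2 ^ (N - k) * r₁ := by positivity
    nlinarith
  have hpow : ∀ j ≤ N - k, 2 ^ j * r₁ ≤ ρ * r₀ := fun j hj => by
    have : (2 : ℝ) ^ j ≤ 2 ^ (N - k) := pow_le_pow_right₀ (by norm_num) hj
    have : 0 < ρ * r₀ := by positivity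
    nlinarith
  have hr₁ρ : r₁ ≤ ρ * r₀ := by simpa using hpow 0 (Nat.zero_le _)
  have hdens' : α * T * r₁ ^ n ≤ (μ.restrict S).real (closedBall x₁ r₁) := by
    have h1 : (μ.restrict S).real (closedBall x₁ r₁) = μ.real (closedBall x₁ r₁) := by
      rw [measureReal_restrict_apply measurableSet_closedBall]
      have := measureReal_inter_add_sdiff (μ := μ) (s := closedBall x₁ r₁) hS
        measure_closedBall_lt_top.ne
      rw [measureReal_def μ (closedBall x₁ r₁ \ S), hfree' r₁ hr₁ρ, ENNReal.toReal_zero,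
        add_zero] at this
      exact this
    have h2 := ENNReal.toReal_mono (ballDensity_ne_top x₁ hr₁) hdens
    rw [ENNReal.toReal_mul, ENNReal.toReal_ofReal hα.le, toReal_ballDensity x₀ hr₀,
      toReal_ballDensity x₁ hr₁, le_div_iff₀ (by positivity)] at h2
    rw [h1]
    exact h2
  have hmass : (μ.restrict S).real univ ≤ 2 ^ (n + 1) * C₀ * (2 / ρ) ^ n * T * R ^ n := by
    rw [measureReal_restrict_apply_univ]
    have h1 : μ.real S ≤ μ.real (closedBall x₀ (2 * r₀)) :=
      measureReal_mono hSN measure_closedBall_lt_top.ne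
    refine (h1.trans (measure_real_two_mul_le hr₀ hC₀ hP)).trans (le_of_eq ?_)
    rw [← hq, hT, div_pow]
    field_simp
  have key := lt_energy hn hσ hH hHb hE (T := T) (α := α) (r₁ := r₁) (C₂ := C₂)
    (B := fieldConst n C₀ τ (2 / ρ)) (L := 2 ^ (n + 1) * C₀ * (2 / ρ) ^ n)
    (ε := energyConst n α d) hr₁ hR hT0 hα (by positivity) hC₂ hHB hmass hdens'
    (J := N - k) (by rw [hRdef]; linarith) hG1
    (fun j hj => isGoodBall_restrict (hfree' _ (hpow j (hG1 j hj))) (hG2 j hj)) ?_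
    (energyConst_pos n hα hd) (energyConst_le_one n α d)
    (two_mul_energyConst_sq_le n hα hd hR.le (by linarith) hdr)
    (by rw [← hq]; exact powConst_mul_energyConst_le n hα hd hR (by linarith) hdr hC₀ hdC)
  · -- translate the bound to the extended nonnegative reals
    have hfm := measurable_field hn hσ hH univ
    have hfb := norm_field_le hn hσ hHb univ
    have hi : Integrable (fun x => ‖field (μ.restrict S) H univ x‖ ^ 2) (μ.restrict S) :=
      Integrable.of_bound (hfm.norm.pow_const 2).aestronglyMeasurable
        ((CH + (M * powConst n n + (μ.restrict S).real univ)) ^ 2)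
        (Eventually.of_forall fun y => by rw [norm_pow, norm_norm]; gcongr; exact hfb y)
    have e1 : ∫⁻ x in S, ‖rieszOscillation μ S x‖ₑ ^ 2 ∂μ =
        ENNReal.ofReal (energy (μ.restrict S) H univ) := by
      rw [energy, Measure.restrict_univ, ofReal_integral_eq_lintegral_ofReal hi
        (Eventually.of_forall fun x => by positivity)]
      refine setLIntegral_congr_fun hS fun x hx => ?_
      rw [hosc x hx, ENNReal.ofReal_pow (norm_nonneg _), ofReal_norm]
    have e2 : ENNReal.ofReal (energyConst n α d ^ 2 * (d / 2) ^ n) * ballDensity μ x₀ r₀ ^ 2 *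
        μ (closedBall x₀ r₀) = ENNReal.ofReal (energyConst n α d ^ 2 * (d / 2) ^ n * T ^ 2 *
          μ.real (closedBall x₀ r₀)) := by
      conv_rhs => rw [ENNReal.ofReal_mul (by positivity), ENNReal.ofReal_mul (by positivity),
        ENNReal.ofReal_pow hT0.le, ofReal_measureReal hBfin, hT, ← toReal_ballDensity x₀ hr₀,
        ENNReal.ofReal_toReal (ballDensity_ne_top x₀ hr₀)]
    rw [e1, e2]
    refine ENNReal.ofReal_le_ofReal (le_trans ?_ key.le)
    have hBT : μ.real (closedBall x₀ r₀) = T * r₀ ^ n := by rw [hT]; field_simp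
    calc _ = energyConst n α d ^ 2 * T ^ 3 * (d / 2 * r₀) ^ n := by
          rw [hBT, mul_pow (d / 2)]; ring
      _ ≤ _ := by rw [hRdef]; gcongr
  · refine le_trans (mul_le_mul_of_nonneg_right (pow_le_pow_of_le_one ?_ ?_ hG3) ?_) hm
    · linarith [decayConst_le n C₂]
    · linarith [decayConst_pos n hC₂]
    · positivity

end RieszLowerBound

end

theorem mainTheorem7 (n : ℕ) (hn : 1 ≤ n) (α : ℝ) (hα : 0 < α) (C₂ : ℝ) (hC₂ : 0 < C₂) :
    -- `c₁ δ₀` depends on `n`, `α`, `C₂`, `δ₀` only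
    ∃ c₁ : ℝ → ℝ, (∀ δ₀ : ℝ, 0 < δ₀ → 0 < c₁ δ₀) ∧
    ∀ C₀ τ η ρ : ℝ, 0 < C₀ → 0 < τ → 0 < η → 0 < ρ →
    -- `δ₁` has to be small, depending on `n`, `α`, `C₂`, `C₀`, `τ`, `η`, `ρ`
    ∃ δ : ℝ, 0 < δ ∧ δ < 1 / 2 ∧
    ∀ δ₀ δ₁ : ℝ, 0 < δ₀ → 0 < δ₁ → δ₁ ≤ δ →
    ∀ (μ : Measure (Euc n)) [IsLocallyFiniteMeasure μ] (D : DavidMattilaLattice μ)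
      (x₀ : Euc n) (r₀ : ℝ) (x₁ : Euc n) (r₁ : ℝ),
      0 < r₀ →
      -- `B₀ = B(x₀, r₀)` is `(P_μ, C₀)`-doubling
      IsPDoubling μ C₀ x₀ r₀ →
      -- `μ = h 𝓛^{n+1}` in `2B₀` with `h ∈ L^∞(μ)`
      (∃ h : Euc n → ℝ≥0, Measurable h ∧ (∃ M : ℝ≥0, ∀ᵐ x ∂μ, h x ≤ M) ∧
        μ.restrict (closedBall x₀ (2 * r₀)) =
          (volume.restrict (closedBall x₀ (2 * r₀))).withDensity (fun x => (h x : ℝ≥0∞))) →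
      -- `M_n(χ_{3B₀} μ)` and `R_*(χ_{3B₀} μ)` belong to `L²(μ|_{2B₀})`
      (∫⁻ x in closedBall x₀ (2 * r₀),
        maximalDensity (μ.restrict (closedBall x₀ (3 * r₀))) x ^ 2 ∂μ < ∞) →
      (∫⁻ x in closedBall x₀ (2 * r₀),
        rieszMaximal (μ.restrict (closedBall x₀ (3 * r₀))) x ^ 2 ∂μ < ∞) →
      -- the small ball `B₁ = B(x₁, r₁)` centered in `B₀`
      x₁ ∈ closedBall x₀ r₀ →
      δ₀ * r₀ ≤ r₁ → r₁ ≤ δ₁ * r₀ →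
      ENNReal.ofReal α * ballDensity μ x₀ r₀ ≤ ballDensity μ x₁ r₁ →
      -- near the center of `B₁` the support of `μ` is contained in `R₀`
      μ.support ∩ closedBall x₁ (ρ * r₀) ⊆ D.region x₀ r₀ →
      -- at least `η N` of the balls `2^j B₁`, `0 ≤ j ≤ N`, are `(μ, C₂)`-good
      η * (⌊Real.logb 2 (r₀ / r₁)⌋₊ : ℝ) ≤
        ({j : ℕ | j ≤ ⌊Real.logb 2 (r₀ / r₁)⌋₊ ∧ IsGoodBall μ C₂ x₁ (2 ^ j * r₁)}.ncard : ℝ) →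
      -- small interaction through the boundary of `R₀`
      (∫⁻ y in closedBall x₀ (2 * r₀) \ D.region x₀ r₀,
          ∫⁻ x in D.region x₀ r₀, (edist x y ^ n)⁻¹ ∂μ ∂μ ≤
        ENNReal.ofReal τ * ballDensity μ x₀ r₀ * μ (closedBall x₀ (2 * r₀))) →
      ENNReal.ofReal (c₁ δ₀) * ballDensity μ x₀ r₀ ^ 2 * μ (closedBall x₀ r₀) ≤
        ∫⁻ x in D.region x₀ r₀, ‖rieszOscillation μ (D.region x₀ r₀) x‖ₑ ^ 2 ∂μ := by
  have hθ1 : 1 - RieszLowerBound.decayConst n C₂ / 3 < 1 := by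
    linarith [RieszLowerBound.decayConst_pos n hC₂]
  have hζ := RieszLowerBound.levelConst_pos n hα
  refine ⟨fun d => RieszLowerBound.energyConst n α d ^ 2 * (d / 2) ^ n, fun d hd => ?_, ?_⟩
  · have := RieszLowerBound.energyConst_pos n hα hd
    positivity
  intro C₀ τ η ρ hC₀ hτ hη hρ
  obtain ⟨ρ', hρ', hρ'1, hρ'ρ⟩ : ∃ ρ', 0 < ρ' ∧ ρ' ≤ 1 ∧ ρ' ≤ ρ :=
    ⟨min ρ 1, lt_min hρ one_pos, min_le_right _ _, min_le_left _ _⟩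
  set t := RieszLowerBound.topConst n (RieszLowerBound.fieldConst n C₀ τ (2 / ρ'))
    (2 ^ (n + 1) * C₀ * (2 / ρ') ^ n) with ht
  -- `m` good scales bring the excess below the level that can carry the flux
  obtain ⟨m, hm⟩ := exists_pow_lt_of_lt_one
    (show 0 < RieszLowerBound.levelConst n α ^ 6 / (t ^ 6 + 1) by positivity) hθ1
  have hm' : (1 - RieszLowerBound.decayConst n C₂ / 3) ^ m * t ^ 6 ≤
      RieszLowerBound.levelConst n α ^ 6 := by
    have h0 : 0 ≤ (1 - RieszLowerBound.decayConst n C₂ / 3) ^ m :=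
      pow_nonneg (by linarith [RieszLowerBound.decayConst_le n C₂]) _
    rw [lt_div_iff₀ (by positivity)] at hm
    linarith
  -- the `k` largest scales may leave the region without sources
  obtain ⟨k, hk⟩ := pow_unbounded_of_one_lt (128 / ρ') (one_lt_two (α := ℝ))
  obtain ⟨N₀, hN₀⟩ := exists_nat_ge (((m + k : ℕ) : ℝ) / η + k)
  have hkη : 0 ≤ ((m + k : ℕ) : ℝ) / η := by positivity
  refine ⟨min (1 / 4) (min (1 / C₀) (min ρ' (2 ^ N₀)⁻¹)), by positivity,
    (min_le_left _ _).trans_lt (by norm_num), ?_⟩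
  intro δ₀ δ₁ hδ₀ hδ₁ hδ μ _ D x₀ r₀ x₁ r₁ hr₀ hP hμ _ _ hx₁ hr₁ hr₁' hdens hsupp hgood hint
  obtain ⟨h, hhm, ⟨M, hhM⟩, hμh⟩ := hμ
  have hr₁0 : 0 < r₁ := lt_of_lt_of_le (by positivity) hr₁
  simp only [le_min_iff] at hδ
  obtain ⟨hδ4, hδC, hδρ, hδN⟩ := hδ
  have hδ₀₁ : δ₀ ≤ δ₁ := le_of_mul_le_mul_right (hr₁.trans hr₁') hr₀
  have hN : N₀ ≤ ⌊Real.logb 2 (r₀ / r₁)⌋₊ := by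
    refine RieszLowerBound.le_floor_logb hr₀ hr₁0 ?_
    have : r₁ ≤ (2 ^ N₀)⁻¹ * r₀ := hr₁'.trans (by gcongr)
    rwa [inv_mul_eq_div, le_div_iff₀ (by positivity), mul_comm] at this
  have hN' : (N₀ : ℝ) ≤ (⌊Real.logb 2 (r₀ / r₁)⌋₊ : ℝ) := by exact_mod_cast hN
  refine RieszLowerBound.le_lintegral_rieszOscillation hn hα hC₂ hC₀ hτ hη hρ' hρ'1 hδ₀ ?_ ?_ hm'
    hk.le hr₀ hP (RieszLowerBound.measurableSet_region D x₀ r₀)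
    (RieszLowerBound.region_subset_closedBall D x₀ r₀)
    (RieszLowerBound.measure_closedBall_le_region D x₀ hr₀)
    (RieszLowerBound.le_smul_of_withDensity hhm hhM hμh) hx₁ hr₁ ?_ hdens ?_ ?_ ?_ hgood hint
  · rw [le_div_iff₀ hC₀] at hδC
    rw [le_div_iff₀ hδ₀]
    nlinarith
  · linarith
  · nlinarith
  · have h0 : μ μ.supportᶜ = 0 := Measure.support_mem_ae
    refine measure_mono_null (t := μ.supportᶜ) ?_ h0
    intro y hy hys
    exact hy.2 (hsupp ⟨hys, closedBall_subset_closedBall (by gcongr) hy.1⟩)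
  · linarith
  · have : (k : ℝ) ≤ N₀ := by linarith
    exact (Nat.cast_le.1 this).trans hN
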